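/- **Conventions.** For $A\subset\mathbb{R}^d$ let $\operatorname{Unp}A$ be the set of points of $\mathbb{R}^d$ having a unique nearest point in $A$. For $a\in A$ put $\operatorname{reach}(A,a)=\sup\{r\ge 0: B(a,r)\subset\operatorname{Unp}A\}$, where $B(a,r)$ is the open ball and $B(a,0)=\emptyset$, and put $\operatorname{reach}A=\inf_{a\in A}\operatorname{reach}(A,a)$; $A$ has *positive reach* if $\operatorname{reach}A>0$. The tangent cone $\operatorname{Tan}(A,a)$ consists of $0$ and of all limits of $r_i(a_i-a)$ with $r_i>0$, $a\neq a_i\in A$, $a_i\to a$. Its dimension is that of its linear span, and $T_k(A)$ is the set of all $a\in A$ with $\dim\operatorname{Tan}(A,a)=k$. The dimension of the set $A$ itself is its topological (covering) dimension. For a unit vector $u\in\mathbb{R}^d$ and $f:u^\perp\to\mathbb{R}$ let $\operatorname{hyp}_uf=\{w+tu: w\in u^\perp,\ t\le f(w)\}$. The function $f$ is *semiconcave* if $f-\frac c2|\cdot|^2$ is concave on $u^\perp$ for some $c\ge 0$. A *convex body* in $\mathbb{R}^k$ is a compact convex set with nonempty interior. A mapping $\Phi:U\to\mathbb{R}^d$,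 $U\subset\mathbb{R}^d$, is a *$C^{1,1}$-diffeomorphism* if it is injective, $U$ and $\Phi(U)$ are open, and both $\Phi$ and $\Phi^{-1}$ are differentiable with Lipschitz Fréchet derivative on their domains. **Proposition.** Let $d\ge 1$, let $A\subset\mathbb{R}^d$ have positive reach and let $a\in T_d(A)\cap\partial A$. Then: (i) If $d\ge 2$, there exist $\varepsilon>0$, a unit vector $u\in\mathbb{R}^d$ and a Lipschitz semiconcave function $f:u^\perp\to\mathbb{R}$ such that $$A\cap B(a,\varepsilon)=\operatorname{hyp}_uf\cap B(a,\varepsilon).$$ (ii) There exist a convex body $K\subset\mathbb{R}^d$ and a surjective $C^{1,1}$-diffeomorphism $\Phi:\mathbb{R}^d\to\mathbb{R}^d$ such that $\Phi(K)$ is a neighbourhood of $a$ in $A$ (that is, $\Phi(K)\subset A$ and $\Phi(K)$ contains a relatively open subset of $A$ containing $a$). **Theorem L (Lytchak).** Let $1\le k\le d$, let $A\subset\mathbb{R}^d$ be a $k$-dimensional set with positive reach, and let $a\in A$ be such that $\dim\operatorname{Tan}(A,a)=k$. Then there exist a convex body $K\subset\mathbb{R}^k$, with $\mathbb{R}^k$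 identified with $\operatorname{span}\{e_1,\dots,e_k\}\subset\mathbb{R}^d$, an open set $U\subset\mathbb{R}^d$ containing $K$, and a $C^{1,1}$-diffeomorphism $\Phi:U\to\mathbb{R}^d$ such that $\Phi(K)$ is a neighbourhood of $a$ in $A$. -/

import Mathlib

open scoped NNReal ENNReal Topology

noncomputable section

namespace PositiveReach

/-- `Unp A`: the points of `ℝᵈ` having a unique nearest point in `A`. -/
def unp {E : Type*} [NormedAddCommGroup E] (A : Set E) : Set E :=
  {z | ∃! p, p ∈ A ∧ ‖z - p‖ = Metric.infDist z A}

/-- The reach of `A` at the point `a`: the supremum of the `r ≥ 0` for which the open ball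
`B(a, r)` is contained in `Unp A` (the value `∞` is possible). -/
def reachAt {E : Type*} [NormedAddCommGroup E] (A : Set E) (a : E) : ℝ≥0∞ :=
  ⨆ (r : ℝ≥0) (_ : Metric.ball a (r : ℝ) ⊆ unp A), (r : ℝ≥0∞)

/-- The reach of `A`: the infimum over `a ∈ A` of the reach of `A` at `a`. -/
def reach {E : Type*} [NormedAddCommGroup E] (A : Set E) : ℝ≥0∞ :=
  ⨅ a ∈ A, reachAt A a

/-- `A` has positive reach. -/
def HasPositiveReach {E : Type*} [NormedAddCommGroup E] (A : Set E) : Prop :=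
  0 < reach A

/-- The set `T_k(A)` of the points of `A` at which the tangent cone of `A` has dimension `k`.
The tangent cone is the one-sided one (limits of `r_i • (a_i - a)` with `a_i ∈ A`, `a_i → a`,
`r_i ≥ 0`), and the dimension of a cone is the dimension of its linear span. -/
def tangentStratum {E : Type*} [NormedAddCommGroup E] [NormedSpace ℝ E] (k : ℕ) (A : Set E) :
    Set E :=
  {a | a ∈ A ∧ Module.finrank ℝ (Submodule.span ℝ (posTangentConeAt A a)) = k}

/-- A real function `f` is semiconcave on the (open convex) set `C` if `f - (c/2)|·|²` is concave
on `C` for some `c ≥ 0`. -/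
def SemiconcaveOn {E : Type*} [NormedAddCommGroup E] [NormedSpace ℝ E] (C : Set E) (f : E → ℝ) :
    Prop :=
  ∃ c : ℝ, 0 ≤ c ∧ ConcaveOn ℝ C (fun x => f x - c / 2 * ‖x‖ ^ 2)

/-- The `u`-hypograph `{w + t u : w ∈ u^⊥, t ≤ f w}` of a function `f` on `u^⊥`. -/
def hypograph {E : Type*} [NormedAddCommGroup E] [InnerProductSpace ℝ E] (u : E)
    (f : (ℝ ∙ u)ᗮ → ℝ) : Set E :=
  {x | ∃ (w : (ℝ ∙ u)ᗮ) (t : ℝ), t ≤ f w ∧ x = (w : E) + t • u}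

/-- A convex body: a compact convex set with nonempty interior. -/
def IsConvexBody {E : Type*} [NormedAddCommGroup E] [NormedSpace ℝ E] (K : Set E) : Prop :=
  IsCompact K ∧ Convex ℝ K ∧ (interior K).Nonempty

/-- `F` is `C^{1,1}` smooth on the open set `U`: it is differentiable there and its Fréchet
derivative is Lipschitz on `U`. -/
def C11On {E F : Type*} [NormedAddCommGroup E] [NormedSpace ℝ E] [NormedAddCommGroup F]
    [NormedSpace ℝ F] (f : E → F) (U : Set E) : Prop :=
  DifferentiableOn ℝ f U ∧ ∃ L : ℝ≥0, LipschitzOnWith L (fderiv ℝ f) U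

/-- `Φ` restricts to a `C^{1,1}`-diffeomorphism on `U`: it is injective on `U`, both `U` and `Φ(U)`
are open, and both `Φ` (on `U`) and its inverse (on `Φ(U)`) are `C^{1,1}` smooth. -/
def IsC11Diffeo {E : Type*} [NormedAddCommGroup E] [NormedSpace ℝ E] (Φ : E → E) (U : Set E) :
    Prop :=
  IsOpen U ∧ Set.InjOn Φ U ∧ IsOpen (Φ '' U) ∧ C11On Φ U ∧
    ∃ Ψ : E → E, Set.LeftInvOn Ψ Φ U ∧ C11On Ψ (Φ '' U)

/-- `N` is a neighbourhood of the point `a` in (the subspace) `A`. -/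
def IsNhdIn {E : Type*} [TopologicalSpace E] (N : Set E) (a : E) (A : Set E) : Prop :=
  a ∈ A ∧ N ⊆ A ∧ N ∈ 𝓝[A] a

/-- The topological (Lebesgue covering) dimension of `X` is at most `n`: every finite open cover of
`X` has a (one-to-one indexed) open refinement such that each point of `X` lies in at most `n + 1`
of its members. -/
def CoveringDimLE (X : Type*) [TopologicalSpace X] (n : ℕ) : Prop :=
  ∀ (m : ℕ) (U : Fin m → Set X), (∀ i, IsOpen (U i)) → (⋃ i, U i) = Set.univ →
    ∃ V : Fin m → Set X, (∀ i, IsOpen (V i)) ∧ (∀ i, V i ⊆ U i) ∧ (⋃ i, V i) = Set.univ ∧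
      ∀ x, {i | x ∈ V i}.ncard ≤ n + 1

/-- The subset `A` has topological dimension `k`. -/
def HasTopologicalDim {E : Type*} [TopologicalSpace E] (A : Set E) (k : ℕ) : Prop :=
  A.Nonempty ∧ CoveringDimLE A k ∧ ∀ n < k, ¬ CoveringDimLE A n

/-- The standard inclusion `ℝᵏ → ℝᵈ`, `x ↦ (x, 0)`, for `k ≤ d`, which identifies `ℝᵏ` with
`span {e₁, …, e_k}`. -/
def stdIncl (k d : ℕ) (x : EuclideanSpace ℝ (Fin k)) : EuclideanSpace ℝ (Fin d) :=
  WithLp.toLp 2 (fun i => if h : (i : ℕ) < k then x ⟨i, h⟩ else 0)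

end PositiveReach

end

/-! Fix `r > 0` with `ball a r ⊆ unp A` for every `a ∈ A`. Everything rests on proximal normals:
vectors `n` with `⟪n, b - a⟫ ≤ (1/r) ‖n‖ ‖b - a‖²` for all `b ∈ A`. Where nearest points are unique,
the distance to `A` can be increased at unit rate, so an exterior ball touching `A` at `a` can be
enlarged to any radius below `r` (`infDist_add_smul_eq`). Hence a quadratic bound that holds near
`a` with any constant holds globally with `1/r` (`isProxNormal_of_local`). The normals at a point
therefore form a closed convex cone, outer semicontinuous in the point, whose polar is the tangent
cone (`mem_posTangentConeAt_iff`).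

Full-dimensional tangent cone: let `v` be interior to it. Normals at nearby points make uniformly
obtuse angles with `v`. For an exterior point `y` near `a`, the normal at a nearest point gives a
paraboloid lying above `A` near `a` and strictly below `y`, where "up" is `-v`. The infimum of these
paraboloids is Lipschitz and semiconcave, and `A` is locally its hypograph (`exists_hypograph`),
unless `A` is a neighbourhood of `a`. A quadratic shear turns that hypograph into a convex one, and
intersecting with a small ball gives the convex body.

Lytchak's theorem: let `L` be the span of the tangent cone at `a`, of dimension `k`. If tangent
dimensions on `A` never exceed `k`, the orthogonal complement of the tangent span at each nearby
point has dimension at least `d - k`, and its vectors are normals together with their negatives,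
almost orthogonal to `L`. So `A` is locally a graph over a set `D ⊆ L`, with second-order Taylor
bounds (`exists_taylor_graph`). The full-dimensional argument, run inside `L`, shows that `D` is a
neighbourhood or a hypograph; Whitney extension makes the graph map `C^{1,1}` on `L`. Then `Φ` is an
isometry, followed by the shear that straightens `D` and the shear onto the graph.

The bound on tangent dimensions comes from topology: at a point where the tangent dimension is
maximal the same local model embeds a ball of that dimension in `A`, and Lebesgue's covering theorem
bounds it by the covering dimension. The covering theorem is proved by an integral form of degree
theory (`exists_det_ne_zero`). -/

namespace PositiveReach

open Filter Metric Set
open scoped RealInnerProductSpace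

/-! ### Growth of the distance function and persistence of exterior balls -/

section Reach

variable {E : Type*} [NormedAddCommGroup E]

/-- A lower bound for the reach, valid on uniform balls. -/
theorem HasPositiveReach.exists_ball_subset {A : Set E} (h : HasPositiveReach A) :
    ∃ r : ℝ, 0 < r ∧ ∀ a ∈ A, ball a r ⊆ unp A := by
  obtain ⟨s, hs0, hs⟩ := ENNReal.lt_iff_exists_nnreal_btwn.1 h
  refine ⟨s, by exact_mod_cast hs0, fun a ha => ?_⟩
  have h1 : (s : ℝ≥0∞) < reachAt A a := hs.trans_le (iInf₂_le a ha)
  obtain ⟨t, ht⟩ := lt_iSup_iff.1 h1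
  obtain ⟨hb, ht'⟩ := lt_iSup_iff.1 ht
  refine (ball_subset_ball ?_).trans hb
  exact_mod_cast ht'.le

theorem isClosed_of_ball_subset_unp {A : Set E} {r : ℝ} (hr : 0 < r)
    (h : ∀ a ∈ A, ball a r ⊆ unp A) : IsClosed A := by
  refine isClosed_of_closure_subset fun x hx => ?_
  obtain ⟨a, ha, hxa⟩ := Metric.mem_closure_iff.1 hx r hr
  obtain ⟨p, ⟨hp, hpx⟩, -⟩ := h a ha (mem_ball.2 hxa)
  rw [(mem_closure_iff_infDist_zero ⟨a, ha⟩).1 hx, norm_eq_zero, sub_eq_zero] at hpx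
  exact hpx ▸ hp


variable [ProperSpace E]

/-- The nearest point is continuous at the points where it is unique. -/
theorem tendsto_nearest {A : Set E} (hA : IsClosed A) {z p : E} (hz : z ∈ unp A) (hp : p ∈ A)
    (hpz : ‖z - p‖ = infDist z A) {ξ : E → E} (hξ : ∀ x, ξ x ∈ A)
    (hξ' : ∀ x, ‖x - ξ x‖ = infDist x A) : Tendsto ξ (𝓝 z) (𝓝 p) := by
  have hlim : Tendsto (fun x => ‖z - ξ x‖) (𝓝 z) (𝓝 (infDist z A)) := by
    have h1 : Tendsto (fun x => infDist x A + ‖z - x‖) (𝓝 z) (𝓝 (infDist z A)) := by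
      have : ContinuousAt (fun x => infDist x A + ‖z - x‖) z :=
        ((continuous_infDist_pt A).add (by fun_prop)).continuousAt
      simpa [ContinuousAt] using this
    refine tendsto_of_tendsto_of_tendsto_of_le_of_le tendsto_const_nhds h1 (fun x => ?_)
      (fun x => ?_)
    · simpa [dist_eq_norm] using infDist_le_dist_of_mem (hξ x) (x := z)
    · have := norm_sub_le_norm_sub_add_norm_sub z x (ξ x)
      simp only
      rw [← hξ' x]; linarith
  refine (isCompact_closedBall z (infDist z A + 1)).tendsto_nhds_of_unique_mapClusterPt ?_ ?_
  · filter_upwards [hlim.eventually (gt_mem_nhds (lt_add_one _))] with x hx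
    rw [mem_closedBall, dist_comm, dist_eq_norm]; exact hx.le
  · intro y _ hy
    refine hz.unique ⟨?_, ?_⟩ ⟨hp, hpz⟩
    · exact hA.mem_of_mapClusterPt hy (Eventually.of_forall hξ)
    · have hc : ContinuousAt (fun q => ‖z - q‖) y := by fun_prop
      have h2 : MapClusterPt ‖z - y‖ (𝓝 z) (fun x => ‖z - ξ x‖) :=
        hy.continuousAt_comp (f := fun q => ‖z - q‖) hc
      have h3 : (𝓝 ‖z - y‖ ⊓ 𝓝 (infDist z A)).NeBot := NeBot.mono h2 (inf_le_inf_left _ hlim)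
      exact eq_of_nhds_neBot h3

theorem exists_nearest {A : Set E} (hA : IsClosed A) (hne : A.Nonempty) (x : E) :
    ∃ p ∈ A, ‖x - p‖ = infDist x A := by
  obtain ⟨p, hp, h⟩ := hA.exists_infDist_eq_dist hne x
  exact ⟨p, hp, by rw [h, dist_eq_norm]⟩

variable [InnerProductSpace ℝ E]

/-- The distance function grows at unit rate in the direction pointing away from the unique
nearest point. -/
theorem eventually_infDist_add_ge {A : Set E} (hA : IsClosed A) (hne : A.Nonempty) {z : E}
    (hz : z ∈ unp A) (hpos : 0 < infDist z A) {c : ℝ} (hc : c < 1) :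
    ∃ e : E, ‖e‖ = 1 ∧ ∀ᶠ h : ℝ in 𝓝[>] 0, infDist z A + c * h ≤ infDist (z + h • e) A := by
  choose ξ hξ hξ' using exists_nearest hA hne
  set δ := infDist z A with hδ
  set e : E := δ⁻¹ • (z - ξ z) with he
  have hen : ‖e‖ = 1 := by
    rw [he, norm_smul, hξ' z, norm_inv, Real.norm_of_nonneg hpos.le, inv_mul_cancel₀ hpos.ne']
  refine ⟨e, hen, ?_⟩
  have hcont : Tendsto (fun h : ℝ => ξ (z + h • e)) (𝓝[>] 0) (𝓝 (ξ z)) := by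
    refine (tendsto_nearest hA hz (hξ z) (hξ' z) hξ hξ').comp ?_
    have : ContinuousAt (fun h : ℝ => z + h • e) 0 := by fun_prop
    have h0 : Tendsto (fun h : ℝ => z + h • e) (𝓝 0) (𝓝 z) := by simpa [ContinuousAt] using this
    exact h0.mono_left nhdsWithin_le_nhds
  have hinner : Tendsto (fun h : ℝ => ⟪e, z - ξ (z + h • e)⟫ - c * ‖z - ξ (z + h • e)‖) (𝓝[>] 0)
      (𝓝 (⟪e, z - ξ z⟫ - c * ‖z - ξ z‖)) := by
    have h1 : Tendsto (fun h : ℝ => z - ξ (z + h • e)) (𝓝[>] 0) (𝓝 (z - ξ z)) :=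
      tendsto_const_nhds.sub hcont
    exact (tendsto_const_nhds.inner h1).sub (h1.norm.const_mul c)
  have hpos' : 0 < ⟪e, z - ξ z⟫ - c * ‖z - ξ z‖ := by
    rw [he, real_inner_smul_left, real_inner_self_eq_norm_sq, hξ' z, ← hδ]
    have : δ⁻¹ * δ ^ 2 = δ := by field_simp
    rw [this]; nlinarith
  filter_upwards [hinner.eventually (lt_mem_nhds hpos'), self_mem_nhdsWithin] with h hh hh0
  set q := ξ (z + h • e)
  have hzq : δ ≤ ‖z - q‖ := by
    simpa [dist_eq_norm] using infDist_le_dist_of_mem (hξ (z + h • e)) (x := z)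
  have hq0 : 0 < ‖z - q‖ := hpos.trans_le hzq
  rw [← hξ' (z + h • e)]
  -- Projecting onto the direction of `z - q` gives `‖z + h e - q‖ ≥ ‖z - q‖ + h ⟪e, z - q⟫ / ‖z -
  -- q‖`. The last quotient exceeds `c` for small `h`, since `q` tends to `ξ z`.
  have hin := real_inner_le_norm (z + h • e - q) (z - q)
  have h2 : ⟪z + h • e - q, z - q⟫ = ‖z - q‖ ^ 2 + h * ⟪e, z - q⟫ := by
    rw [show z + h • e - q = (z - q) + h • e by abel, inner_add_left, real_inner_self_eq_norm_sq,
      real_inner_smul_left]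
  rw [h2] at hin
  have hh0' : (0 : ℝ) < h := hh0
  by_contra hcon
  push Not at hcon
  have : ‖z - q‖ ^ 2 + h * ⟪e, z - q⟫ > (δ + c * h) * ‖z - q‖ := by nlinarith
  nlinarith

/-- Maximize `infDist z A - c ‖z - y‖` over the ball. An interior maximum is impossible, because
from there the distance grows at a rate larger than `c` in some direction. -/
theorem exists_infDist_ge_add_aux {A : Set E} (hA : IsClosed A) (hne : A.Nonempty) {y : E} {ε : ℝ}
    (hε0 : 0 < ε) (hε : ε < infDist y A) (hU : closedBall y ε ⊆ unp A) {c : ℝ} (hc0 : 0 < c)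
    (hc : c < 1) : ∃ z ∈ sphere y ε, infDist y A + c * ε ≤ infDist z A := by
  obtain ⟨z, hz, hmax⟩ := (isCompact_closedBall y ε).exists_isMaxOn
    ⟨y, mem_closedBall_self hε0.le⟩ (f := fun z => infDist z A - c * ‖z - y‖)
    (((continuous_infDist_pt A).sub (by fun_prop)).continuousOn)
  have hzy : infDist y A ≤ infDist z A - c * ‖z - y‖ := by
    simpa using hmax (mem_closedBall_self hε0.le)
  rw [mem_closedBall, dist_eq_norm] at hz
  rcases hz.eq_or_lt with heq | hlt
  · refine ⟨z, by rw [mem_sphere, dist_eq_norm, heq], ?_⟩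
    rw [heq] at hzy; linarith
  · exfalso
    have hzpos : 0 < infDist z A := by
      have : 0 ≤ c * ‖z - y‖ := by positivity
      linarith
    obtain ⟨e, he, hev⟩ := eventually_infDist_add_ge hA hne
      (hU (by rw [mem_closedBall, dist_eq_norm]; exact hz)) hzpos (c := (1 + c) / 2) (by linarith)
    have hsmall : ∀ᶠ h : ℝ in 𝓝[>] 0, h < ε - ‖z - y‖ :=
      nhdsWithin_le_nhds (gt_mem_nhds (by linarith))
    obtain ⟨h, h1, h2, h3⟩ := (hev.and (hsmall.and self_mem_nhdsWithin)).exists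
    have h3' : (0 : ℝ) < h := h3
    have hn : ‖z + h • e - y‖ ≤ ‖z - y‖ + h := by
      rw [show z + h • e - y = (z - y) + h • e by abel]
      refine (norm_add_le _ _).trans ?_
      rw [norm_smul, he, Real.norm_of_nonneg h3'.le, mul_one]
    have := hmax (show z + h • e ∈ closedBall y ε by
      rw [mem_closedBall, dist_eq_norm]; linarith)
    simp only [mem_ofPred_eq] at this
    nlinarith

/-- The limit `c → 1` of the preceding estimate: a maximizer of the distance on the compact sphere
dominates all the approximate ones. -/
theorem exists_infDist_ge_add {A : Set E} (hA : IsClosed A) (hne : A.Nonempty) {y : E} {ε : ℝ}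
    (hε0 : 0 < ε) (hε : ε < infDist y A) (hU : closedBall y ε ⊆ unp A) :
    ∃ z, ‖z - y‖ = ε ∧ infDist y A + ε ≤ infDist z A := by
  obtain ⟨z₀, hz₀, -⟩ := exists_infDist_ge_add_aux hA hne hε0 hε hU (c := 1 / 2) (by norm_num)
    (by norm_num)
  obtain ⟨z, hz, hmax⟩ := (isCompact_sphere y ε).exists_isMaxOn ⟨z₀, hz₀⟩
    (continuous_infDist_pt A).continuousOn
  refine ⟨z, by rwa [mem_sphere, dist_eq_norm] at hz, ?_⟩
  refine le_of_forall_pos_le_add fun η hη => ?_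
  have hlt : max (1 / 2) (1 - η / ε) < 1 := max_lt (by norm_num) (by simp; positivity)
  obtain ⟨w, hw, hwd⟩ := exists_infDist_ge_add_aux hA hne hε0 hε hU (c := max (1 / 2) (1 - η / ε))
    (by positivity) hlt
  have h1 : infDist w A ≤ infDist z A := hmax hw
  have h2 : (1 - η / ε) * ε ≤ max (1 / 2) (1 - η / ε) * ε := by gcongr; exact le_max_right _ _
  have h3 : (1 - η / ε) * ε = ε - η := by field_simp
  linarith

/-- A unit vector which is a proximal normal at some scale is one at every scale below the
reach. -/
theorem infDist_add_smul_eq {A : Set E} {r : ℝ} (hr : 0 < r) (hU : ∀ a ∈ A, ball a r ⊆ unp A)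
    {a n : E} (ha : a ∈ A) (hn : ‖n‖ = 1) {s : ℝ} (hs : 0 < s) (hsn : infDist (a + s • n) A = s)
    {t : ℝ} (hst : s ≤ t) (htr : t < r) : infDist (a + t • n) A = t := by
  have hA := isClosed_of_ball_subset_unp hr hU
  have hcl : IsClosed ({t | infDist (a + t • n) A = t} ∩ Icc s t) := by
    refine IsClosed.inter (isClosed_eq ?_ continuous_id) isClosed_Icc
    exact (continuous_infDist_pt A).comp (by fun_prop)
  refine hcl.Icc_subset_of_forall_exists_gt hsn ?_ ⟨hst, le_rfl⟩
  rintro x ⟨hx, hsx, hxt⟩ y hy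
  have hy' : x < y := hy
  have hx' : infDist (a + x • n) A = x := hx
  have hx0 : 0 < x := hs.trans_le hsx
  -- The three bounds keep `x + ε` at most `y`, keep the `ε`-ball about `a + x n` inside `ball a r`,
  -- and make `ε` smaller than the distance `x`.
  set ε := min (min (y - x) ((t - x) / 2)) (x / 2) with hε
  have hε0 : 0 < ε := by
    refine lt_min (lt_min ?_ ?_) ?_ <;> linarith
  have hε1 : ε ≤ y - x := (min_le_left _ _).trans (min_le_left _ _)
  have hε2 : ε ≤ (t - x) / 2 := (min_le_left _ _).trans (min_le_right _ _)
  have hε3 : ε ≤ x / 2 := min_le_right _ _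
  obtain ⟨z, hz1, hz2⟩ := exists_infDist_ge_add hA ⟨a, ha⟩ (y := a + x • n) hε0
    (by rw [hx']; linarith) (by
      refine Subset.trans ?_ (hU a ha)
      intro w hw
      rw [mem_closedBall, dist_eq_norm] at hw
      rw [mem_ball, dist_eq_norm]
      have h1 : ‖w - a‖ ≤ ‖w - (a + x • n)‖ + ‖x • n‖ := by
        refine le_trans (le_of_eq ?_) (norm_add_le _ _)
        congr 1; abel
      rw [norm_smul, hn, Real.norm_of_nonneg hx0.le] at h1
      linarith)
  rw [hx'] at hz2
  have hza : infDist z A ≤ ‖z - a‖ := by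
    simpa [dist_eq_norm] using infDist_le_dist_of_mem ha (x := z)
  have hxn : ‖x • n‖ = x := by rw [norm_smul, hn, Real.norm_of_nonneg hx0.le, mul_one]
  have hdecomp : z - a = x • n + (z - (a + x • n)) := by abel
  have hle : ‖z - a‖ ≤ x + ε := by
    rw [hdecomp]; refine (norm_add_le _ _).trans ?_
    rw [hxn, hz1]
  -- As `a ∈ A`, the distance of `z` is at most `‖z - a‖ ≤ x + ε`, so the triangle inequality is an
  -- equality. Strict convexity forces `z` onto the ray.
  have heq : ‖x • n + (z - (a + x • n))‖ = ‖x • n‖ + ‖z - (a + x • n)‖ := by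
    rw [← hdecomp, hxn, hz1]; linarith
  rw [norm_add_eq_iff_real, hxn, hz1] at heq
  have hz : z = a + (x + ε) • n := by
    have h4 : z - (a + x • n) = ε • n := by
      have : x • (z - (a + x • n)) = x • (ε • n) := by rw [← heq, smul_comm]
      exact smul_right_injective E hx0.ne' this
    rw [add_smul, ← h4]; abel
  refine ⟨x + ε, ?_, by linarith, by linarith⟩
  show infDist (a + (x + ε) • n) A = x + ε
  rw [← hz]; linarith

end Reach

/-! ### Proximal normals and their polarity with the tangent cone -/

section Normals

variable {E : Type*} [NormedAddCommGroup E] [InnerProductSpace ℝ E]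

/-- `n` is a proximal normal of `A` at `a`, with constant `C`. -/
def IsProxNormal (A : Set E) (C : ℝ) (a n : E) : Prop :=
  ∀ b ∈ A, ⟪n, b - a⟫ ≤ C * ‖n‖ * ‖b - a‖ ^ 2

theorem IsProxNormal.zero (A : Set E) (C : ℝ) (a : E) : IsProxNormal A C a 0 := by
  intro b _; simp

theorem IsProxNormal.smul {A : Set E} {C : ℝ} {a n : E} (h : IsProxNormal A C a n) {t : ℝ}
    (ht : 0 ≤ t) : IsProxNormal A C a (t • n) := by
  intro b hb
  rw [real_inner_smul_left, norm_smul, Real.norm_of_nonneg ht]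
  have := mul_le_mul_of_nonneg_left (h b hb) ht
  linarith

theorem isProxNormal_of_tendsto {A : Set E} {C : ℝ} {a n : E} {ι : Type*} {l : Filter ι} [l.NeBot]
    {b m : ι → E} (hb : Tendsto b l (𝓝 a)) (hm : Tendsto m l (𝓝 n))
    (h : ∀ i, IsProxNormal A C (b i) (m i)) : IsProxNormal A C a n := by
  intro c hc
  have h1 : Tendsto (fun i => c - b i) l (𝓝 (c - a)) := tendsto_const_nhds.sub hb
  exact le_of_tendsto_of_tendsto' (hm.inner h1) ((hm.norm.const_mul C).mul (h1.norm.pow 2))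
    fun i => h i c hc

theorem IsProxNormal.inner_nonpos {A : Set E} {C : ℝ} {a n u : E} (h : IsProxNormal A C a n)
    (hu : u ∈ posTangentConeAt A a) : ⟪n, u⟫ ≤ 0 := by
  obtain ⟨α, l, hl, c, d, hd, hmem, hcd⟩ := exists_fun_of_mem_tangentConeAt hu
  have h1 : Tendsto (fun i => C * ‖n‖ * (‖c i • d i‖ * ‖d i‖)) l (𝓝 0) := by
    simpa using (hcd.norm.mul hd.norm).const_mul (C * ‖n‖)
  refine le_of_tendsto_of_tendsto (tendsto_const_nhds.inner hcd) h1 ?_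
  filter_upwards [hmem] with i hi
  have h2 := h _ hi
  rw [add_sub_cancel_left] at h2
  have h3 : c i • d i = (c i : ℝ) • d i := rfl
  have h4 : ‖(c i : ℝ)‖ = c i := Real.norm_of_nonneg (c i).2
  rw [h3, real_inner_smul_right, norm_smul, h4]
  have := mul_le_mul_of_nonneg_left h2 (c i).2
  nlinarith

/-- Outer semicontinuity of the proximal normal cone, tested against directions in the polar
cone. -/
theorem exists_forall_inner_le [FiniteDimensional ℝ E] (A : Set E) (C : ℝ) (a : E) (R : ℝ) {η : ℝ}
    (hη : 0 < η) :
    ∃ ε > 0, ∀ b, ‖b - a‖ < ε → ∀ n, IsProxNormal A C b n → ∀ u,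
      (∀ m, IsProxNormal A C a m → ⟪m, u⟫ ≤ 0) → ‖u‖ ≤ R → ⟪n, u⟫ ≤ η * ‖n‖ := by
  by_contra hcon
  push Not at hcon
  choose b hb n hn u hu huR hlt using fun j : ℕ =>
    hcon (1 / ((j : ℝ) + 1)) Nat.one_div_pos_of_nat
  have hn0 : ∀ j, 0 < ‖n j‖ := by
    intro j
    refine norm_pos_iff.2 fun h0 => ?_
    have := hlt j
    simp [h0] at this
  have hbt : Tendsto b atTop (𝓝 a) := by
    rw [tendsto_iff_norm_sub_tendsto_zero]
    exact squeeze_zero (fun _ => norm_nonneg _) (fun j => (hb j).le)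
      tendsto_one_div_add_atTop_nhds_zero_nat
  set N : ℕ → E := fun j => ‖n j‖⁻¹ • n j with hN
  have hNn : ∀ j, ‖N j‖ = 1 := fun j => by
    rw [hN]; simp only
    rw [norm_smul, norm_inv, norm_norm, inv_mul_cancel₀ (hn0 j).ne']
  have hcomp : IsCompact (closedBall (0 : E) 1 ×ˢ closedBall (0 : E) R) :=
    (isCompact_closedBall _ _).prod (isCompact_closedBall _ _)
  obtain ⟨⟨N', u'⟩, -, φ, hφ, hlim⟩ := hcomp.tendsto_subseq (x := fun j => (N j, u j))
    (fun j => ⟨by simp [hNn j], by simpa using huR j⟩)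
  have hN' : Tendsto (N ∘ φ) atTop (𝓝 N') := (continuous_fst.tendsto _).comp hlim
  have hu' : Tendsto (u ∘ φ) atTop (𝓝 u') := (continuous_snd.tendsto _).comp hlim
  have h1 : IsProxNormal A C a N' := isProxNormal_of_tendsto (hbt.comp hφ.tendsto_atTop) hN'
    fun i => (hn (φ i)).smul (inv_nonneg.2 (norm_nonneg _))
  have h2 : ⟪N', u'⟫ ≤ 0 := le_of_tendsto' (tendsto_const_nhds.inner hu') fun i => hu (φ i) N' h1
  have h3 : η ≤ ⟪N', u'⟫ := ge_of_tendsto' (hN'.inner hu') fun i => by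
    have := hlt (φ i)
    simp only [Function.comp, hN]
    rw [real_inner_smul_left, ← div_eq_inv_mul, le_div_iff₀ (hn0 _)]
    exact this.le
  linarith

variable [ProperSpace E]

/-- A vector satisfying a proximal normal inequality locally, with any constant, satisfies it
globally with the constant determined by the reach. -/
theorem isProxNormal_of_local {A : Set E} {r : ℝ} (hr : 0 < r) (hU : ∀ a ∈ A, ball a r ⊆ unp A)
    {a n : E} (ha : a ∈ A) {C ε : ℝ} (hε : 0 < ε)
    (h : ∀ b ∈ A, ‖b - a‖ < ε → ⟪n, b - a⟫ ≤ C * ‖b - a‖ ^ 2) : IsProxNormal A (1 / r) a n := by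
  rcases eq_or_ne n 0 with rfl | hn
  · exact IsProxNormal.zero _ _ _
  have hn0 : 0 < ‖n‖ := norm_pos_iff.2 hn
  set N : E := ‖n‖⁻¹ • n with hN
  have hN1 : ‖N‖ = 1 := by rw [hN, norm_smul, norm_inv, norm_norm, inv_mul_cancel₀ hn0.ne']
  have hnN : n = ‖n‖ • N := by rw [hN, smul_inv_smul₀ hn0.ne']
  obtain ⟨K, hK0, hK⟩ : ∃ K > 0, ∀ b ∈ A, ⟪N, b - a⟫ ≤ K * ‖b - a‖ ^ 2 := by
    refine ⟨max (C / ‖n‖) (1 / ε), lt_max_of_lt_right (by positivity), fun b hb => ?_⟩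
    rcases lt_or_ge ‖b - a‖ ε with hlt | hge
    · have h1 := h b hb hlt
      rw [hN, real_inner_smul_left]
      calc ‖n‖⁻¹ * ⟪n, b - a⟫ ≤ ‖n‖⁻¹ * (C * ‖b - a‖ ^ 2) := by gcongr
        _ = C / ‖n‖ * ‖b - a‖ ^ 2 := by ring
        _ ≤ _ := by gcongr; exact le_max_left _ _
    · calc ⟪N, b - a⟫ ≤ ‖N‖ * ‖b - a‖ := real_inner_le_norm _ _
        _ = 1 / ε * (ε * ‖b - a‖) := by rw [hN1]; field_simp
        _ ≤ 1 / ε * (‖b - a‖ * ‖b - a‖) := by gcongr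
        _ ≤ max (C / ‖n‖) (1 / ε) * (‖b - a‖ * ‖b - a‖) := by gcongr; exact le_max_right _ _
        _ = _ := by ring
  have hexp : ∀ (t : ℝ) (b : E), ‖a + t • N - b‖ ^ 2 = t ^ 2 - 2 * t * ⟪N, b - a⟫ + ‖b - a‖ ^ 2 := by
    intro t b
    rw [show a + t • N - b = t • N - (b - a) by abel, norm_sub_sq_real, norm_smul, hN1,
      real_inner_smul_left, mul_one, Real.norm_eq_abs, sq_abs]
    ring
  -- With `2 s K ≤ 1` the ball of radius `s` about `a + s N` has no point of `A` in its interior; `s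
  -- ≤ r / 4` allows enlarging it to radius `r / 2`, and radius `r / 2` yields exactly the constant
  -- `1 / r`.
  set s : ℝ := min (1 / (2 * K)) (r / 4) with hs
  have hs0 : 0 < s := lt_min (by positivity) (by positivity)
  have hsK : 2 * s * K ≤ 1 := by
    have : s ≤ 1 / (2 * K) := min_le_left _ _
    rw [le_div_iff₀ (by positivity)] at this; linarith
  have hinf : infDist (a + s • N) A = s := by
    refine le_antisymm ?_ ?_
    · have := infDist_le_dist_of_mem ha (x := a + s • N)
      rwa [dist_eq_norm, add_sub_cancel_left, norm_smul, hN1, mul_one,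
        Real.norm_of_nonneg hs0.le] at this
    · rw [le_infDist ⟨a, ha⟩]
      intro b hb
      rw [dist_eq_norm]
      refine (pow_le_pow_iff_left₀ hs0.le (norm_nonneg _) two_ne_zero).1 ?_
      rw [hexp]
      have h1 := mul_le_mul_of_nonneg_left (hK b hb) (by positivity : 0 ≤ 2 * s)
      have h2 := mul_le_mul_of_nonneg_right hsK (sq_nonneg ‖b - a‖)
      nlinarith
  have hfar := infDist_add_smul_eq hr hU ha hN1 hs0 hinf (t := r / 2)
    ((min_le_right _ _).trans (by linarith)) (by linarith)
  intro b hb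
  have h1 : r / 2 ≤ ‖a + (r / 2) • N - b‖ := by
    rw [← dist_eq_norm]
    exact hfar.symm.le.trans (infDist_le_dist_of_mem hb)
  have h2 := pow_le_pow_left₀ (by positivity) h1 2
  rw [hexp] at h2
  have h3 : ⟪N, b - a⟫ ≤ 1 / r * ‖b - a‖ ^ 2 := by
    rw [one_div, ← div_eq_inv_mul, le_div_iff₀ hr]; linarith
  calc ⟪n, b - a⟫ = ‖n‖ * ⟪N, b - a⟫ := by rw [← real_inner_smul_left, ← hnN]
    _ ≤ ‖n‖ * (1 / r * ‖b - a‖ ^ 2) := by gcongr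
    _ = _ := by ring

/-- Squaring the minimality of `‖y - p‖` gives a quadratic bound with the unnormalized constant `1 /
2`, which `isProxNormal_of_local` upgrades. No smallness of `‖y - p‖` is needed. -/
theorem isProxNormal_of_nearest {A : Set E} {r : ℝ} (hr : 0 < r) (hU : ∀ a ∈ A, ball a r ⊆ unp A)
    {y p : E} (hp : p ∈ A) (h : ∀ b ∈ A, ‖y - p‖ ≤ ‖y - b‖) :
    IsProxNormal A (1 / r) p (y - p) := by
  refine isProxNormal_of_local hr hU hp (C := 1 / 2) one_pos fun b hb _ => ?_
  have h1 := pow_le_pow_left₀ (norm_nonneg _) (h b hb) 2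
  rw [show y - b = (y - p) - (b - p) by abel, norm_sub_sq_real (y - p)] at h1
  linarith

/-- Adding the two inequalities leaves `‖n‖ + ‖m‖` where `‖n + m‖` is wanted; the self-improvement
in `isProxNormal_of_local` repairs this. Convexity of the normal cone thus comes from the reach. -/
theorem IsProxNormal.add {A : Set E} {r : ℝ} (hr : 0 < r) (hU : ∀ a ∈ A, ball a r ⊆ unp A)
    {a n m : E} (ha : a ∈ A) (hn : IsProxNormal A (1 / r) a n) (hm : IsProxNormal A (1 / r) a m) :
    IsProxNormal A (1 / r) a (n + m) := by
  refine isProxNormal_of_local hr hU ha (C := 1 / r * ‖n‖ + 1 / r * ‖m‖) one_pos fun b hb _ => ?_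
  rw [inner_add_left, add_mul]
  exact add_le_add (hn b hb) (hm b hb)

/-- The proximal normal cone. -/
def proxNormalCone {A : Set E} {r : ℝ} (hr : 0 < r) (hU : ∀ a ∈ A, ball a r ⊆ unp A)
    {a : E} (ha : a ∈ A) : ProperCone ℝ E where
  carrier := {n | IsProxNormal A (1 / r) a n}
  add_mem' := fun hn hm => hn.add hr hU ha hm
  zero_mem' := IsProxNormal.zero _ _ _
  smul_mem' := fun t _ hn => hn.smul t.2
  isClosed' := by
    refine isSeqClosed_iff_isClosed.1 fun x n hx hn => ?_
    exact isProxNormal_of_tendsto tendsto_const_nhds hn hx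

variable [FiniteDimensional ℝ E]

/-- The tangent cone is the polar of the proximal normal cone. -/
theorem mem_posTangentConeAt_iff {A : Set E} {r : ℝ} (hr : 0 < r) (hU : ∀ a ∈ A, ball a r ⊆ unp A)
    {a : E} (ha : a ∈ A) {u : E} :
    u ∈ posTangentConeAt A a ↔ ∀ n, IsProxNormal A (1 / r) a n → ⟪n, u⟫ ≤ 0 := by
  refine ⟨fun hu n hn => hn.inner_nonpos hu, fun hu => ?_⟩
  have hA := isClosed_of_ball_subset_unp hr hU
  choose ξ hξ hξ' using exists_nearest hA ⟨a, ha⟩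
  set s : ℕ → ℝ≥0 := fun j => 1 / ((j : ℝ≥0) + 1) with hs
  have hs0 : ∀ j, 0 < s j := fun j => by simp only [hs]; positivity
  have hs0' : ∀ j, 0 < (s j : ℝ) := fun j => hs0 j
  have hst : Tendsto (fun j => (s j : ℝ)) atTop (𝓝 0) := by
    simpa [hs] using tendsto_one_div_add_atTop_nhds_zero_nat (𝕜 := ℝ)
  set p : ℕ → E := fun j => ξ (a + (s j : ℝ) • u) with hp
  have hpnear : ∀ j, ∀ b ∈ A, ‖a + (s j : ℝ) • u - p j‖ ≤ ‖a + (s j : ℝ) • u - b‖ := by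
    intro j b hb
    rw [hξ', ← dist_eq_norm]; exact infDist_le_dist_of_mem hb
  have hε : ∀ j, ‖a + (s j : ℝ) • u - p j‖ ≤ s j * ‖u‖ := by
    intro j
    have := hpnear j a ha
    rwa [add_sub_cancel_left, norm_smul, Real.norm_of_nonneg (hs0' j).le] at this
  have hpa : ∀ j, ‖p j - a‖ ≤ 2 * s j * ‖u‖ := by
    intro j
    calc ‖p j - a‖ = ‖(s j : ℝ) • u - (a + (s j : ℝ) • u - p j)‖ := by congr 1; abel
      _ ≤ ‖(s j : ℝ) • u‖ + ‖a + (s j : ℝ) • u - p j‖ := norm_sub_le _ _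
      _ ≤ s j * ‖u‖ + s j * ‖u‖ := by
        rw [norm_smul, Real.norm_of_nonneg (hs0' j).le]; gcongr; exact hε j
      _ = _ := by ring
  have hd : Tendsto (fun j => p j - a) atTop (𝓝 0) := by
    rw [tendsto_zero_iff_norm_tendsto_zero]
    refine squeeze_zero (fun _ => norm_nonneg _) hpa ?_
    simpa using (hst.const_mul 2).mul_const ‖u‖
  -- The key point is that `a + s u` is at distance `o(s)` from `A`. Its offset `m` from the nearest
  -- point `p` is a normal at `p`, and `‖m‖² = ⟪m, a - p⟫ + s ⟪m, u⟫`. The first term is `O(s²) ‖m‖`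
  -- by the normal inequality, the second at most `o(s) ‖m‖` by outer semicontinuity.
  have hquot : Tendsto (fun j => (s j : ℝ)⁻¹ * ‖a + (s j : ℝ) • u - p j‖) atTop (𝓝 0) := by
    refine Metric.tendsto_atTop.2 fun η hη => ?_
    obtain ⟨ε, hε0, hεη⟩ := exists_forall_inner_le A (1 / r) a ‖u‖ (half_pos hη)
    have e1 : ∀ᶠ j in atTop, ‖p j - a‖ < ε := by
      have := hd.norm
      rw [norm_zero] at this
      exact this.eventually (gt_mem_nhds hε0)
    have e2 : ∀ᶠ j in atTop, 1 / r * (2 * ‖u‖) ^ 2 * s j < η / 2 := by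
      have := hst.const_mul (1 / r * (2 * ‖u‖) ^ 2)
      rw [mul_zero] at this
      exact this.eventually (gt_mem_nhds (half_pos hη))
    obtain ⟨N, hN⟩ := eventually_atTop.1 (e1.and e2)
    refine ⟨N, fun j hj => ?_⟩
    obtain ⟨h1, h2⟩ := hN j hj
    set m := a + (s j : ℝ) • u - p j with hm
    have hmn : IsProxNormal A (1 / r) (p j) m := isProxNormal_of_nearest hr hU (hξ _) (hpnear j)
    have h3 := hεη (p j) h1 m hmn u hu le_rfl
    have h4 := hmn a ha
    have h5 : ‖m‖ ^ 2 = ⟪m, a - p j⟫ + s j * ⟪m, u⟫ := by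
      rw [← real_inner_self_eq_norm_sq, ← real_inner_smul_right, ← inner_add_right]
      congr 1; rw [hm]; abel
    have h6 : ‖a - p j‖ ^ 2 ≤ (2 * s j * ‖u‖) ^ 2 := by
      rw [norm_sub_rev]; exact pow_le_pow_left₀ (norm_nonneg _) (hpa j) 2
    rw [Real.dist_eq, sub_zero, abs_of_nonneg (by positivity), ← div_eq_inv_mul,
      div_lt_iff₀ (hs0' j)]
    rcases (norm_nonneg m).eq_or_lt with h0 | h0
    · rw [← h0]; have := hs0' j; positivity
    · have h7 : ‖m‖ * ‖m‖ ≤ ‖m‖ * (1 / r * (2 * s j * ‖u‖) ^ 2 + s j * (η / 2)) := by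
        have h8 : 1 / r * ‖m‖ * ‖a - p j‖ ^ 2 ≤ 1 / r * ‖m‖ * (2 * s j * ‖u‖) ^ 2 := by gcongr
        have h9 := mul_le_mul_of_nonneg_left h3 (hs0' j).le
        nlinarith
      have h8 := le_of_mul_le_mul_left h7 h0
      have h9 := mul_lt_mul_of_pos_right h2 (hs0' j)
      nlinarith
  refine mem_tangentConeAt_of_seq atTop (fun j => (s j)⁻¹) (fun j => p j - a) hd
    (Eventually.of_forall fun j => by rw [add_sub_cancel]; exact hξ _) ?_
  rw [tendsto_iff_norm_sub_tendsto_zero]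
  refine hquot.congr fun j => ?_
  have h3 : (s j)⁻¹ • (p j - a) = (s j : ℝ)⁻¹ • (p j - a) := rfl
  have h4 : u = (s j : ℝ)⁻¹ • ((s j : ℝ) • u) := by rw [inv_smul_smul₀ (hs0' j).ne']
  rw [h3]
  conv_rhs => rw [h4, ← smul_sub, norm_smul, norm_inv, Real.norm_of_nonneg (hs0' j).le]
  rw [← norm_neg]
  congr 2; abel

/-- Vectors orthogonal to the tangent cone are proximal normals. -/
theorem isProxNormal_of_mem_orthogonal {A : Set E} {r : ℝ} (hr : 0 < r)
    (hU : ∀ a ∈ A, ball a r ⊆ unp A) {a : E} (ha : a ∈ A) {n : E}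
    (hn : n ∈ (Submodule.span ℝ (posTangentConeAt A a))ᗮ) : IsProxNormal A (1 / r) a n := by
  by_contra hcon
  have hmem : n ∉ proxNormalCone hr hU ha := hcon
  -- Bipolar argument: the separating functional gives a vector `-y` of the tangent cone not
  -- orthogonal to `n`.
  obtain ⟨y, hy, hny⟩ := ProperCone.hyperplane_separation' _ hmem
  have h1 : -y ∈ posTangentConeAt A a := (mem_posTangentConeAt_iff hr hU ha).2 fun m hm => by
    rw [inner_neg_right]; have := hy m hm; linarith
  have h2 := (Submodule.mem_orthogonal' _ _).1 hn _ (Submodule.subset_span h1)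
  rw [inner_neg_right] at h2
  linarith

/-- The tangent cone contains a relatively open ball of its span. -/
theorem exists_ball_subset_posTangentConeAt {A : Set E} {r : ℝ} (hr : 0 < r)
    (hU : ∀ a ∈ A, ball a r ⊆ unp A) {a : E} (ha : a ∈ A) :
    ∃ v ∈ Submodule.span ℝ (posTangentConeAt A a), ∃ ρ > 0,
      ∀ e ∈ Submodule.span ℝ (posTangentConeAt A a), ‖e‖ ≤ ρ → v + e ∈ posTangentConeAt A a := by
  set T := posTangentConeAt A a with hT
  set L := Submodule.span ℝ T with hL
  have hpol : ∀ u, u ∈ T ↔ ∀ n, IsProxNormal A (1 / r) a n → ⟪n, u⟫ ≤ 0 := fun u =>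
    mem_posTangentConeAt_iff hr hU ha
  set S : Set L := (↑) ⁻¹' T with hS
  have hconv : Convex ℝ S := by
    intro x hx y hy α β hα hβ _
    show ((α • x + β • y : L) : E) ∈ T
    rw [hpol]
    intro n hn
    have h1 := (hpol _).1 hx n hn
    have h2 := (hpol _).1 hy n hn
    push_cast
    rw [inner_add_right, real_inner_smul_right, real_inner_smul_right]
    nlinarith [mul_nonneg hα (neg_nonneg.2 h1), mul_nonneg hβ (neg_nonneg.2 h2)]
  have h0 : (0 : L) ∈ S := by
    show ((0 : L) : E) ∈ T
    rw [hpol]; simp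
  have hspan : Submodule.span ℝ S = ⊤ := Submodule.span_span_coe_preimage
  have haff : affineSpan ℝ S = ⊤ := by
    have : (0 : L) ∈ affineSpan ℝ S := subset_affineSpan ℝ S h0
    rw [← AffineSubspace.direction_eq_top_iff_of_nonempty ⟨0, this⟩, direction_affineSpan,
      vectorSpan_eq_span_vsub_set_right ℝ h0]
    simpa using hspan
  obtain ⟨v, hv⟩ := hconv.interior_nonempty_iff_affineSpan_eq_top.2 haff
  obtain ⟨ρ, hρ, hball⟩ := Metric.isOpen_iff.1 isOpen_interior v hv
  refine ⟨v, v.2, ρ / 2, by positivity, fun e he hen => ?_⟩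
  have : v + ⟨e, he⟩ ∈ S := interior_subset (hball (by
    rw [mem_ball, dist_eq_norm, add_sub_cancel_left, Submodule.coe_norm]
    simp only; linarith))
  exact this

end Normals

/-! ### Hypographs as regions below an infimum of paraboloids -/

section Hypograph

variable {F : Type*} [NormedAddCommGroup F] [InnerProductSpace ℝ F]

/-- The orthogonal projection onto the hyperplane `u^⊥`. -/
noncomputable abbrev hyperProj (u : F) : F →L[ℝ] (ℝ ∙ u)ᗮ := (ℝ ∙ u)ᗮ.orthogonalProjectionOnto

theorem hyperProj_add_smul {u : F} (hu : ‖u‖ = 1) (x : F) :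
    (hyperProj u x : F) + ⟪x, u⟫ • u = x := by
  have h := (ℝ ∙ u).starProjection_add_starProjection_orthogonal x
  rw [Submodule.starProjection_unit_singleton ℝ hu, real_inner_comm] at h
  rw [add_comm]; exact h

theorem inner_orthogonal_eq_zero {u : F} (w : (ℝ ∙ u)ᗮ) : ⟪(w : F), u⟫ = 0 :=
  (Submodule.mem_orthogonal' _ _).1 w.2 u (Submodule.mem_span_singleton_self u)

theorem hyperProj_coe_add_smul {u : F} (w : (ℝ ∙ u)ᗮ) (t : ℝ) :
    hyperProj u ((w : F) + t • u) = w := by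
  have h : hyperProj u u = 0 := by
    rw [Submodule.orthogonalProjectionOnto_eq_zero_iff, Submodule.orthogonal_orthogonal]
    exact Submodule.mem_span_singleton_self u
  rw [map_add, map_smul, h, smul_zero, add_zero]
  exact Submodule.orthogonalProjectionOnto_mem_subspace_eq_self w

theorem inner_coe_add_smul {u : F} (hu : ‖u‖ = 1) (w : (ℝ ∙ u)ᗮ) (t : ℝ) :
    ⟪(w : F) + t • u, u⟫ = t := by
  rw [inner_add_left, inner_orthogonal_eq_zero, real_inner_smul_left, real_inner_self_eq_norm_sq,
    hu]; ring

theorem inner_eq_inner_hyperProj_add {u : F} (hu : ‖u‖ = 1) (x z : F) :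
    ⟪x, z⟫ = ⟪hyperProj u x, hyperProj u z⟫ + ⟪x, u⟫ * ⟪z, u⟫ := by
  conv_lhs => rw [← hyperProj_add_smul hu x, ← hyperProj_add_smul hu z]
  simp only [inner_add_left, inner_add_right, real_inner_smul_left, real_inner_smul_right,
    inner_orthogonal_eq_zero, real_inner_comm _ u, real_inner_self_eq_norm_sq, hu]
  rw [Submodule.coe_inner]; ring

theorem norm_sq_eq_hyperProj {u : F} (hu : ‖u‖ = 1) (z : F) :
    ‖z‖ ^ 2 = ‖hyperProj u z‖ ^ 2 + ⟪z, u⟫ ^ 2 := by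
  rw [← real_inner_self_eq_norm_sq, inner_eq_inner_hyperProj_add hu, real_inner_self_eq_norm_sq]
  ring

theorem mem_hypograph_iff {u : F} (hu : ‖u‖ = 1) (f : (ℝ ∙ u)ᗮ → ℝ) (x : F) :
    x ∈ hypograph u f ↔ ⟪x, u⟫ ≤ f (hyperProj u x) := by
  constructor
  · rintro ⟨w, t, ht, rfl⟩
    rw [hyperProj_coe_add_smul, inner_coe_add_smul hu]
    exact ht
  · intro h
    exact ⟨hyperProj u x, ⟪x, u⟫, h, (hyperProj_add_smul hu x).symm⟩

/-- An infimum of equi-Lipschitz, uniformly semiconcave functions is Lipschitz and semiconcave. -/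
theorem lipschitzWith_and_concaveOn_iInf {V ι : Type*} [NormedAddCommGroup V]
    [InnerProductSpace ℝ V] [Nonempty ι] {g : ι → V → ℝ} {K : ℝ≥0} {C : ℝ}
    (hK : ∀ i, LipschitzWith K (g i))
    (hC : ∀ i, ConcaveOn ℝ univ fun w => g i w - C * ‖w‖ ^ 2)
    (hb : ∀ w, BddBelow (range fun i => g i w)) :
    LipschitzWith K (fun w => ⨅ i, g i w) ∧
      ConcaveOn ℝ univ fun w => (⨅ i, g i w) - C * ‖w‖ ^ 2 := by
  refine ⟨LipschitzWith.of_le_add_mul K fun w w' => ?_, convex_univ, fun w _ w' _ α β hα hβ hαβ => ?_⟩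
  · rw [← sub_le_iff_le_add]
    refine le_ciInf fun i => ?_
    have h1 := (hK i).le_add_mul w w'
    have h2 := ciInf_le (hb w) i
    linarith
  · simp only [smul_eq_mul]
    rw [le_sub_iff_add_le]
    refine le_ciInf fun i => ?_
    have h1 := (hC i).2 (mem_univ w) (mem_univ w') hα hβ hαβ
    simp only [smul_eq_mul] at h1
    have h2 := mul_le_mul_of_nonneg_left (ciInf_le (hb w) i) hα
    have h3 := mul_le_mul_of_nonneg_left (ciInf_le (hb w') i) hβ
    linarith

theorem abs_min_sq_sub_le {s t : ℝ} (hs : 0 ≤ s) (ht : 0 ≤ t) :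
    min (s ^ 2) 1 ≤ min (t ^ 2) 1 + 2 * |s - t| := by
  rcases le_total t 1 with h | h
  · rw [min_eq_left (by nlinarith : t ^ 2 ≤ 1)]
    rcases le_total s 1 with h' | h'
    · rw [min_eq_left (by nlinarith : s ^ 2 ≤ 1)]
      nlinarith [le_abs_self (s - t), abs_nonneg (s - t)]
    · rw [min_eq_right (by nlinarith : 1 ≤ s ^ 2)]
      nlinarith [le_abs_self (s - t), abs_nonneg (s - t)]
  · rw [min_eq_right (by nlinarith : 1 ≤ t ^ 2)]
    have := min_le_right (s ^ 2) 1
    have := abs_nonneg (s - t)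
    linarith

/-- Truncating the square at `1` makes the paraboloid globally Lipschitz and keeps it semiconcave:
`min (‖w - w₀‖²) 1 - ‖w‖²` is the minimum of an affine function and `1 - ‖w‖²`. -/
theorem lipschitzWith_and_concaveOn_paraboloid {V : Type*} [NormedAddCommGroup V]
    [InnerProductSpace ℝ V] (α : ℝ) (q w₀ : V) {C M : ℝ} (hC : 0 ≤ C) (hq : ‖q‖ ≤ M) :
    LipschitzWith (M + 2 * C).toNNReal (fun w => α - ⟪q, w - w₀⟫ + C * min (‖w - w₀‖ ^ 2) 1) ∧
      ConcaveOn ℝ univ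
        fun w => (α - ⟪q, w - w₀⟫ + C * min (‖w - w₀‖ ^ 2) 1) - C * ‖w‖ ^ 2 := by
  constructor
  · refine LipschitzWith.of_le_add_mul _ fun w w' => ?_
    have hM : 0 ≤ M := (norm_nonneg q).trans hq
    rw [Real.coe_toNNReal _ (by positivity), dist_eq_norm]
    have h1 : -⟪q, w - w₀⟫ ≤ -⟪q, w' - w₀⟫ + M * ‖w - w'‖ := by
      have : ⟪q, w' - w₀⟫ - ⟪q, w - w₀⟫ = ⟪q, w' - w⟫ := by rw [← inner_sub_right]; congr 1; abel
      have h2 := real_inner_le_norm q (w' - w)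
      rw [norm_sub_rev w' w] at h2
      have h3 := mul_le_mul_of_nonneg_right hq (norm_nonneg (w - w'))
      linarith
    have h2 := abs_min_sq_sub_le (norm_nonneg (w - w₀)) (norm_nonneg (w' - w₀))
    have h3 : |‖w - w₀‖ - ‖w' - w₀‖| ≤ ‖w - w'‖ := by
      refine (abs_norm_sub_norm_le _ _).trans (le_of_eq ?_); congr 1; abel
    have h4 := mul_le_mul_of_nonneg_left (h2.trans (by linarith :
      _ ≤ min (‖w' - w₀‖ ^ 2) 1 + 2 * ‖w - w'‖)) hC
    nlinarith
  · have haff : ∀ (b : V) (c : ℝ), ConcaveOn ℝ univ fun w : V => ⟪b, w⟫ + c := by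
      intro b c
      refine ⟨convex_univ, fun x _ y _ s t _ _ hst => le_of_eq ?_⟩
      simp only [smul_eq_mul, inner_add_right, real_inner_smul_right]
      have : s * c + t * c = c := by rw [← add_mul, hst, one_mul]
      linarith
    have hsq : ConcaveOn ℝ univ fun w : V => -‖w‖ ^ 2 :=
      ((convexOn_norm convex_univ).pow (fun _ _ => norm_nonneg _) 2).neg
    have h1 := ((haff ((-2 : ℝ) • w₀) (‖w₀‖ ^ 2)).inf (hsq.add_const 1)).smul hC
    have h2 := (haff (-q) (α + ⟪q, w₀⟫)).add h1
    refine h2.congr fun w _ => ?_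
    simp only [Pi.add_apply, Pi.inf_apply, smul_eq_mul, inner_neg_left,
      real_inner_smul_left, inner_sub_right]
    rw [norm_sub_sq_real, real_inner_comm w₀ w]
    have : min (‖w‖ ^ 2 - 2 * ⟪w₀, w⟫ + ‖w₀‖ ^ 2) 1
        = (-2 * ⟪w₀, w⟫ + ‖w₀‖ ^ 2) ⊓ (-‖w‖ ^ 2 + 1) + ‖w‖ ^ 2 := by
      rw [← min_add_add_right]; congr 1 <;> ring
    rw [this]
    ring

/-- Removes the vertical term `t²` from the right side: `t² ≤ 2 (a + t)² + 2 b²`, and `2 K (a + t)²`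
is at most half of `a + t` because `K c ≤ 1 / 4`. -/
theorem le_of_absorb {a t z b c K : ℝ} (hK : 0 ≤ K) (hab : |a| ≤ b)
    (h : a + t ≤ K * (z ^ 2 + t ^ 2)) (hc : a + t ≤ c) (hKc : K * c ≤ 1 / 4) :
    a + t ≤ 2 * K * z ^ 2 + 4 * (K * b ^ 2) := by
  rcases le_or_gt (a + t) 0 with hs | hs
  · exact hs.trans (by positivity)
  · have ha2 : a ^ 2 ≤ b ^ 2 := sq_le_sq' (by linarith [neg_abs_le a]) ((le_abs_self a).trans hab)
    have ht2 : t ^ 2 ≤ 2 * (a + t) ^ 2 + 2 * b ^ 2 := by linarith [sq_nonneg (2 * a + t)]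
    have h5 : K * (a + t) ^ 2 ≤ K * c * (a + t) := by
      rw [pow_two, ← mul_assoc]; gcongr
    have h7 := mul_le_mul_of_nonneg_right hKc hs.le
    have h8 := mul_le_mul_of_nonneg_left ht2 hK
    linarith

/-- A set whose exterior points have nearest-type points with uniformly controlled proximal
normals in a cone around `u` is locally a hypograph of a Lipschitz semiconcave function. -/
theorem exists_hypograph {D : Set F} {x₀ u : F} (hu : ‖u‖ = 1) {C ρ ε₀ : ℝ} (hC : 0 ≤ C)
    (hρ : 0 < ρ) (hε₀ : 0 < ε₀)
    (h : ∀ y ∈ ball x₀ ε₀, y ∉ D → ∃ p ∈ D, ‖y - p‖ ≤ ‖y - x₀‖ ∧ ρ * ‖y - p‖ ≤ ⟪y - p, u⟫ ∧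
      ∀ x ∈ D, x ∈ ball x₀ ε₀ → ⟪y - p, x - p⟫ ≤ C * ‖y - p‖ * ‖x - p‖ ^ 2)
    (hx₀ : ∀ ε > 0, ∃ y ∈ ball x₀ ε, y ∉ D) :
    ∃ ε > 0, ∃ f : (ℝ ∙ u)ᗮ → ℝ, (∃ L : ℝ≥0, LipschitzWith L f) ∧ SemiconcaveOn univ f ∧
      D ∩ ball x₀ ε = hypograph u f ∩ ball x₀ ε := by
  set C₁ := C / ρ with hC₁
  have hC₁0 : 0 ≤ C₁ := by positivity
  -- This is the constant from `le_of_absorb` with `K = C₁` and `b = z / ρ`. In `ε` below, `1 / 4`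
  -- keeps the truncation inactive, the bound with `C₁` permits the absorption, and the one with
  -- `C₂` gives `C₂ ε < 1`, which puts exterior points strictly above their paraboloid.
  set C₂ := 2 * C₁ * (1 + 2 / ρ ^ 2) with hC₂
  have hC₂0 : 0 ≤ C₂ := by positivity
  set ε := min (min ε₀ (1 / 4)) (min (1 / (12 * (C₁ + 1) * (1 + 1 / ρ))) (1 / (2 * (C₂ + 1))))
    with hε
  have hε0 : 0 < ε := lt_min (lt_min hε₀ (by norm_num)) (lt_min (by positivity) (by positivity))
  have hε1 : ε ≤ ε₀ := (min_le_left _ _).trans (min_le_left _ _)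
  have hε2 : ε ≤ 1 / 4 := (min_le_left _ _).trans (min_le_right _ _)
  have hε3 : 12 * ((C₁ + 1) * (ε * (1 + 1 / ρ))) ≤ 1 := by
    have h1 : ε ≤ 1 / (12 * (C₁ + 1) * (1 + 1 / ρ)) := (min_le_right _ _).trans (min_le_left _ _)
    rw [le_div_iff₀ (by positivity)] at h1
    linarith
  have hε4 : 2 * (C₂ + 1) * ε ≤ 1 := by
    have h1 : ε ≤ 1 / (2 * (C₂ + 1)) := (min_le_right _ _).trans (min_le_right _ _)
    rw [le_div_iff₀ (by positivity)] at h1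
    linarith
  have h' : ∀ y : {y // y ∈ ball x₀ ε ∧ y ∉ D}, ∃ p ∈ D, ‖y.1 - p‖ ≤ ‖y.1 - x₀‖ ∧
      ρ * ‖y.1 - p‖ ≤ ⟪y.1 - p, u⟫ ∧
      ∀ x ∈ D, x ∈ ball x₀ ε₀ → ⟪y.1 - p, x - p⟫ ≤ C * ‖y.1 - p‖ * ‖x - p‖ ^ 2 :=
    fun y => h y (ball_subset_ball hε1 y.2.1) y.2.2
  choose p hpD hpx hpu hpC using h'
  have : Nonempty {y // y ∈ ball x₀ ε ∧ y ∉ D} := by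
    obtain ⟨y, hy⟩ := hx₀ ε hε0
    exact ⟨⟨y, hy⟩⟩
  have hyx : ∀ y : {y // y ∈ ball x₀ ε ∧ y ∉ D}, ‖y.1 - x₀‖ < ε := fun y => by
    rw [← dist_eq_norm]; exact y.2.1
  have hpos : ∀ y : {y // y ∈ ball x₀ ε ∧ y ∉ D}, 0 < ‖y.1 - p y‖ := fun y =>
    norm_pos_iff.2 (sub_ne_zero.2 fun hh => y.2.2 (hh ▸ hpD y))
  have hposu : ∀ y, 0 < ⟪y.1 - p y, u⟫ := fun y => (mul_pos hρ (hpos y)).trans_le (hpu y)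
  have hpx₀ : ∀ y, ‖p y - x₀‖ ≤ 2 * ε := by
    intro y
    have h1 : ‖p y - x₀‖ ≤ ‖p y - y.1‖ + ‖y.1 - x₀‖ := norm_sub_le_norm_sub_add_norm_sub _ _ _
    rw [norm_sub_rev (p y) y.1] at h1
    have := hpx y
    have := hyx y
    linarith
  -- Normalizing the vertical component to `1` makes the horizontal part of `-n y` the slope of the
  -- paraboloid at `p y`.
  set n : {y // y ∈ ball x₀ ε ∧ y ∉ D} → F := fun y => ⟪y.1 - p y, u⟫⁻¹ • (y.1 - p y) with hn
  have hnu : ∀ y, ⟪n y, u⟫ = 1 := fun y => by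
    simp only [hn]; rw [real_inner_smul_left, inv_mul_cancel₀ (hposu y).ne']
  have hnn : ∀ y, ‖n y‖ ≤ 1 / ρ := fun y => by
    simp only [hn]
    rw [norm_smul, norm_inv, Real.norm_of_nonneg (hposu y).le, inv_mul_le_iff₀ (hposu y),
      mul_one_div, le_div_iff₀ hρ, mul_comm]
    exact hpu y
  have hnC : ∀ y, ∀ x ∈ D, x ∈ ball x₀ ε₀ → ⟪n y, x - p y⟫ ≤ C₁ * ‖x - p y‖ ^ 2 := by
    intro y x hx hxb
    have h1 : ⟪n y, x - p y⟫ ≤ C * ‖n y‖ * ‖x - p y‖ ^ 2 := by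
      simp only [hn]
      rw [real_inner_smul_left, norm_smul, norm_inv, Real.norm_of_nonneg (hposu y).le]
      have := mul_le_mul_of_nonneg_left (hpC y x hx hxb) (inv_nonneg.2 (hposu y).le)
      linarith
    refine h1.trans ?_
    have : C * ‖n y‖ ≤ C₁ := by
      rw [hC₁, div_eq_mul_one_div]; gcongr; exact hnn y
    gcongr
  set W := hyperProj u with hW
  have hWle : ∀ x, ‖W x‖ ≤ ‖x‖ := fun x => Submodule.norm_orthogonalProjectionOnto_apply_le _ x
  have hdec : ∀ y z, ⟪n y, z⟫ = ⟪W (n y), W z⟫ + ⟪z, u⟫ := fun y z => by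
    rw [inner_eq_inner_hyperProj_add hu, hnu, one_mul]
  set g : {y // y ∈ ball x₀ ε ∧ y ∉ D} → (ℝ ∙ u)ᗮ → ℝ := fun y w =>
    ⟪p y, u⟫ - ⟪W (n y), w - W (p y)⟫ + C₂ * min (‖w - W (p y)‖ ^ 2) 1 with hg
  have hgp := fun y => lipschitzWith_and_concaveOn_paraboloid ⟪p y, u⟫ (W (n y)) (W (p y)) hC₂0
    ((hWle (n y)).trans (hnn y))
  have hinneru : ∀ x : F, |⟪x, u⟫| ≤ ‖x‖ := fun x => by
    have := abs_real_inner_le_norm x u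
    rwa [hu, mul_one] at this
  have hbdd : ∀ w, BddBelow (range fun y => g y w) := by
    intro w
    refine ⟨⟪x₀, u⟫ - 2 * ε - 1 / ρ * (‖w - W x₀‖ + 2 * ε), ?_⟩
    rintro _ ⟨y, rfl⟩
    have h1 : ⟪x₀, u⟫ - 2 * ε ≤ ⟪p y, u⟫ := by
      have h2 := hinneru (p y - x₀)
      rw [inner_sub_left] at h2
      have h3 := neg_abs_le (⟪p y, u⟫ - ⟪x₀, u⟫)
      linarith [hpx₀ y]
    have h2 : ⟪W (n y), w - W (p y)⟫ ≤ 1 / ρ * (‖w - W x₀‖ + 2 * ε) := by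
      refine (real_inner_le_norm _ _).trans ?_
      have h3 : ‖w - W (p y)‖ ≤ ‖w - W x₀‖ + 2 * ε := by
        calc ‖w - W (p y)‖ ≤ ‖w - W x₀‖ + ‖W x₀ - W (p y)‖ :=
              norm_sub_le_norm_sub_add_norm_sub _ _ _
          _ ≤ ‖w - W x₀‖ + 2 * ε := by
            rw [← map_sub]
            gcongr
            refine (hWle _).trans ?_
            rw [norm_sub_rev]; exact hpx₀ y
      gcongr
      exact (hWle _).trans (hnn y)
    have h3 : 0 ≤ C₂ * min (‖w - W (p y)‖ ^ 2) 1 := by positivity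
    simp only [hg]
    linarith
  obtain ⟨hL, hS⟩ := lipschitzWith_and_concaveOn_iInf (fun y => (hgp y).1) (fun y => (hgp y).2) hbdd
  refine ⟨ε, hε0, fun w => ⨅ y, g y w, ⟨_, hL⟩, ⟨2 * C₂, by positivity, ?_⟩, ?_⟩
  · refine hS.congr fun w _ => ?_
    simp only [hg]; ring
  ext x
  simp only [mem_inter_iff, mem_hypograph_iff hu, and_congr_left_iff]
  intro hxb
  have hxb' : ‖x - x₀‖ < ε := by rw [← dist_eq_norm]; exact hxb
  constructor
  · intro hxD
    refine le_ciInf fun y => ?_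
    have h1 := hnC y x hxD (ball_subset_ball hε1 hxb)
    rw [hdec, norm_sq_eq_hyperProj hu] at h1
    have hxp : ‖x - p y‖ ≤ 3 * ε := by
      have h2 : ‖x - p y‖ ≤ ‖x - x₀‖ + ‖x₀ - p y‖ := norm_sub_le_norm_sub_add_norm_sub _ _ _
      rw [norm_sub_rev x₀] at h2
      linarith [hpx₀ y]
    have hz := hWle (x - p y)
    have ht := hinneru (x - p y)
    simp only [hg]
    rw [← map_sub W x (p y)]
    have hx : ⟪x, u⟫ = ⟪x - p y, u⟫ + ⟪p y, u⟫ := by rw [inner_sub_left]; ring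
    rw [hx]
    have hq := abs_real_inner_le_norm (W (n y)) (W (x - p y))
    have hq2 : |⟪W (n y), W (x - p y)⟫| ≤ 1 / ρ * ‖W (x - p y)‖ :=
      hq.trans (by gcongr; exact (hWle _).trans (hnn y))
    rw [min_eq_left (by nlinarith [norm_nonneg (W (x - p y))])]
    change ⟪W (n y), W (x - p y)⟫ + ⟪x - p y, u⟫ ≤
      C₁ * (‖W (x - p y)‖ ^ 2 + ⟪x - p y, u⟫ ^ 2) at h1
    generalize ⟪x - p y, u⟫ = t at h1 ht ⊢
    generalize ⟪W (n y), W (x - p y)⟫ = a at h1 hq2 ⊢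
    generalize ‖W (x - p y)‖ = z at h1 hq2 hz ⊢
    have hz3 : 1 / ρ * z ≤ 1 / ρ * (3 * ε) := by gcongr; linarith
    have hs2 : a + t ≤ 3 * (ε * (1 + 1 / ρ)) := by
      have := le_abs_self a
      have := le_abs_self t
      linarith
    have h6 : C₁ * (3 * (ε * (1 + 1 / ρ))) ≤ 1 / 4 := by
      have : 0 ≤ ε * (1 + 1 / ρ) := by positivity
      linarith
    have h9 : C₂ * z ^ 2 = 2 * C₁ * z ^ 2 + 4 * (C₁ * (1 / ρ * z) ^ 2) := by
      rw [hC₂]; field_simp; ring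
    have := le_of_absorb hC₁0 hq2 h1 hs2 h6
    linarith
  · intro hle
    by_contra hxD
    set y : {y // y ∈ ball x₀ ε ∧ y ∉ D} := ⟨x, hxb, hxD⟩ with hy
    have h1 : ⟪x, u⟫ ≤ g y (W x) := hle.trans (ciInf_le (hbdd _) y)
    simp only [hg] at h1
    rw [← map_sub W x (p y)] at h1
    have hd := hdec y (x - p y)
    have hx : ⟪x, u⟫ = ⟪x - p y, u⟫ + ⟪p y, u⟫ := by rw [inner_sub_left]; ring
    -- An exterior point `x` exceeds the tangent plane of its own paraboloid by at least `‖x - p‖`,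
    -- while the quadratic term contributes at most `C₂ ε ‖x - p‖`.
    have h2 : ‖x - p y‖ ≤ ⟪n y, x - p y⟫ := by
      simp only [hn]
      rw [real_inner_smul_left, real_inner_self_eq_norm_sq, ← div_eq_inv_mul,
        le_div_iff₀ (hposu y), pow_two]
      gcongr
      exact (le_abs_self _).trans (hinneru _)
    have h3 : C₂ * min (‖W (x - p y)‖ ^ 2) 1 ≤ C₂ * (‖x - p y‖ * ε) := by
      have : ‖W (x - p y)‖ ^ 2 ≤ ‖x - p y‖ * ε := by
        rw [pow_two]
        have := hpx y
        exact mul_le_mul (hWle _) ((hWle _).trans (this.trans hxb'.le)) (norm_nonneg _)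
          (norm_nonneg _)
      exact mul_le_mul_of_nonneg_left ((min_le_left _ _).trans this) hC₂0
    have h4 : 0 < ‖x - p y‖ := hpos y
    change ⟪x, u⟫ ≤ ⟪p y, u⟫ - ⟪W (n y), W (x - p y)⟫ + C₂ * min (‖W (x - p y)‖ ^ 2) 1 at h1
    nlinarith

end Hypograph

/-! ### Calculus of `C^{1,1}` maps and shears -/

section C11

variable {E F G : Type*} [NormedAddCommGroup E] [NormedSpace ℝ E] [NormedAddCommGroup F]
  [NormedSpace ℝ F] [NormedAddCommGroup G] [NormedSpace ℝ G]

theorem c11On_univ_iff {f : E → F} :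
    C11On f univ ↔ Differentiable ℝ f ∧ ∃ L : ℝ≥0, LipschitzWith L (fderiv ℝ f) := by
  simp only [C11On, differentiableOn_univ, lipschitzOnWith_univ]

theorem c11On_clm (f : E →L[ℝ] F) : C11On f univ := by
  refine c11On_univ_iff.2 ⟨f.differentiable, 0, ?_⟩
  have : fderiv ℝ f = fun _ => f := by ext1 x; exact f.fderiv
  rw [this]
  exact LipschitzWith.const f

theorem C11On.add {f g : E → F} (hf : C11On f univ) (hg : C11On g univ) :
    C11On (fun x => f x + g x) univ := by
  obtain ⟨hf1, K, hK⟩ := c11On_univ_iff.1 hf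
  obtain ⟨hg1, L, hL⟩ := c11On_univ_iff.1 hg
  refine c11On_univ_iff.2 ⟨hf1.add hg1, K + L, ?_⟩
  have : fderiv ℝ (fun x => f x + g x) = fun x => fderiv ℝ f x + fderiv ℝ g x := by
    ext1 x; exact fderiv_fun_add (hf1 x) (hg1 x)
  rw [this]
  exact hK.add hL

theorem C11On.clm_comp {f : E → F} (hf : C11On f univ) (g : F →L[ℝ] G) :
    C11On (fun x => g (f x)) univ := by
  obtain ⟨hf1, K, hK⟩ := c11On_univ_iff.1 hf
  refine c11On_univ_iff.2 ⟨g.differentiable.comp hf1, ‖ContinuousLinearMap.compL ℝ E F G g‖₊ * K, ?_⟩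
  · have : fderiv ℝ (fun x => g (f x)) =
        fun x => ContinuousLinearMap.compL ℝ E F G g (fderiv ℝ f x) := by
      ext1 x; exact (g.hasFDerivAt.comp x (hf1 x).hasFDerivAt).fderiv
    rw [this]
    exact (ContinuousLinearMap.compL ℝ E F G g).lipschitz.comp hK

theorem C11On.comp_clm {f : F → G} (hf : C11On f univ) (g : E →L[ℝ] F) :
    C11On (fun x => f (g x)) univ := by
  obtain ⟨hf1, K, hK⟩ := c11On_univ_iff.1 hf
  refine c11On_univ_iff.2 ⟨hf1.comp g.differentiable,
    ‖(ContinuousLinearMap.compL ℝ E F G).flip g‖₊ * (K * ‖g‖₊), ?_⟩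
  · have : fderiv ℝ (fun x => f (g x)) =
        fun x => (ContinuousLinearMap.compL ℝ E F G).flip g (fderiv ℝ f (g x)) := by
      ext1 x; exact ((hf1 (g x)).hasFDerivAt.comp x g.hasFDerivAt).fderiv
    rw [this]
    exact ((ContinuousLinearMap.compL ℝ E F G).flip g).lipschitz.comp (hK.comp g.lipschitz)

theorem c11On_const (c : F) : C11On (fun _ : E => c) univ := by
  refine c11On_univ_iff.2 ⟨differentiable_const c, 0, ?_⟩
  rw [fderiv_fun_const]
  exact LipschitzWith.const _

theorem c11On_norm_sq {V : Type*} [NormedAddCommGroup V] [InnerProductSpace ℝ V] :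
    C11On (fun x : V => ‖x‖ ^ 2) univ := by
  refine c11On_univ_iff.2 ⟨differentiable_id.norm_sq ℝ, ‖(2 : ℝ) • (innerSL ℝ : V →L[ℝ] V →L[ℝ] ℝ)‖₊, ?_⟩
  have : fderiv ℝ (fun x : V => ‖x‖ ^ 2) = fun x => ((2 : ℝ) • (innerSL ℝ : V →L[ℝ] V →L[ℝ] ℝ)) x := by
    ext1 x
    exact (hasStrictFDerivAt_norm_sq x).hasFDerivAt.fderiv.trans (by simp [two_smul])
  rw [this]
  exact ((2 : ℝ) • (innerSL ℝ : V →L[ℝ] V →L[ℝ] ℝ)).lipschitz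

/-- Differentiable maps whose derivative is Lipschitz on every ball. -/
def IsLocC11 (f : E → F) : Prop :=
  Differentiable ℝ f ∧ ∀ R : ℝ, ∃ L : ℝ≥0, LipschitzOnWith L (fderiv ℝ f) (closedBall 0 R)

theorem C11On.isLocC11 {f : E → F} (hf : C11On f univ) : IsLocC11 f := by
  obtain ⟨hf1, K, hK⟩ := c11On_univ_iff.1 hf
  exact ⟨hf1, fun R => ⟨K, hK.lipschitzOnWith⟩⟩

theorem IsLocC11.exists_bounds {f : E → F} (hf : IsLocC11 f) (R : ℝ) : ∃ M : ℝ≥0,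
    (∀ x ∈ closedBall (0 : E) R, ‖fderiv ℝ f x‖ ≤ M) ∧ LipschitzOnWith M f (closedBall 0 R) ∧
      LipschitzOnWith M (fderiv ℝ f) (closedBall 0 R) := by
  obtain ⟨L, hL⟩ := hf.2 |R|
  have hsub : closedBall (0 : E) R ⊆ closedBall 0 |R| := closedBall_subset_closedBall (le_abs_self R)
  have hb : ∀ x ∈ closedBall (0 : E) R, ‖fderiv ℝ f x‖ ≤ ‖fderiv ℝ f 0‖ + L * |R| := by
    intro x hx
    have h1 := hL.dist_le_mul x (hsub hx) 0 (mem_closedBall_self (abs_nonneg R))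
    have h2 : dist x 0 ≤ |R| := hsub hx
    have h3 : ‖fderiv ℝ f x‖ ≤ ‖fderiv ℝ f 0‖ + dist (fderiv ℝ f x) (fderiv ℝ f 0) := by
      rw [dist_eq_norm]; exact norm_le_insert' _ _
    have h4 : (L : ℝ) * dist x 0 ≤ L * |R| := by gcongr
    linarith
  set M : ℝ≥0 := max L (‖fderiv ℝ f 0‖ + L * |R|).toNNReal with hM
  have hbM : ∀ x ∈ closedBall (0 : E) R, ‖fderiv ℝ f x‖ ≤ M := fun x hx =>
    (hb x hx).trans ((Real.le_coe_toNNReal _).trans (by rw [hM, NNReal.coe_max]; exact le_max_right _ _))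
  refine ⟨M, hbM, ?_, (hL.mono hsub).weaken (le_max_left _ _)⟩
  refine (convex_closedBall (0 : E) R).lipschitzOnWith_of_nnnorm_fderiv_le (𝕜 := ℝ)
    (fun x _ => hf.1 x) fun x hx => ?_
  exact_mod_cast hbM x hx

theorem IsLocC11.exists_closedBall {f : E → F} (hf : IsLocC11 f) (R : ℝ) :
    ∃ R' : ℝ, ∀ x ∈ closedBall (0 : E) R, f x ∈ closedBall (0 : F) R' := by
  obtain ⟨M, -, hM, -⟩ := hf.exists_bounds |R|
  have hsub : closedBall (0 : E) R ⊆ closedBall 0 |R| := closedBall_subset_closedBall (le_abs_self R)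
  refine ⟨M * |R| + dist (f 0) 0, fun x hx => ?_⟩
  have h1 := hM.dist_le_mul x (hsub hx) 0 (mem_closedBall_self (abs_nonneg R))
  have h2 : dist x 0 ≤ |R| := hsub hx
  have h4 : (M : ℝ) * dist x 0 ≤ M * |R| := by gcongr
  have := dist_triangle (f x) (f 0) 0
  rw [mem_closedBall]; linarith

/-- The chain rule multiplies derivatives, which may be unbounded on the whole space; global
`C^{1,1}` regularity therefore need not survive composition, but the version on balls does. -/
theorem IsLocC11.comp {g : F → G} {f : E → F} (hg : IsLocC11 g) (hf : IsLocC11 f) :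
    IsLocC11 (fun x => g (f x)) := by
  refine ⟨hg.1.comp hf.1, fun R => ?_⟩
  obtain ⟨R', hR'⟩ := hf.exists_closedBall R
  obtain ⟨M, hM1, hM2, hM3⟩ := hf.exists_bounds R
  obtain ⟨N, hN1, -, hN3⟩ := hg.exists_bounds R'
  refine ⟨N * M * M + N * M, LipschitzOnWith.of_dist_le_mul fun x hx y hy => ?_⟩
  have hfd : ∀ x, fderiv ℝ (fun x => g (f x)) x = (fderiv ℝ g (f x)).comp (fderiv ℝ f x) :=
    fun x => ((hg.1 (f x)).hasFDerivAt.comp x (hf.1 x).hasFDerivAt).fderiv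
  rw [hfd, hfd, dist_eq_norm]
  have h1 : (fderiv ℝ g (f x)).comp (fderiv ℝ f x) - (fderiv ℝ g (f y)).comp (fderiv ℝ f y) =
      (fderiv ℝ g (f x) - fderiv ℝ g (f y)).comp (fderiv ℝ f x) +
        (fderiv ℝ g (f y)).comp (fderiv ℝ f x - fderiv ℝ f y) := by
    ext v; simp
  rw [h1]
  have h2 : ‖fderiv ℝ g (f x) - fderiv ℝ g (f y)‖ ≤ N * (M * dist x y) := by
    rw [← dist_eq_norm]
    refine (hN3.dist_le_mul _ (hR' x hx) _ (hR' y hy)).trans ?_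
    gcongr
    exact hM2.dist_le_mul x hx y hy
  have h3 : ‖fderiv ℝ f x - fderiv ℝ f y‖ ≤ M * dist x y := by
    rw [← dist_eq_norm]; exact hM3.dist_le_mul x hx y hy
  calc _ ≤ ‖(fderiv ℝ g (f x) - fderiv ℝ g (f y)).comp (fderiv ℝ f x)‖ +
        ‖(fderiv ℝ g (f y)).comp (fderiv ℝ f x - fderiv ℝ f y)‖ := norm_add_le _ _
    _ ≤ N * (M * dist x y) * M + N * (M * dist x y) := by
      refine add_le_add ?_ ?_
      · exact (ContinuousLinearMap.opNorm_comp_le _ _).trans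
          (mul_le_mul h2 (hM1 x hx) (norm_nonneg _) (by positivity))
      · exact (ContinuousLinearMap.opNorm_comp_le _ _).trans
          (mul_le_mul (hN1 _ (hR' y hy)) h3 (norm_nonneg _) (by positivity))
    _ = _ := by push_cast; ring

theorem IsLocC11.c11On {f : E → F} (hf : IsLocC11 f) {U : Set E} {R : ℝ}
    (hU : U ⊆ closedBall 0 R) : C11On f U := by
  obtain ⟨L, hL⟩ := hf.2 R
  exact ⟨hf.1.differentiableOn, L, hL.mono hU⟩

/-- Mutually inverse locally `C^{1,1}` maps are `C^{1,1}`-diffeomorphisms on bounded open sets. -/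
theorem isC11Diffeo_of_inverse {Φ Ψ : E → E} (hΦ : IsLocC11 Φ) (hΨ : IsLocC11 Ψ)
    (h1 : Function.LeftInverse Ψ Φ) (h2 : Function.RightInverse Ψ Φ) {U : Set E} (hU : IsOpen U)
    {R : ℝ} (hR : U ⊆ closedBall 0 R) : IsC11Diffeo Φ U := by
  obtain ⟨R', hR'⟩ := hΦ.exists_closedBall R
  refine ⟨hU, h1.injective.injOn, ?_, hΦ.c11On hR, Ψ, fun x _ => h1 x, hΨ.c11On (R := R') ?_⟩
  · rw [image_eq_preimage_of_inverse h1 h2]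
    exact hU.preimage hΨ.1.continuous
  · rintro _ ⟨x, hx, rfl⟩
    exact hR' x (hR hx)

/-- A shear: a `C^{1,1}` displacement field constant along its own displacements. -/
structure IsShear (q : E → E) : Prop where
  c11On : C11On q univ
  add_self : ∀ z, q (z + q z) = q z
  sub_self : ∀ z, q (z - q z) = q z

namespace IsShear

variable {q : E → E}

theorem leftInverse (hq : IsShear q) :
    Function.LeftInverse (fun z => z - q z) (fun z => z + q z) := fun z => by
  simp only [hq.add_self, add_sub_cancel_right]

theorem rightInverse (hq : IsShear q) :
    Function.RightInverse (fun z => z - q z) (fun z => z + q z) := fun z => by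
  simp only [hq.sub_self, sub_add_cancel]

theorem c11On_add (hq : IsShear q) : C11On (fun z => z + q z) univ :=
  (c11On_clm (ContinuousLinearMap.id ℝ E)).add hq.c11On

theorem c11On_sub (hq : IsShear q) : C11On (fun z => z - q z) univ := by
  simpa [sub_eq_add_neg] using
    (c11On_clm (ContinuousLinearMap.id ℝ E)).add (hq.c11On.clm_comp (-ContinuousLinearMap.id ℝ E))

theorem isC11Diffeo (hq : IsShear q) : IsC11Diffeo (fun z => z + q z) univ := by
  have hs : Function.Surjective fun z => z + q z := hq.rightInverse.surjective
  refine ⟨isOpen_univ, hq.leftInverse.injective.injOn, ?_, hq.c11On_add, fun z => z - q z,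
    fun z _ => hq.leftInverse z, ?_⟩ <;> rw [image_univ, hs.range_eq]
  · exact isOpen_univ
  · exact hq.c11On_sub

end IsShear

end C11

/-! ### Straightening a semiconcave hypograph into a convex body -/

section Body

variable {F : Type*} [NormedAddCommGroup F] [InnerProductSpace ℝ F]

theorem isShear_paraboloid (u : F) (c : ℝ) :
    IsShear fun z => (c * ‖hyperProj u z‖ ^ 2) • u := by
  have h0 : ∀ t : ℝ, hyperProj u (t • u) = 0 := fun t => by simp
  refine ⟨?_, fun z => ?_, fun z => ?_⟩
  · have := ((c11On_norm_sq (V := (ℝ ∙ u)ᗮ)).comp_clm (hyperProj u)).clm_comp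
      (ContinuousLinearMap.toSpanSingleton ℝ (c • u))
    refine (congrArg (fun f => C11On f univ) ?_).mp this
    ext1 z
    simp [ContinuousLinearMap.toSpanSingleton_apply, smul_smul, mul_comm]
  · simp only [map_add, h0, add_zero]
  · simp only [map_sub, h0, sub_zero]

variable [FiniteDimensional ℝ F]

theorem exists_body_of_mem_nhds {D : Set F} {x₀ : F} (hD : D ∈ 𝓝 x₀) :
    ∃ K : Set F, ∃ q : F → F, IsConvexBody K ∧ IsShear q ∧
      IsNhdIn ((fun z => z + q z) '' K) x₀ D := by
  obtain ⟨ε, hε, hεD⟩ := Metric.nhds_basis_closedBall.mem_iff.1 hD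
  refine ⟨closedBall x₀ ε, fun _ => 0, ⟨isCompact_closedBall _ _, convex_closedBall _ _,
    x₀, ball_subset_interior_closedBall (mem_ball_self hε)⟩, ⟨c11On_const 0, by simp, by simp⟩,
    mem_of_mem_nhds hD, ?_, ?_⟩
  · simpa using hεD
  · simpa using nhdsWithin_le_nhds (closedBall_mem_nhds x₀ hε)

/-- The shear along `u` by `(c/2) ‖w‖²` carries the hypograph of the concave function `g = f - (c/2)
‖w‖²` onto that of `f`. The body is the part of the convex hypograph in a small ball about the
preimage `z₀` of `x₀`; pushing `z₀` down along `u` gives an interior point. -/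
theorem exists_body_of_hypograph {D : Set F} {x₀ u : F} (hu : ‖u‖ = 1) (hx₀ : x₀ ∈ D) {ε : ℝ}
    (hε : 0 < ε) {f : (ℝ ∙ u)ᗮ → ℝ} (hfc : Continuous f) (hf : SemiconcaveOn univ f)
    (hD : D ∩ ball x₀ ε = hypograph u f ∩ ball x₀ ε) :
    ∃ K : Set F, ∃ q : F → F, IsConvexBody K ∧ IsShear q ∧
      IsNhdIn ((fun z => z + q z) '' K) x₀ D := by
  obtain ⟨c, hc0, hc⟩ := hf
  set q : F → F := fun z => (c / 2 * ‖hyperProj u z‖ ^ 2) • u with hq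
  have hqs : IsShear q := isShear_paraboloid u (c / 2)
  have hcont : Continuous fun z => z + q z :=
    (c11On_univ_iff.1 hqs.c11On_add).1.continuous
  have hcont' : Continuous fun z => z - q z :=
    (c11On_univ_iff.1 hqs.c11On_sub).1.continuous
  set g : (ℝ ∙ u)ᗮ → ℝ := fun w => f w - c / 2 * ‖w‖ ^ 2 with hg
  have hgc : Continuous g := by fun_prop
  have hWq : ∀ z, hyperProj u (z + q z) = hyperProj u z := fun z => by
    rw [map_add]; simp only [hq]
    simp
  have hmem : ∀ z, z + q z ∈ hypograph u f ↔ z ∈ hypograph u g := fun z => by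
    rw [mem_hypograph_iff hu, mem_hypograph_iff hu, hWq, inner_add_left]
    simp only [hq, hg, real_inner_smul_left, real_inner_self_eq_norm_sq, hu]
    rw [one_pow, mul_one, le_sub_iff_add_le]
  set z₀ := x₀ - q x₀ with hz₀
  have hz₀x : z₀ + q z₀ = x₀ := hqs.rightInverse x₀
  have hgset : hypograph u g = {z | ⟪z, u⟫ ≤ g (hyperProj u z)} := by
    ext z; exact mem_hypograph_iff hu g z
  obtain ⟨δ, hδ, hδε⟩ := Metric.nhds_basis_closedBall.mem_iff.1
    (hcont.continuousAt.preimage_mem_nhds (x := z₀) (t := ball x₀ ε) (by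
      simp only [hz₀x]; exact ball_mem_nhds _ hε))
  have hz₀g : z₀ ∈ hypograph u g := by
    rw [← hmem, hz₀x]
    exact (hD.subset ⟨hx₀, mem_ball_self hε⟩).1
  refine ⟨hypograph u g ∩ closedBall z₀ δ, q, ⟨?_, ?_, ?_⟩, hqs, hx₀, ?_, ?_⟩
  · refine (isCompact_closedBall z₀ δ).inter_left ?_
    rw [hgset]
    exact isClosed_le (by fun_prop) (by fun_prop)
  · refine Convex.inter ?_ (convex_closedBall _ _)
    rw [hgset]
    intro x hx y hy s t hs ht hst
    have h1 := hc.2 (mem_univ (hyperProj u x)) (mem_univ (hyperProj u y)) hs ht hst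
    simp only [smul_eq_mul] at h1
    simp only [mem_ofPred_eq] at hx hy ⊢
    rw [inner_add_left, real_inner_smul_left, real_inner_smul_left, map_add, map_smul, map_smul]
    have h2 := mul_le_mul_of_nonneg_left hx hs
    have h3 := mul_le_mul_of_nonneg_left hy ht
    linarith
  · refine ⟨z₀ - (δ / 2) • u, ?_⟩
    rw [interior_inter]
    constructor
    · have hsub : {z | ⟪z, u⟫ < g (hyperProj u z)} ⊆ hypograph u g := by
        rw [hgset]; intro z hz; exact (mem_ofPred_eq ▸ hz : _ < _).le
      refine interior_maximal hsub (isOpen_lt (by fun_prop) (by fun_prop)) ?_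
      rw [mem_hypograph_iff hu] at hz₀g
      have h1 : hyperProj u (z₀ - (δ / 2) • u) = hyperProj u z₀ := by
        rw [map_sub]; simp
      simp only [mem_ofPred_eq, h1]
      rw [inner_sub_left, real_inner_smul_left, real_inner_self_eq_norm_sq, hu]
      linarith
    · refine ball_subset_interior_closedBall ?_
      rw [mem_ball, dist_eq_norm, sub_sub_cancel_left, norm_neg, norm_smul, hu,
        Real.norm_of_nonneg (by positivity)]
      linarith
  · rintro _ ⟨z, ⟨hz1, hz2⟩, rfl⟩
    exact (hD.superset ⟨(hmem z).2 hz1, hδε hz2⟩).1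
  · rw [mem_nhdsWithin_iff_exists_mem_nhds_inter]
    refine ⟨(fun z => z - q z) ⁻¹' (closedBall z₀ δ) ∩ ball x₀ ε, inter_mem
      (hcont'.continuousAt.preimage_mem_nhds (closedBall_mem_nhds z₀ hδ)) (ball_mem_nhds _ hε), ?_⟩
    rintro x ⟨⟨hx1, hx2⟩, hxD⟩
    have hxx : x - q x + q (x - q x) = x := hqs.rightInverse x
    refine ⟨x - q x, ⟨?_, hx1⟩, hxx⟩
    rw [← hmem, hxx]
    exact (hD.subset ⟨hxD, hx2⟩).1

end Body

/-! ### Whitney extension for `C^{1,1}` functions -/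

section Whitney

variable {V : Type*} [NormedAddCommGroup V] [InnerProductSpace ℝ V]

/-- On a set containing a ball of directions at the right scale, a second-order Taylor bound forces
the gradient field to be Lipschitz. -/
theorem norm_gradient_sub_le {D : Set V} {f : V → ℝ} {G : V → V} {C : ℝ} (hC : 0 ≤ C)
    (hf : ∀ x ∈ D, ∀ y ∈ D, |f y - f x - ⟪G x, y - x⟫| ≤ C * ‖y - x‖ ^ 2) {v : V} {ρ : ℝ}
    (hρ : 0 < ρ) {x y : V} (hx : x ∈ D) (hy : y ∈ D)
    (hball : ∀ e : V, ‖e‖ ≤ ρ → y + ‖x - y‖ • (v + e) ∈ D) :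
    ‖G y - G x‖ ≤ 2 * C * ((‖v‖ + ρ) ^ 2 + (1 + (‖v‖ + ρ)) ^ 2 + 1) / ρ * ‖x - y‖ := by
  rcases eq_or_ne x y with rfl | hxy
  · simp
  set s := ‖x - y‖ with hs
  have hs0 : 0 < s := norm_pos_iff.2 (sub_ne_zero.2 hxy)
  set m := ‖v‖ + ρ with hm
  -- Compare the expansions at `x` and `y` at the third point `z = y + s (v + e)`. Testing `e = 0`
  -- and `e` parallel to `G y - G x` then recovers the norm.
  have key : ∀ e : V, ‖e‖ ≤ ρ → |⟪G y - G x, v + e⟫| ≤ C * (m ^ 2 + (1 + m) ^ 2 + 1) * s := by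
    intro e he
    have hw : ‖v + e‖ ≤ m := (norm_add_le _ _).trans (by rw [hm]; gcongr)
    set z := y + s • (v + e) with hz
    have hzy : z - y = s • (v + e) := by rw [hz]; abel
    have hzyn : ‖z - y‖ ≤ s * m := by
      rw [hzy, norm_smul, Real.norm_of_nonneg hs0.le]; gcongr
    have hzxn : ‖z - x‖ ≤ s * (1 + m) := by
      have : ‖z - x‖ ≤ ‖z - y‖ + ‖y - x‖ := norm_sub_le_norm_sub_add_norm_sub _ _ _
      rw [norm_sub_rev y x] at this
      linarith
    have h1 := hf y hy z (hball e he)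
    have h2 := hf x hx z (hball e he)
    have h3 := hf x hx y hy
    have e1 : C * ‖z - y‖ ^ 2 ≤ C * (s * m) ^ 2 := by gcongr
    have e2 : C * ‖z - x‖ ^ 2 ≤ C * (s * (1 + m)) ^ 2 := by gcongr
    rw [norm_sub_rev y x, ← hs] at h3
    have h4 : s * ⟪G y - G x, v + e⟫ =
        (f z - f x - ⟪G x, z - x⟫) - (f z - f y - ⟪G y, z - y⟫) - (f y - f x - ⟪G x, y - x⟫) := by
      rw [← real_inner_smul_right, ← hzy, inner_sub_left,
        show z - x = (z - y) + (y - x) by abel, inner_add_right]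
      ring
    have h5 : s * |⟪G y - G x, v + e⟫| ≤ s * (C * (m ^ 2 + (1 + m) ^ 2 + 1) * s) := by
      rw [← abs_of_pos hs0, ← abs_mul, abs_of_pos hs0, h4]
      refine (abs_sub _ _).trans ?_
      have := abs_sub (f z - f x - ⟪G x, z - x⟫) (f z - f y - ⟪G y, z - y⟫)
      nlinarith
    exact le_of_mul_le_mul_left h5 hs0
  set g := G y - G x with hg
  rcases eq_or_ne g 0 with h0 | h0
  · rw [h0, norm_zero]; positivity
  have hg0 : 0 < ‖g‖ := norm_pos_iff.2 h0
  have k1 := key 0 (by simpa using hρ.le)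
  have k2 := key ((ρ / ‖g‖) • g) (by
    rw [norm_smul, norm_div, norm_norm, Real.norm_of_nonneg hρ.le, div_mul_cancel₀ _ hg0.ne'])
  rw [add_zero] at k1
  rw [inner_add_right, real_inner_smul_right, real_inner_self_eq_norm_sq] at k2
  have h6 : ρ / ‖g‖ * ‖g‖ ^ 2 = ρ * ‖g‖ := by field_simp
  rw [h6] at k2
  have h7 : ρ * ‖g‖ ≤ 2 * (C * (m ^ 2 + (1 + m) ^ 2 + 1) * s) := by
    have := le_abs_self (⟪g, v⟫ + ρ * ‖g‖)
    have := neg_abs_le ⟪g, v⟫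
    linarith
  rw [div_mul_eq_mul_div, le_div_iff₀ hρ]
  linarith

variable [FiniteDimensional ℝ V]

/-- Separate `(x, F x)` from the open strict epigraph; the functional is strictly negative in the
vertical direction, so dividing by it gives a slope. -/
theorem exists_subgradient {F : V → ℝ} (hF : ConvexOn ℝ univ F) (x : V) :
    ∃ p : V, ∀ y, F x + ⟪p, y - x⟫ ≤ F y := by
  have hcont : Continuous F := continuousOn_univ.1 (hF.continuousOn isOpen_univ)
  have hconv : Convex ℝ {p : V × ℝ | p.1 ∈ univ ∧ F p.1 < p.2} := hF.convex_strict_epigraph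
  have hopen : IsOpen {p : V × ℝ | p.1 ∈ univ ∧ F p.1 < p.2} := by
    simp only [mem_univ, true_and]
    exact isOpen_lt (by fun_prop) (by fun_prop)
  obtain ⟨φ, hφ⟩ := geometric_hahn_banach_open_point hconv hopen (x := (x, F x)) (by simp)
  set β := φ (0, 1) with hβ
  have hdec : ∀ y t, φ (y, t) = φ (y, 0) + t * β := fun y t => by
    rw [hβ, ← smul_eq_mul, ← map_smul, ← map_add]; simp
  have hβ0 : β < 0 := by
    have := hφ (x, F x + 1) (by simp)
    rw [hdec x (F x + 1), hdec x (F x)] at this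
    linarith
  set ψ : V →L[ℝ] ℝ := φ.comp (ContinuousLinearMap.inl ℝ V ℝ) with hψ
  have hψa : ∀ y, φ (y, 0) = ψ y := fun y => by simp [hψ]
  refine ⟨(-β)⁻¹ • (InnerProductSpace.toDual ℝ V).symm ψ, fun y => ?_⟩
  rw [real_inner_smul_left, InnerProductSpace.toDual_symm_apply, map_sub]
  have h1 : ψ y + F y * β ≤ ψ x + F x * β := by
    refine le_of_forall_pos_le_add fun ε hε => ?_
    have h2 := hφ (y, F y + ε / (-β)) (by simp; exact div_pos hε (by linarith))
    rw [hdec y, hdec x (F x), hψa, hψa] at h2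
    have : ε / (-β) * β = -ε := by rw [div_neg, neg_mul, div_mul_cancel₀ _ hβ0.ne]
    linarith
  have h2 : (-β)⁻¹ * (ψ y - ψ x) ≤ F y - F x := by
    rw [inv_mul_le_iff₀ (by linarith)]
    linarith
  linarith

/-- A convex function which is also semiconcave is `C^{1,1}`. -/
theorem ConvexOn.c11On {F : V → ℝ} (hF : ConvexOn ℝ univ F) {C : ℝ} (hC : 0 ≤ C)
    (hs : ∀ x h, F (x + h) + F (x - h) ≤ 2 * F x + C * ‖h‖ ^ 2) : C11On F univ := by
  choose p hp using exists_subgradient hF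
  -- The lower bound is the subgradient inequality; the upper one combines it at the reflected point
  -- `2x - y` with semiconcavity.
  have htaylor : ∀ x y, |F y - F x - ⟪p x, y - x⟫| ≤ C * ‖y - x‖ ^ 2 := by
    intro x y
    have h1 := hp x y
    have h2 := hs x (y - x)
    have h3 := hp x (x - (y - x))
    rw [sub_sub_cancel_left, inner_neg_right] at h3
    rw [add_sub_cancel] at h2
    rw [abs_le]
    constructor
    · have : 0 ≤ C * ‖y - x‖ ^ 2 := by positivity
      linarith
    · linarith
  have hder : ∀ x, HasFDerivAt F (innerSL ℝ (p x)) x := by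
    intro x
    refine HasFDerivAt.of_isLittleO ?_
    have h1 : (fun y => F y - F x - innerSL ℝ (p x) (y - x)) =O[𝓝 x] fun y => ‖y - x‖ ^ 2 := by
      refine Asymptotics.IsBigO.of_bound C (Eventually.of_forall fun y => ?_)
      simpa using htaylor x y
    refine h1.trans_isLittleO ?_
    have h2 : (fun y : V => ‖y - x‖ ^ 2) =o[𝓝 x] fun y => ‖y - x‖ ^ 1 := by
      refine (Asymptotics.isLittleO_pow_pow one_lt_two).comp_tendsto ?_
      have : Continuous fun y : V => ‖y - x‖ := by fun_prop
      simpa using this.tendsto x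
    simpa using h2
  have hlip : ∀ x y, ‖p x - p y‖ ≤ 2 * C * 6 * ‖x - y‖ := by
    intro x y
    have := norm_gradient_sub_le (D := univ) (f := F) (G := p) hC (fun x _ y _ => htaylor x y)
      (v := 0) (ρ := 1) one_pos (mem_univ y) (mem_univ x) (fun _ _ => mem_univ _)
    rw [norm_sub_rev y x, norm_zero] at this
    refine this.trans (le_of_eq ?_)
    ring
  refine c11On_univ_iff.2 ⟨fun x => (hder x).differentiableAt, ‖(innerSL ℝ : V →L[ℝ] V →L[ℝ] ℝ)‖₊ *
    (2 * C * 6).toNNReal, ?_⟩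
  have : fderiv ℝ F = fun x => innerSL ℝ (p x) := by ext1 x; exact (hder x).fderiv
  rw [this]
  refine (innerSL ℝ : V →L[ℝ] V →L[ℝ] ℝ).lipschitz.comp (LipschitzWith.of_dist_le_mul fun x y => ?_)
  rw [Real.coe_toNNReal _ (by positivity), dist_eq_norm, dist_eq_norm]
  exact hlip x y

/-- Whitney's extension theorem for `C^{1,1}` functions. -/
theorem exists_c11On_extension {S : Set V} {f : V → ℝ} {G : V → V} {M : ℝ} (hM : 0 ≤ M)
    (hf : ∀ x ∈ S, ∀ y ∈ S, |f y - f x - ⟪G x, y - x⟫| ≤ M * ‖y - x‖ ^ 2)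
    (hG : ∀ x ∈ S, ∀ y ∈ S, ‖G y - G x‖ ≤ M * ‖y - x‖) :
    ∃ F : V → ℝ, C11On F univ ∧ ∀ x ∈ S, F x = f x := by
  rcases S.eq_empty_or_nonempty with rfl | ⟨y₀, hy₀⟩
  · exact ⟨fun _ => 0, c11On_const 0, by simp⟩
  -- Explicit extension: after adding `K ‖x‖²`, each jet has a paraboloid `q y` above and an affine
  -- function `m y` below, agreeing at `y`. The choice `K = 4 M` gives `m z ≤ q y` for all pairs.
  -- The convex envelope `F` of the paraboloids lies above all the `m z`, hence has the prescribed
  -- values on `S`.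
  set K := 4 * M with hK
  have hK0 : 0 ≤ K := by positivity
  set q : V → V → ℝ := fun y x => f y + ⟪G y, x - y⟫ + K * ‖x‖ ^ 2 + K * ‖x - y‖ ^ 2 with hq
  set m : V → V → ℝ := fun z x => ⟪G z + (2 * K) • z, x⟫ + (f z - ⟪G z, z⟫ - K * ‖z‖ ^ 2) with hm
  have hm' : ∀ z x, m z x = f z + ⟪G z, x - z⟫ + K * ‖x‖ ^ 2 - K * ‖x - z‖ ^ 2 := by
    intro z x
    simp only [hm]
    rw [norm_sub_sq_real, inner_add_left, real_inner_smul_left, inner_sub_right,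
      real_inner_comm z x]
    ring
  have hmq : ∀ z ∈ S, ∀ y ∈ S, ∀ x, m z x ≤ q y x := by
    intro z hz y hy x
    have h1 := (abs_le.1 (hf y hy z hz)).2
    have h2 := hG y hy z hz
    have h3 := real_inner_le_norm (G z - G y) (x - z)
    have h4 : ‖z - y‖ ≤ ‖x - z‖ + ‖x - y‖ := by
      rw [norm_sub_rev x z]; exact norm_sub_le_norm_sub_add_norm_sub _ _ _
    have h5 : ⟪G z - G y, x - z⟫ = ⟪G z, x - z⟫ - ⟪G y, x - y⟫ + ⟪G y, z - y⟫ := by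
      rw [inner_sub_left, show x - y = (x - z) + (z - y) by abel, inner_add_right]; ring
    rw [hm']
    simp only [hq]
    set a := ‖x - z‖
    set b := ‖x - y‖
    have ha : 0 ≤ a := norm_nonneg _
    have hb : 0 ≤ b := norm_nonneg _
    have h6 : ‖G z - G y‖ * a ≤ M * (a + b) * a := by gcongr; exact h2.trans (by gcongr)
    have h7 : M * ‖z - y‖ ^ 2 ≤ M * (a + b) ^ 2 := by gcongr
    have h8 : M * ((a + b) ^ 2 + (a + b) * a) ≤ M * (4 * a ^ 2 + 4 * b ^ 2) :=
      mul_le_mul_of_nonneg_left (by nlinarith [sq_nonneg (a - b)]) hM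
    rw [hK]
    linarith
  set epi : Set (V × ℝ) := {p | ∃ y ∈ S, q y p.1 ≤ p.2} with hepi
  set hull := convexHull ℝ epi with hhull
  have hlow : ∀ p ∈ hull, ∀ z ∈ S, m z p.1 ≤ p.2 := by
    intro p hp z hz
    have hconv : Convex ℝ {p : V × ℝ | m z p.1 ≤ p.2} := by
      intro x hx y hy s t hs ht hst
      simp only [mem_ofPred_eq, hm, Prod.fst_add, Prod.snd_add, Prod.smul_fst, Prod.smul_snd,
        smul_eq_mul, inner_add_right, real_inner_smul_right] at hx hy ⊢
      have h1 := mul_le_mul_of_nonneg_left hx hs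
      have h2 := mul_le_mul_of_nonneg_left hy ht
      have h3 : (s + t) * (f z - ⟪G z, z⟫ - K * ‖z‖ ^ 2) = f z - ⟪G z, z⟫ - K * ‖z‖ ^ 2 := by
        rw [hst, one_mul]
      linarith
    refine convexHull_min ?_ hconv hp
    rintro p ⟨y, hy, hyp⟩
    exact (hmq z hz y hy _).trans hyp
  set F : V → ℝ := fun x => sInf {t | (x, t) ∈ hull} with hF
  have hbdd : ∀ x, BddBelow {t | (x, t) ∈ hull} := fun x => ⟨m y₀ x, fun t ht => hlow _ ht _ hy₀⟩
  have hqmem : ∀ y ∈ S, ∀ x, (x, q y x) ∈ hull := fun y hy x =>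
    subset_convexHull ℝ _ ⟨y, hy, le_rfl⟩
  have hFle : ∀ x t, (x, t) ∈ hull → F x ≤ t := fun x t h => csInf_le (hbdd x) h
  have hFex : ∀ x, ∀ ε > 0, ∃ t, (x, t) ∈ hull ∧ t < F x + ε := fun x ε hε => by
    obtain ⟨t, ht, h⟩ := exists_lt_of_csInf_lt (s := {t | (x, t) ∈ hull}) ⟨_, hqmem y₀ hy₀ x⟩
      (lt_add_of_pos_right (F x) hε)
    exact ⟨t, ht, h⟩
  have hconv : ConvexOn ℝ univ F := by
    refine ⟨convex_univ, fun x _ y _ s t hs ht hst => le_of_forall_pos_le_add fun ε hε => ?_⟩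
    obtain ⟨α, hα, hα'⟩ := hFex x ε hε
    obtain ⟨β, hβ, hβ'⟩ := hFex y ε hε
    have h1 : F (s • x + t • y) ≤ s * α + t * β :=
      hFle _ _ (convex_convexHull ℝ epi hα hβ hs ht hst)
    simp only [smul_eq_mul]
    have h2 := mul_le_mul_of_nonneg_left hα'.le hs
    have h3 := mul_le_mul_of_nonneg_left hβ'.le ht
    have h4 : (s + t) * ε = ε := by rw [hst, one_mul]
    linarith
  have hsemi : ∀ x h, F (x + h) + F (x - h) ≤ 2 * F x + 4 * K * ‖h‖ ^ 2 := by
    intro x h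
    -- Convexity of `F` makes the semiconcavity condition convex in `(x, t)`, so it passes from the
    -- epigraphs of the `q y` to their convex hull.
    have hcs : Convex ℝ {p : V × ℝ | F (p.1 + h) + F (p.1 - h) ≤ 2 * p.2 + 4 * K * ‖h‖ ^ 2} := by
      intro x hx y hy s t hs ht hst
      simp only [mem_ofPred_eq, Prod.fst_add, Prod.snd_add, Prod.smul_fst, Prod.smul_snd,
        smul_eq_mul] at hx hy ⊢
      have h1 := hconv.2 (mem_univ (x.1 + h)) (mem_univ (y.1 + h)) hs ht hst
      have h2 := hconv.2 (mem_univ (x.1 - h)) (mem_univ (y.1 - h)) hs ht hst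
      have e0 : h = s • h + t • h := by rw [← add_smul, hst, one_smul]
      have e1 : s • (x.1 + h) + t • (y.1 + h) = s • x.1 + t • y.1 + h := by
        conv_rhs => rw [e0]
        simp only [smul_add]; abel
      have e2 : s • (x.1 - h) + t • (y.1 - h) = s • x.1 + t • y.1 - h := by
        conv_rhs => rw [e0]
        simp only [smul_sub]; abel
      rw [e1] at h1
      rw [e2] at h2
      simp only [smul_eq_mul] at h1 h2
      have h3 := mul_le_mul_of_nonneg_left hx hs
      have h4 := mul_le_mul_of_nonneg_left hy ht
      have h5 : (s + t) * (4 * K * ‖h‖ ^ 2) = 4 * K * ‖h‖ ^ 2 := by rw [hst, one_mul]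
      linarith
    have hsub : hull ⊆ {p : V × ℝ | F (p.1 + h) + F (p.1 - h) ≤ 2 * p.2 + 4 * K * ‖h‖ ^ 2} := by
      refine convexHull_min ?_ hcs
      rintro ⟨x, t⟩ ⟨y, hy, hyt⟩
      have h1 := hFle _ _ (hqmem y hy (x + h))
      have h2 := hFle _ _ (hqmem y hy (x - h))
      simp only [hq] at h1 h2 hyt
      rw [show x + h - y = (x - y) + h by abel, norm_add_sq_real, norm_add_sq_real,
        inner_add_right] at h1
      rw [show x - h - y = (x - y) - h by abel, norm_sub_sq_real (x - y) h, norm_sub_sq_real x h,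
        inner_sub_right _ (x - y) h] at h2
      simp only [mem_ofPred_eq]
      linarith
    refine le_of_forall_pos_le_add fun ε hε => ?_
    obtain ⟨t, ht, ht'⟩ := hFex x (ε / 2) (by positivity)
    have := hsub ht
    simp only [mem_ofPred_eq] at this
    linarith
  refine ⟨fun x => F x + (-K) * ‖x‖ ^ 2, ?_, fun x hx => ?_⟩
  · refine (ConvexOn.c11On hconv (by positivity) hsemi).add ?_
    have := (c11On_norm_sq (V := V)).clm_comp ((-K) • ContinuousLinearMap.id ℝ ℝ)
    simpa using this
  · have h1 := hFle _ _ (hqmem x hx x)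
    have h2 : m x x ≤ F x := le_csInf ⟨_, hqmem x hx x⟩ fun t ht => hlow _ ht x hx
    rw [hm'] at h2
    simp only [hq, sub_self, inner_zero_right, norm_zero] at h1 h2
    simp only
    linarith

end Whitney

/-! ### A degree formula by change of variables and interpolation -/

section Degree

open MeasureTheory Polynomial

variable {V : Type*} [NormedAddCommGroup V] [InnerProductSpace ℝ V] [FiniteDimensional ℝ V]

theorem exists_polynomial_det (A : V →L[ℝ] V) :
    ∃ P : ℝ[X], P.natDegree ≤ Module.finrank ℝ V ∧
      ∀ t : ℝ, P.eval t = (ContinuousLinearMap.id ℝ V + t • A).det := by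
  set b := Module.finBasis ℝ V with hb
  set M := LinearMap.toMatrix b b (A : V →ₗ[ℝ] V) with hM
  refine ⟨((X : ℝ[X]) • M.map (C : ℝ →+* ℝ[X]) + (1 : Matrix _ _ ℝ).map (C : ℝ →+* ℝ[X])).det, ?_, fun t => ?_⟩
  · simpa using natDegree_det_X_add_C_le M 1
  · rw [ContinuousLinearMap.det, ← LinearMap.det_toMatrix b, ← coe_evalRingHom, RingHom.map_det]
    congr 1
    have h1 : ((ContinuousLinearMap.id ℝ V + t • A : V →L[ℝ] V) : V →ₗ[ℝ] V) =
        LinearMap.id + t • (A : V →ₗ[ℝ] V) := rfl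
    have h2 : LinearMap.toMatrix b b (LinearMap.id + t • (A : V →ₗ[ℝ] V)) = 1 + t • M := by
      rw [map_add, map_smul, ← hM, LinearMap.toMatrix_id]
    rw [h1, h2]
    ext i j
    by_cases hij : i = j <;> simp [hij, add_comm] <;> ring

/-- The determinant is `1` at parameter `0` and cannot vanish before `t`, since a kernel vector
would violate `t ‖A‖ < 1`. -/
theorem det_id_add_smul_pos {A : V →L[ℝ] V} {t : ℝ} (ht : 0 ≤ t) (hA : t * ‖A‖ < 1) :
    0 < (ContinuousLinearMap.id ℝ V + t • A).det := by
  obtain ⟨P, -, hP⟩ := exists_polynomial_det A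
  have hne : ∀ s ∈ Icc 0 t, P.eval s ≠ 0 := by
    intro s hs h0
    rw [hP] at h0
    obtain ⟨v, hv, hv0⟩ := (Submodule.ne_bot_iff _).1 (LinearMap.bot_lt_ker_of_det_eq_zero h0).ne'
    have h1 : v + s • A v = 0 := hv
    have h2 : ‖v‖ ≤ t * ‖A‖ * ‖v‖ := by
      have h3 : v = -(s • A v) := eq_neg_of_add_eq_zero_left h1
      calc ‖v‖ = ‖s • A v‖ := by conv_lhs => rw [h3, norm_neg]
        _ = s * ‖A v‖ := by rw [norm_smul, Real.norm_of_nonneg hs.1]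
        _ ≤ t * (‖A‖ * ‖v‖) := mul_le_mul hs.2 (A.le_opNorm v) (norm_nonneg _) ht
        _ = _ := by ring
    have := norm_pos_iff.2 hv0
    nlinarith
  rw [← hP]
  by_contra hcon
  push Not at hcon
  have h0 : P.eval 0 = 1 := by rw [hP, zero_smul, add_zero]; simp [ContinuousLinearMap.det]
  obtain ⟨s, hs, hs0⟩ := intermediate_value_Icc' ht P.continuous.continuousOn
    (show (0 : ℝ) ∈ Icc (P.eval t) (P.eval 0) by rw [h0]; exact ⟨hcon, zero_le_one⟩)
  exact hne s hs hs0

variable [MeasurableSpace V] [BorelSpace V] (μ : Measure V) [μ.IsAddHaarMeasure]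

/-- Change of variables for a small perturbation of the identity supported in a ball. -/
theorem setIntegral_perturbation_eq {H : V → V} (hH : ContDiff ℝ 1 H) {R : ℝ}
    (hsupp : ∀ x, x ∉ closedBall (0 : V) R → H x = 0) {M : ℝ≥0} (hM : ∀ x, ‖fderiv ℝ H x‖ ≤ M)
    {t : ℝ} (ht : 0 ≤ t) (htM : t * M < 1) (g : V → ℝ) :
    ∫ x in closedBall 0 R, (ContinuousLinearMap.id ℝ V + t • fderiv ℝ H x).det * g (x + t • H x) ∂μ
      = ∫ x in closedBall 0 R, g x ∂μ := by
  have hHd := hH.differentiable one_ne_zero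
  have hlip : LipschitzWith M H := lipschitzWith_of_nnnorm_fderiv_le hHd fun x => by
    exact_mod_cast hM x
  have hinj : Function.Injective fun x => x + t • H x := by
    intro x y hxy
    simp only at hxy
    by_contra hne
    have h1 : x - y = t • (H y - H x) := by
      rw [smul_sub]
      have : x = y + t • H y - t • H x := by rw [← hxy]; abel
      conv_lhs => rw [this]
      abel
    have h2 : ‖x - y‖ ≤ t * M * ‖x - y‖ := by
      conv_lhs => rw [h1, norm_smul, Real.norm_of_nonneg ht]
      rw [mul_assoc, norm_sub_rev x y]
      gcongr
      simpa [dist_eq_norm] using hlip.dist_le_mul y x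
    have := norm_pos_iff.2 (sub_ne_zero.2 hne)
    nlinarith
  -- A preimage of `y` is a fixed point of the contraction `x ↦ y - t H x`. As the map is the
  -- identity off the ball, bijectivity makes it preserve the ball.
  have hsurj : Function.Surjective fun x => x + t • H x := by
    intro y
    have hc : ContractingWith (t.toNNReal * M) fun x => y - t • H x := by
      refine ⟨?_, LipschitzWith.of_dist_le_mul fun x z => ?_⟩
      · rw [← NNReal.coe_lt_coe]; push_cast
        rw [Real.coe_toNNReal _ ht]; exact htM
      · push_cast
        rw [Real.coe_toNNReal _ ht, dist_sub_left, dist_smul₀, Real.norm_of_nonneg ht, mul_assoc]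
        gcongr
        exact hlip.dist_le_mul x z
    have := hc.fixedPoint_isFixedPt
    set x := ContractingWith.fixedPoint _ hc
    refine ⟨x, ?_⟩
    have h1 : y - t • H x = x := this
    simp only
    nth_rewrite 1 [← h1]
    abel
  have hout : ∀ x, x ∉ closedBall (0 : V) R → x + t • H x = x := fun x hx => by
    rw [hsupp x hx, smul_zero, add_zero]
  have himage : (fun x => x + t • H x) '' closedBall (0 : V) R = closedBall 0 R := by
    ext y
    constructor
    · rintro ⟨x, hx, rfl⟩
      by_contra hy
      have := hinj (hout _ hy)
      simp only at this hy
      exact hy (this.symm ▸ hx)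
    · intro hy
      obtain ⟨x, rfl⟩ := hsurj y
      refine ⟨x, ?_, rfl⟩
      by_contra hx
      simp only [hout x hx] at hy
      exact hx hy
  have hder : ∀ x, HasFDerivAt (fun x => x + t • H x)
      (ContinuousLinearMap.id ℝ V + t • fderiv ℝ H x) x := fun x =>
    (hasFDerivAt_id x).add ((hHd x).hasFDerivAt.const_smul t)
  have := integral_image_eq_integral_abs_det_fderiv_smul μ (measurableSet_closedBall (x := (0 : V)) (ε := R))
    (fun x _ => (hder x).hasFDerivWithinAt) hinj.injOn g
  rw [himage] at this
  rw [this]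
  congr 1
  ext1 x
  rw [abs_of_pos (det_id_add_smul_pos ht ?_), smul_eq_mul]
  exact (mul_le_mul_of_nonneg_left (hM x) ht).trans_lt htM

/-- The degree formula for compactly supported perturbations of the identity, for densities which
are polynomial on lines. -/
theorem setIntegral_det_mul_eq {H : V → V} (hH : ContDiff ℝ 1 H) {R : ℝ}
    (hsupp : ∀ x, x ∉ closedBall (0 : V) R → H x = 0) {g : V → ℝ} (hg : Continuous g) {N : ℕ}
    (hgN : ∀ x v : V, ∃ P : ℝ[X], P.natDegree ≤ N ∧ ∀ t : ℝ, P.eval t = g (x + t • v)) :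
    ∫ x in closedBall 0 R, (ContinuousLinearMap.id ℝ V + fderiv ℝ H x).det * g (x + H x) ∂μ
      = ∫ x in closedBall 0 R, g x ∂μ := by
  have hcs : HasCompactSupport H := HasCompactSupport.intro (isCompact_closedBall 0 R) hsupp
  have hfc : Continuous (fderiv ℝ H) := hH.continuous_fderiv one_ne_zero
  obtain ⟨M₀, hM₀⟩ := (hcs.fderiv ℝ).exists_bound_of_continuous hfc
  set M : ℝ≥0 := M₀.toNNReal with hMdef
  have hM : ∀ x, ‖fderiv ℝ H x‖ ≤ M := fun x => (hM₀ x).trans (Real.le_coe_toNNReal _)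
  set n := Module.finrank ℝ V + N + 1 with hn
  -- For fixed `x` the integrand is a polynomial in `t` of degree below `n`. These `n` nodes lie in
  -- the range where change of variables is valid; interpolating from them at `t = 1` carries the
  -- identity to the full perturbation.
  set τ : ℕ → ℝ := fun i => (i : ℝ) / (n * (M + 1)) with hτ
  have hn0 : (0 : ℝ) < n := by rw [hn]; positivity
  have hτ0 : ∀ i, 0 ≤ τ i := fun i => by simp only [hτ]; positivity
  have hτM : ∀ i ∈ Finset.range n, τ i * M < 1 := by
    intro i hi
    have hi' : (i : ℝ) < n := by exact_mod_cast Finset.mem_range.1 hi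
    simp only [hτ]
    rw [div_mul_eq_mul_div, div_lt_one (by positivity)]
    have h1 : (i : ℝ) * M ≤ n * M := by gcongr
    nlinarith
  have hτinj : Set.InjOn τ (Finset.range n : Set ℕ) := by
    intro i _ j _ hij
    simp only [hτ] at hij
    have h2 : (n : ℝ) * (M + 1) ≠ 0 := by positivity
    rw [div_left_inj' h2] at hij
    exact_mod_cast hij
  set c : ℕ → ℝ := fun i => (Lagrange.basis (Finset.range n) τ i).eval 1 with hc
  have hc1 : ∑ i ∈ Finset.range n, c i = 1 := by
    have := congrArg (Polynomial.eval 1) (Lagrange.sum_basis hτinj (by simp [hn]))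
    simpa [eval_finsetSum, hc] using this
  set φ : ℝ → V → ℝ := fun t x =>
    (ContinuousLinearMap.id ℝ V + t • fderiv ℝ H x).det * g (x + t • H x) with hφ
  have hφc : ∀ t, Continuous (φ t) := fun t => by
    refine Continuous.mul (ContinuousLinearMap.continuous_det.comp (by fun_prop)) ?_
    exact hg.comp (continuous_id.add (hH.continuous.const_smul t))
  have hint : ∀ t, IntegrableOn (φ t) (closedBall 0 R) μ := fun t =>
    (hφc t).continuousOn.integrableOn_compact (isCompact_closedBall 0 R)
  have hinterp : ∀ x, φ 1 x = ∑ i ∈ Finset.range n, φ (τ i) x * c i := by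
    intro x
    obtain ⟨P, hP, hPe⟩ := exists_polynomial_det (fderiv ℝ H x)
    obtain ⟨Q, hQ, hQe⟩ := hgN x (H x)
    have he : ∀ t, (P * Q).eval t = φ t x := fun t => by rw [eval_mul, hPe, hQe]
    have hdeg : (P * Q).degree < (Finset.range n).card := by
      refine lt_of_le_of_lt degree_le_natDegree ?_
      rw [Finset.card_range]
      have : (P * Q).natDegree < n := natDegree_mul_le.trans_lt (by omega)
      exact_mod_cast this
    have := congrArg (Polynomial.eval 1) (Lagrange.eq_interpolate hτinj hdeg)
    rw [he, Lagrange.interpolate_apply, eval_finsetSum] at this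
    rw [this]
    refine Finset.sum_congr rfl fun i _ => ?_
    rw [eval_mul, eval_C, he]
  have h1 : ∫ x in closedBall 0 R, φ 1 x ∂μ = ∫ x in closedBall 0 R, g x ∂μ := by
    calc ∫ x in closedBall 0 R, φ 1 x ∂μ
        = ∫ x in closedBall 0 R, ∑ i ∈ Finset.range n, φ (τ i) x * c i ∂μ := by
          congr 1; ext1 x; exact hinterp x
      _ = ∑ i ∈ Finset.range n, ∫ x in closedBall 0 R, φ (τ i) x * c i ∂μ :=
          integral_finsetSum _ fun i _ => (hint _).mul_const _
      _ = ∑ i ∈ Finset.range n, (∫ x in closedBall 0 R, g x ∂μ) * c i := by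
          refine Finset.sum_congr rfl fun i hi => ?_
          rw [integral_mul_const,
            setIntegral_perturbation_eq μ hH hsupp hM (hτ0 i) (hτM i hi) g]
      _ = _ := by rw [← Finset.mul_sum, hc1, mul_one]
  simpa [hφ] using h1

end Degree

/-! ### A point of nonzero Jacobian mapped near the origin -/

section Degree

open MeasureTheory Polynomial

variable {V : Type*} [NormedAddCommGroup V] [InnerProductSpace ℝ V] [FiniteDimensional ℝ V]

/-- A compactly supported perturbation of the identity has a point with nonzero Jacobian which is
mapped close to the origin. -/
theorem exists_det_ne_zero {H : V → V} (hH : ContDiff ℝ 1 H) {R δ : ℝ} (hδ : 0 < δ)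
    (hδR : δ ≤ R) (hsupp : ∀ x, x ∉ closedBall (0 : V) R → H x = 0) :
    ∃ x ∈ closedBall (0 : V) R, ‖x + H x‖ < δ ∧
      (ContinuousLinearMap.id ℝ V + fderiv ℝ H x).det ≠ 0 := by
  by_contra hcon
  push Not at hcon
  borelize V
  set μ : Measure V := MeasureTheory.volume
  set B := closedBall (0 : V) R with hB
  have hBc : IsCompact B := isCompact_closedBall 0 R
  have hcont : Continuous fun x => x + H x := continuous_id.add hH.continuous
  have hfc : Continuous (fderiv ℝ H) := hH.continuous_fderiv one_ne_zero
  have hdet : Continuous fun x => (ContinuousLinearMap.id ℝ V + fderiv ℝ H x).det :=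
    ContinuousLinearMap.continuous_det.comp (by fun_prop)
  obtain ⟨R₁, hR₁⟩ := hBc.exists_bound_of_continuousOn hcont.continuousOn
  obtain ⟨J, hJ⟩ := hBc.exists_bound_of_continuousOn hdet.continuousOn
  set S := max (max R₁ R) 1 with hS
  have hS0 : 0 < S := lt_max_of_lt_right one_pos
  have hRS : R ≤ S := (le_max_right _ _).trans (le_max_left _ _)
  have hR₁S : R₁ ≤ S := (le_max_left _ _).trans (le_max_left _ _)
  have hJ0 : 0 ≤ J := (norm_nonneg _).trans (hJ 0 (mem_closedBall_self (hδ.le.trans hδR)))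
  set α := 1 - δ ^ 2 / S ^ 2 with hα
  set β := 1 - (δ / 2) ^ 2 / S ^ 2 with hβ
  have hδS : δ ≤ S := hδR.trans hRS
  have hα0 : 0 ≤ α := by
    rw [hα, sub_nonneg, div_le_one (by positivity)]; gcongr
  have hαβ : α < β := by
    rw [hα, hβ]; gcongr; linarith
  have hβ0 : 0 < β := hα0.trans_lt hαβ
  -- These densities are polynomial on lines and concentrate at the origin. If the Jacobian vanished
  -- wherever `‖x + H x‖ < δ`, one side of the degree formula would be `O(α ^ p)`, while the other
  -- is at least a positive multiple of `β ^ p` with `α < β`.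
  set g : ℕ → V → ℝ := fun p y => (1 - ‖y‖ ^ 2 / S ^ 2) ^ p with hg
  have hgc : ∀ p, Continuous (g p) := fun p => by fun_prop
  have hgpoly : ∀ p, ∀ x v : V, ∃ P : ℝ[X], P.natDegree ≤ p * 2 ∧
      ∀ t : ℝ, P.eval t = g p (x + t • v) := by
    intro p x v
    refine ⟨(C (1 - ‖x‖ ^ 2 / S ^ 2) - C (2 * ⟪x, v⟫ / S ^ 2) * X - C (‖v‖ ^ 2 / S ^ 2) * X ^ 2) ^ p,
      natDegree_pow_le_of_le p (by compute_degree), fun t => ?_⟩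
    simp only [hg, eval_pow, eval_sub, eval_mul, eval_C, eval_X]
    rw [norm_add_sq_real, real_inner_smul_right, norm_smul, Real.norm_eq_abs, mul_pow, sq_abs]
    ring
  have hmain : ∀ p, μ.real (ball 0 (δ / 2)) * β ^ p ≤ J * μ.real B * α ^ p := by
    intro p
    have heq := setIntegral_det_mul_eq μ hH hsupp (hgc p) (hgpoly p)
    have hgnn : ∀ y : V, ‖y‖ ≤ S → 0 ≤ 1 - ‖y‖ ^ 2 / S ^ 2 := fun y hy => by
      rw [sub_nonneg, div_le_one (by positivity)]; gcongr
    have hgint : IntegrableOn (g p) B μ := (hgc p).continuousOn.integrableOn_compact hBc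
    have hsub : ball (0 : V) (δ / 2) ⊆ B := ball_subset_closedBall.trans
      (closedBall_subset_closedBall (by linarith))
    have hlow : μ.real (ball 0 (δ / 2)) * β ^ p ≤ ∫ x in B, g p x ∂μ := by
      calc μ.real (ball 0 (δ / 2)) * β ^ p = ∫ _ in ball (0 : V) (δ / 2), β ^ p ∂μ := by
            rw [setIntegral_const, smul_eq_mul]
        _ ≤ ∫ x in ball (0 : V) (δ / 2), g p x ∂μ := by
            refine setIntegral_mono_on (integrableOn_const measure_ball_lt_top.ne)
              (hgint.mono_set hsub) measurableSet_ball fun x hx => ?_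
            simp only [hg]
            refine pow_le_pow_left₀ hβ0.le ?_ p
            rw [hβ]
            have : ‖x‖ ≤ δ / 2 := (mem_ball_zero_iff.1 hx).le
            gcongr
        _ ≤ ∫ x in B, g p x ∂μ := by
            refine setIntegral_mono_set hgint ?_ hsub.eventuallyLE
            refine (ae_restrict_iff' measurableSet_closedBall).2 (Eventually.of_forall fun x hx => ?_)
            exact pow_nonneg (hgnn x ((mem_closedBall_zero_iff.1 hx).trans hRS)) p
    have hup : ‖∫ x in B, (ContinuousLinearMap.id ℝ V + fderiv ℝ H x).det * g p (x + H x) ∂μ‖ ≤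
        J * α ^ p * μ.real B := by
      refine norm_setIntegral_le_of_norm_le_const hBc.measure_lt_top fun x hx => ?_
      by_cases hx' : ‖x + H x‖ < δ
      · rw [hcon x hx hx', zero_mul, norm_zero]; positivity
      · push Not at hx'
        rw [norm_mul]
        have h1 := hR₁ x hx
        refine mul_le_mul (hJ x hx) ?_ (norm_nonneg _) hJ0
        simp only [hg]
        rw [norm_pow, Real.norm_of_nonneg (hgnn _ (h1.trans hR₁S))]
        refine pow_le_pow_left₀ (hgnn _ (h1.trans hR₁S)) ?_ p
        rw [hα]; gcongr
    rw [heq] at hup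
    have := (le_abs_self _).trans hup
    linarith
  have hvol : 0 < μ.real (ball (0 : V) (δ / 2)) := by
    rw [measureReal_def]
    exact ENNReal.toReal_pos (measure_ball_pos μ 0 (by positivity)).ne' measure_ball_lt_top.ne
  have hlim : Tendsto (fun p : ℕ => J * μ.real B * (α / β) ^ p) atTop (𝓝 0) := by
    simpa using (tendsto_pow_atTop_nhds_zero_of_lt_one (by positivity)
      ((div_lt_one hβ0).2 hαβ)).const_mul (J * μ.real B)
  obtain ⟨p, hp⟩ := (hlim.eventually (gt_mem_nhds hvol)).exists
  have h1 := hmain p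
  rw [div_pow, ← mul_div_assoc, div_lt_iff₀ (by positivity)] at hp
  linarith

end Degree

/-! ### Lebesgue's covering theorem and embedded balls -/

section Covering

/-- Bounds on the covering dimension pass to closed subspaces. -/
theorem CoveringDimLE.of_isClosedEmbedding {X Y : Type*} [TopologicalSpace X] [TopologicalSpace Y]
    {e : X → Y} (he : Topology.IsClosedEmbedding e) {n : ℕ} (h : CoveringDimLE Y n) :
    CoveringDimLE X n := by
  intro m U hU hcov
  rcases isEmpty_or_nonempty X with hX | ⟨⟨x₀⟩⟩
  · exact ⟨U, hU, fun _ => subset_rfl, hcov, fun x => hX.elim x⟩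
  obtain ⟨i₀, -⟩ := mem_iUnion.1 (hcov.superset (mem_univ x₀))
  choose W hW hWU using fun i => he.isInducing.isOpen_iff.1 (hU i)
  obtain ⟨V', hV', hVU, hVcov, hVn⟩ := h m (fun i => W i ∪ (range e)ᶜ)
    (fun i => (hW i).union he.isClosed_range.isOpen_compl) (by
      refine eq_univ_of_forall fun y => ?_
      by_cases hy : y ∈ range e
      · obtain ⟨x, rfl⟩ := hy
        obtain ⟨i, hi⟩ := mem_iUnion.1 (hcov.superset (mem_univ x))
        rw [← hWU i] at hi
        exact mem_iUnion.2 ⟨i, Or.inl hi⟩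
      · exact mem_iUnion.2 ⟨i₀, Or.inr hy⟩)
  refine ⟨fun i => e ⁻¹' V' i, fun i => (hV' i).preimage he.continuous, fun i x hx => ?_, ?_,
    fun x => hVn (e x)⟩
  · rcases hVU i hx with h1 | h1
    · rw [← hWU i]; exact h1
    · exact absurd (mem_range_self x) h1
  · rw [← preimage_iUnion, hVcov, preimage_univ]

variable {V : Type*} [NormedAddCommGroup V] [InnerProductSpace ℝ V] [FiniteDimensional ℝ V]

/-- A map `∑ ψ i • z i` with few nonconstant coefficients summing to one has singular derivative. -/
theorem det_sum_smulRight_eq_zero {ι : Type*} [Fintype ι] (ψ : ι → V →L[ℝ] ℝ) (z : ι → V)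
    (hsum : ∑ i, ψ i = 0) {I : Set ι} (hI : ∀ i, i ∉ I → ψ i = 0) (hne : I.Nonempty)
    (hcard : I.ncard ≤ Module.finrank ℝ V) : (∑ i, (ψ i).smulRight (z i)).det = 0 := by
  classical
  obtain ⟨i₀, hi₀⟩ := hne
  -- Since the functionals sum to zero, one of them is redundant; the others number fewer than the
  -- dimension and so have a common nonzero kernel vector.
  set J : Finset ι := I.toFinite.toFinset.erase i₀ with hJ
  have hJcard : J.card < Module.finrank ℝ V := by
    have h1 : J.card = I.toFinite.toFinset.card - 1 := Finset.card_erase_of_mem (by simpa using hi₀)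
    have h2 : I.toFinite.toFinset.card = I.ncard := (Set.ncard_eq_toFinset_card I).symm
    have h3 : 0 < I.toFinite.toFinset.card := Finset.card_pos.2 ⟨i₀, by simpa using hi₀⟩
    omega
  set T : V →ₗ[ℝ] (J → ℝ) := LinearMap.pi fun j => (ψ j : V →ₗ[ℝ] ℝ) with hT
  have hker : T.ker ≠ ⊥ := LinearMap.ker_ne_bot_of_finrank_lt (by simpa using hJcard)
  obtain ⟨v, hv, hv0⟩ := (Submodule.ne_bot_iff _).1 hker
  have hψv : ∀ i, i ≠ i₀ → ψ i v = 0 := by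
    intro i hi
    by_cases hiI : i ∈ I
    · have : T v ⟨i, by simp [hJ, hi, hiI]⟩ = 0 := by rw [LinearMap.mem_ker.1 hv]; rfl
      exact this
    · rw [hI i hiI]; rfl
  have hψi₀ : ψ i₀ v = 0 := by
    have h1 : ∑ i, ψ i v = 0 := by
      rw [← _root_.sum_apply, hsum]; rfl
    rwa [Finset.sum_eq_single i₀ (fun i _ hi => hψv i hi) (by simp)] at h1
  have hall : ∀ i, ψ i v = 0 := fun i => by
    by_cases hi : i = i₀
    · rw [hi, hψi₀]
    · exact hψv i hi
  by_contra hdet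
  have hunit := (LinearMap.isUnit_iff_isUnit_det _).2 (isUnit_iff_ne_zero.2 hdet)
  refine hv0 (LinearMap.ker_eq_bot'.1 ((LinearMap.isUnit_iff_ker_eq_bot _).1 hunit) v ?_)
  show (∑ i, (ψ i).smulRight (z i)) v = 0
  rw [_root_.sum_apply]
  exact Finset.sum_eq_zero fun i _ => by simp [hall i]

open scoped Manifold ContDiff in
/-- **Lebesgue's covering theorem**: the covering dimension of the unit ball is at least the
dimension of the space. -/
theorem finrank_le_of_coveringDimLE_closedBall {n : ℕ}
    (h : CoveringDimLE (closedBall (0 : V) 1) n) : Module.finrank ℝ V ≤ n := by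
  classical
  by_contra! hlt
  obtain ⟨t, -, ht⟩ := (isCompact_closedBall (0 : V) 1).elim_nhds_subcover (fun z => ball z (1 / 8))
    fun z _ => ball_mem_nhds z (by norm_num)
  set M := t.card
  set eM := t.equivFin
  set z : Fin M → V := fun i => (eM.symm i : V) with hz
  obtain ⟨O, hO, hOU, hOcov, hOn⟩ := h M (fun i => Subtype.val ⁻¹' ball (z i) (1 / 8))
    (fun i => isOpen_ball.preimage continuous_subtype_val) (by
      refine eq_univ_of_forall fun x => ?_
      obtain ⟨y, hy, hxy⟩ := mem_iUnion₂.1 (ht x.2)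
      refine mem_iUnion.2 ⟨eM ⟨y, hy⟩, ?_⟩
      simpa [hz] using hxy)
  choose W hW hWO using fun i => isOpen_induced_iff.1 (hO i)
  set s := closedBall (0 : V) (3 / 4) with hs
  have hsub : s ⊆ closedBall 0 1 := closedBall_subset_closedBall (by norm_num)
  obtain ⟨ψ, hψ⟩ := SmoothPartitionOfUnity.exists_isSubordinate 𝓘(ℝ, V) (M := V) (s := s)
    isClosed_closedBall (fun i => W i ∩ ball 0 1) (fun i => (hW i).inter isOpen_ball) (by
      intro x hx
      obtain ⟨i, hi⟩ := mem_iUnion.1 (hOcov.superset (mem_univ ⟨x, hsub hx⟩))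
      rw [← hWO i] at hi
      exact mem_iUnion.2 ⟨i, hi, closedBall_subset_ball (by norm_num) hx⟩)
  have hψs : ∀ i, ContDiff ℝ 1 (ψ i) := fun i =>
    (ψ i).contMDiff.contDiff.of_le (by exact_mod_cast le_top)
  have hsum : ∀ x ∈ s, ∑ i, ψ i x = 1 := fun x hx => by
    rw [← ψ.sum_eq_one hx, finsum_eq_sum_of_fintype]
  have hnear : ∀ i x, x ∈ tsupport (ψ i) → ‖z i - x‖ < 1 / 8 := fun i x hx => by
    obtain ⟨h1, h2⟩ := hψ i hx
    have h3 : (⟨x, ball_subset_closedBall h2⟩ : closedBall (0 : V) 1) ∈ O i := by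
      rw [← hWO i]; exact h1
    have h4 : x ∈ ball (z i) (1 / 8) := hOU i h3
    rwa [mem_ball, dist_eq_norm, norm_sub_rev] at h4
  -- `F` moves points of `s` by at most `1 / 8`. At each point of the open ball of radius `3 / 4`,
  -- at most `n + 1 ≤ finrank ℝ V` of the weights have nonzero derivative, so the derivative of `F`
  -- is singular there.
  set F : V → V := fun x => ∑ i, ψ i x • z i with hF
  have hFs : ContDiff ℝ 1 F := ContDiff.sum fun i _ => (hψs i).smul contDiff_const
  have hFx : ∀ x ∈ s, ‖F x - x‖ ≤ 1 / 8 := by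
    intro x hx
    have h1 : F x - x = ∑ i, ψ i x • (z i - x) := by
      simp only [hF, smul_sub, Finset.sum_sub_distrib]
      rw [← Finset.sum_smul, hsum x hx, one_smul]
    rw [h1]
    calc ‖∑ i, ψ i x • (z i - x)‖ ≤ ∑ i, ‖ψ i x • (z i - x)‖ := norm_sum_le _ _
      _ ≤ ∑ i, ψ i x * (1 / 8) := by
        refine Finset.sum_le_sum fun i _ => ?_
        rw [norm_smul, Real.norm_of_nonneg (ψ.nonneg i x)]
        by_cases hx0 : ψ i x = 0
        · simp [hx0]
        · have := hnear i x (subset_tsupport _ hx0)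
          exact mul_le_mul_of_nonneg_left this.le (ψ.nonneg i x)
      _ = 1 / 8 := by rw [← Finset.sum_mul, hsum x hx, one_mul]
  set χ : ContDiffBump (0 : V) := ⟨1 / 4, 1 / 2, by norm_num, by norm_num⟩ with hχ
  set H : V → V := fun x => χ x • (F x - x) with hH
  have hHs : ContDiff ℝ 1 H := (χ.contDiff (n := 1)).smul (hFs.sub contDiff_id)
  have hHsupp : ∀ x, x ∉ closedBall (0 : V) (1 / 2) → H x = 0 := by
    intro x hx
    have : χ x = 0 := by
      rw [← Function.notMem_support, χ.support_eq]
      exact fun hh => hx (ball_subset_closedBall hh)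
    simp only [hH, this, zero_smul]
  obtain ⟨x, hx, hxδ, hdet⟩ := exists_det_ne_zero hHs (R := 1 / 2) (δ := 1 / 8) (by norm_num)
    (by norm_num) hHsupp
  refine hdet ?_
  have hxs : x ∈ ball (0 : V) (3 / 4) := closedBall_subset_ball (by norm_num) hx
  have hHx : ‖H x‖ ≤ 1 / 8 := by
    simp only [hH]
    rw [norm_smul, Real.norm_of_nonneg χ.nonneg]
    have := hFx x (ball_subset_closedBall hxs)
    exact (mul_le_of_le_one_left (norm_nonneg _) χ.le_one).trans this
  -- The radii fit: image norm below `1 / 8` plus displacement at most `1 / 8` puts `x` where the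
  -- cutoff is `1`, so `id + H` coincides with `F` near `x`.
  have hx4 : x ∈ ball (0 : V) (1 / 4) := by
    rw [mem_ball_zero_iff]
    have h1 : ‖x‖ ≤ ‖x + H x‖ + ‖H x‖ := by
      simpa using norm_sub_le (x + H x) (H x)
    linarith
  have hHF : H =ᶠ[𝓝 x] fun y => F y - y := by
    filter_upwards [χ.eventuallyEq_one_of_mem_ball hx4] with y hy
    simp only [hH, hy, Pi.one_apply, one_smul]
  have hψd : ∀ i, HasFDerivAt (ψ i) (fderiv ℝ (ψ i) x) x := fun i =>
    ((hψs i).differentiable one_ne_zero x).hasFDerivAt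
  have hFd : HasFDerivAt F (∑ i, (fderiv ℝ (ψ i) x).smulRight (z i)) x :=
    HasFDerivAt.fun_sum fun i _ => (hψd i).smul_const (z i)
  have hHd : fderiv ℝ H x = (∑ i, (fderiv ℝ (ψ i) x).smulRight (z i)) - ContinuousLinearMap.id ℝ V := by
    rw [hHF.fderiv_eq]
    exact (hFd.sub (hasFDerivAt_id x)).fderiv
  rw [hHd, add_sub_cancel]
  have hxQ : x ∈ closedBall (0 : V) 1 := hsub (ball_subset_closedBall hxs)
  refine det_sum_smulRight_eq_zero _ z ?_ (I := {i | (⟨x, hxQ⟩ : closedBall (0 : V) 1) ∈ O i})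
    (fun i hi => ?_) ?_ ((hOn ⟨x, hxQ⟩).trans hlt)
  · have h1 : HasFDerivAt (fun y => ∑ i, ψ i y) (∑ i, fderiv ℝ (ψ i) x) x :=
      HasFDerivAt.fun_sum fun i _ => hψd i
    have h2 : (fun y => ∑ i, ψ i y) =ᶠ[𝓝 x] fun _ => (1 : ℝ) := by
      filter_upwards [isOpen_ball.mem_nhds hxs] with y hy
      exact hsum y (ball_subset_closedBall hy)
    exact (h1.congr_of_eventuallyEq h2.symm).unique (hasFDerivAt_const 1 x)
  · have hnot : x ∉ tsupport (ψ i) := fun hh => hi (by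
      have := (hψ i hh).1
      rw [mem_ofPred_eq, ← hWO i]; exact this)
    have : ψ i =ᶠ[𝓝 x] fun _ => (0 : ℝ) := notMem_tsupport_iff_eventuallyEq.1 hnot
    rw [this.fderiv_eq]; simp
  · obtain ⟨i, hi⟩ := mem_iUnion.1 (hOcov.superset (mem_univ ⟨x, hxQ⟩))
    exact ⟨i, hi⟩

/-- A set of covering dimension at most `n` contains no injective continuous image of a ball of
dimension larger than `n`. -/
theorem CoveringDimLE.finrank_le {Y : Type*} [TopologicalSpace Y] [T2Space Y] {A : Set Y} {n : ℕ}
    (h : CoveringDimLE A n) {x₀ : V} {δ : ℝ} (hδ : 0 < δ) {e : V → Y}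
    (hc : ContinuousOn e (closedBall x₀ δ)) (hinj : InjOn e (closedBall x₀ δ))
    (hmaps : MapsTo e (closedBall x₀ δ) A) : Module.finrank ℝ V ≤ n := by
  have hball : ∀ x : closedBall (0 : V) 1, x₀ + δ • (x : V) ∈ closedBall x₀ δ := fun x => by
    have h1 := mem_closedBall_zero_iff.1 x.2
    rw [mem_closedBall, dist_eq_norm, add_sub_cancel_left, norm_smul, Real.norm_of_nonneg hδ.le]
    exact mul_le_of_le_one_right hδ.le h1
  set φ : closedBall (0 : V) 1 → A := fun x => ⟨e (x₀ + δ • (x : V)), hmaps (hball x)⟩ with hφ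
  have hφc : Continuous φ := by
    refine Continuous.subtype_mk ?_ _
    exact hc.comp_continuous (by fun_prop) hball
  have hφi : Function.Injective φ := by
    intro x y hxy
    have h1 := hinj (hball x) (hball y) (congrArg Subtype.val hxy)
    exact Subtype.ext (smul_right_injective V hδ.ne' (add_left_cancel h1))
  have : CompactSpace (closedBall (0 : V) 1) := isCompact_iff_compactSpace.1 (isCompact_closedBall _ _)
  exact finrank_le_of_coveringDimLE_closedBall
    (h.of_isClosedEmbedding (hφc.isClosedEmbedding hφi))

end Covering

/-! ### Graph structure over the tangent space -/

section Graph

variable {E : Type*} [NormedAddCommGroup E] [InnerProductSpace ℝ E] [FiniteDimensional ℝ E]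

/-- The orthogonal projection onto a subspace. -/
noncomputable abbrev proj (L : Submodule ℝ E) : E →L[ℝ] L := L.orthogonalProjectionOnto

theorem sub_proj_mem (L : Submodule ℝ E) (x : E) : x - (proj L x : E) ∈ Lᗮ :=
  L.sub_starProjection_mem_orthogonal x

theorem inner_coe_eq_inner_proj {L : Submodule ℝ E} (l : L) (x : E) :
    ⟪(l : E), x⟫ = ⟪l, proj L x⟫ := by
  rw [← Submodule.inner_orthogonalProjectionOnto_eq_of_mem_left]

theorem proj_coe {L : Submodule ℝ E} (l : L) : proj L (l : E) = l :=
  Submodule.orthogonalProjectionOnto_mem_subspace_eq_self l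

theorem proj_of_mem_orthogonal {L : Submodule ℝ E} {y : E} (hy : y ∈ Lᗮ) : proj L y = 0 :=
  Submodule.orthogonalProjectionOnto_eq_zero_iff.2 hy

theorem norm_proj_le (L : Submodule ℝ E) (x : E) : ‖proj L x‖ ≤ ‖x‖ :=
  Submodule.norm_orthogonalProjectionOnto_apply_le _ x

theorem inner_sub_proj {L : Submodule ℝ E} {y : E} (hy : y ∈ Lᗮ) (x : E) :
    ⟪y, x - (proj L x : E)⟫ = ⟪y, x⟫ := by
  rw [inner_sub_right, (Submodule.mem_orthogonal' _ _).1 hy _ (proj L x).2, sub_zero]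

/-- Proximal normals lying in `L` point strictly away from the interior of the tangent cone. -/
theorem exists_inner_le_of_mem (A : Set E) (C : ℝ) (a : E) {L : Submodule ℝ E} {v : L} {ρ : ℝ}
    (hρ : 0 < ρ) (hv : ∀ e : L, ‖e‖ ≤ ρ → ∀ m, IsProxNormal A C a m → ⟪m, ((v + e : L) : E)⟫ ≤ 0) :
    ∃ ε > 0, ∀ b, ‖b - a‖ < ε → ∀ n : L, IsProxNormal A C b n → ⟪n, v⟫ ≤ -(ρ / 2) * ‖n‖ := by
  obtain ⟨ε, hε, h⟩ := exists_forall_inner_le A C a (‖v‖ + ρ) (half_pos hρ)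
  refine ⟨ε, hε, fun b hb n hn => ?_⟩
  rcases eq_or_ne n 0 with rfl | h0
  · simp
  have hn0 : 0 < ‖n‖ := norm_pos_iff.2 h0
  set e : L := (ρ / ‖n‖) • n with he
  have hen : ‖e‖ = ρ := by
    rw [he, norm_smul, norm_div, norm_norm, Real.norm_of_nonneg hρ.le, div_mul_cancel₀ _ hn0.ne']
  have h1 := h b hb n hn ((v + e : L) : E) (hv e hen.le)
    ((norm_add_le v e).trans (by rw [hen]))
  rw [← Submodule.coe_inner, inner_add_right, he, real_inner_smul_right,
    real_inner_self_eq_norm_sq] at h1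
  have h2 : ρ / ‖n‖ * ‖n‖ ^ 2 = ρ * ‖n‖ := by field_simp
  rw [h2] at h1
  have h3 : ‖(n : E)‖ = ‖n‖ := rfl
  rw [h3] at h1
  linarith

/-- Two-sided proximal normals near `a` are almost orthogonal to the tangent space at `a`. -/
theorem exists_norm_proj_le (A : Set E) (C : ℝ) (a : E) {L : Submodule ℝ E} {v : L} {ρ : ℝ}
    (hρ : 0 < ρ) (hv : ∀ e : L, ‖e‖ ≤ ρ → ∀ m, IsProxNormal A C a m → ⟪m, ((v + e : L) : E)⟫ ≤ 0)
    {η : ℝ} (hη : 0 < η) :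
    ∃ ε > 0, ∀ b, ‖b - a‖ < ε → ∀ n, IsProxNormal A C b n → IsProxNormal A C b (-n) →
      ‖proj L n‖ ≤ η * ‖n‖ := by
  obtain ⟨ε, hε, h⟩ := exists_forall_inner_le A C a (‖v‖ + ρ) (show 0 < η * ρ / 2 by positivity)
  refine ⟨ε, hε, fun b hb n hn hn' => ?_⟩
  rcases eq_or_ne (proj L n) 0 with h0 | h0
  · rw [h0, norm_zero]; positivity
  have hn0 : 0 < ‖proj L n‖ := norm_pos_iff.2 h0
  set e : L := (ρ / ‖proj L n‖) • proj L n with he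
  have hen : ‖e‖ = ρ := by
    rw [he, norm_smul, norm_div, norm_norm, Real.norm_of_nonneg hρ.le, div_mul_cancel₀ _ hn0.ne']
  have h1 := h b hb n hn ((v + e : L) : E) (hv e hen.le) ((norm_add_le v e).trans (by rw [hen]))
  have h2 := h b hb (-n) hn' ((v + 0 : L) : E) (hv 0 (by simpa using hρ.le))
    (by rw [add_zero, Submodule.coe_norm]; linarith)
  rw [real_inner_comm, inner_coe_eq_inner_proj, inner_add_left, he, real_inner_smul_left,
    real_inner_self_eq_norm_sq] at h1
  rw [real_inner_comm, inner_coe_eq_inner_proj, add_zero, map_neg, inner_neg_right, norm_neg] at h2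
  have h3 : ρ / ‖proj L n‖ * ‖proj L n‖ ^ 2 = ρ * ‖proj L n‖ := by field_simp
  rw [h3] at h1
  -- Adding the test of `n` against `v + e` and of `-n` against `v` cancels the `v` terms.
  have h4 : ρ * ‖proj L n‖ ≤ ρ * (η * ‖n‖) := by linarith
  exact le_of_mul_le_mul_left h4 hρ

/-- A subspace of large dimension which is almost orthogonal to `L` is a graph over `Lᗮ`. -/
theorem exists_mem_sub_proj_eq {L M : Submodule ℝ E}
    (hdim : Module.finrank ℝ Lᗮ ≤ Module.finrank ℝ M)
    (hM : ∀ n ∈ M, ‖proj L n‖ ≤ 1 / 8 * ‖n‖) {y : E} (hy : y ∈ Lᗮ) :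
    ∃ n ∈ M, n - (proj L n : E) = y ∧ ‖n‖ ≤ 2 * ‖y‖ ∧ ‖proj L n‖ ≤ 1 / 4 * ‖y‖ := by
  set Q : M →ₗ[ℝ] Lᗮ := ((Lᗮ.orthogonalProjectionOnto : E →L[ℝ] Lᗮ) : E →ₗ[ℝ] Lᗮ) ∘ₗ M.subtype
    with hQ
  have hQc : ∀ n : M, (Q n : E) = (n : E) - (proj L n : E) := fun n => by
    have h := L.starProjection_add_starProjection_orthogonal (n : E)
    rw [← h, hQ]
    conv_rhs => rw [h]
    rw [eq_sub_iff_add_eq, add_comm]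
    exact h
  have hinj : Function.Injective Q := by
    refine (injective_iff_map_eq_zero Q).2 fun n hn => ?_
    have h1 := hQc n
    rw [hn, Submodule.coe_zero] at h1
    have h2 : (n : E) = proj L n := (sub_eq_zero.1 h1.symm)
    have h3 := hM n n.2
    have h4 : ‖proj L (n : E)‖ = ‖(n : E)‖ := by
      rw [← Submodule.coe_norm]; exact congrArg norm h2.symm
    rw [h4] at h3
    have h5 : ‖(n : E)‖ = 0 := by linarith [norm_nonneg (n : E)]
    exact Subtype.ext (norm_eq_zero.1 h5)
  have heq : Module.finrank ℝ M = Module.finrank ℝ Lᗮ :=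
    le_antisymm (LinearMap.finrank_le_finrank_of_injective hinj) hdim
  obtain ⟨n, hn⟩ := (LinearMap.injective_iff_surjective_of_finrank_eq_finrank heq).1 hinj ⟨y, hy⟩
  have h1 := hQc n
  rw [hn] at h1
  simp only at h1
  have h2 := hM n n.2
  have h3 : ‖(n : E)‖ ≤ ‖y‖ + ‖proj L (n : E)‖ := by
    have : (n : E) = y + (proj L (n : E) : E) := by rw [h1]; abel
    conv_lhs => rw [this]
    exact norm_add_le _ _
  have h4 := norm_nonneg y
  have h5 := norm_nonneg (n : E)
  exact ⟨n, n.2, h1.symm, by linarith, by linarith⟩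

/-- Near a point where the dimension of the tangent cone is maximal, the set is a graph over
(part of) its tangent space, with second-order Taylor expansions. -/
theorem exists_taylor_graph {A : Set E} {r : ℝ} (hr : 0 < r) (hU : ∀ a ∈ A, ball a r ⊆ unp A)
    {a : E} {L : Submodule ℝ E} {v : L} {ρ : ℝ} (hρ : 0 < ρ)
    (hv : ∀ e : L, ‖e‖ ≤ ρ → ∀ m, IsProxNormal A (1 / r) a m → ⟪m, ((v + e : L) : E)⟫ ≤ 0)
    (hdim : ∀ b ∈ A, Module.finrank ℝ (Submodule.span ℝ (posTangentConeAt A b)) ≤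
      Module.finrank ℝ L) :
    ∃ ε > 0, (∀ b ∈ A ∩ closedBall a ε, ∀ b' ∈ A ∩ closedBall a ε,
        ‖b' - b‖ ≤ 2 * ‖proj L b' - proj L b‖) ∧
      ∀ y ∈ Lᗮ, ∃ G : E → L, ∀ b ∈ A ∩ closedBall a ε, ∀ b' ∈ A ∩ closedBall a ε,
        |⟪y, b'⟫ - ⟪y, b⟫ - ⟪G b, proj L b' - proj L b⟫| ≤
          8 / r * ‖y‖ * ‖proj L b' - proj L b‖ ^ 2 := by
  obtain ⟨ε₁, hε₁, h1⟩ := exists_norm_proj_le A (1 / r) a hρ hv (show (0 : ℝ) < 1 / 8 by norm_num)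
  set ε := min (ε₁ / 2) (r / 16) with hε
  have hε0 : 0 < ε := lt_min (by positivity) (by positivity)
  have hlift : ∀ y ∈ Lᗮ, ∀ b ∈ A ∩ closedBall a ε, ∃ n,
      (∀ b' ∈ A, |⟪n, b' - b⟫| ≤ 1 / r * ‖n‖ * ‖b' - b‖ ^ 2) ∧
      n - (proj L n : E) = y ∧ ‖n‖ ≤ 2 * ‖y‖ ∧ ‖proj L n‖ ≤ 1 / 4 * ‖y‖ := by
    rintro y hy b ⟨hbA, hb⟩
    have hba : ‖b - a‖ < ε₁ := by
      rw [mem_closedBall, dist_eq_norm] at hb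
      have : ε ≤ ε₁ / 2 := min_le_left _ _
      linarith
    set M := (Submodule.span ℝ (posTangentConeAt A b))ᗮ with hM
    have hMprox : ∀ n ∈ M, IsProxNormal A (1 / r) b n := fun n hn =>
      isProxNormal_of_mem_orthogonal hr hU hbA hn
    -- Maximality of the tangent dimension enters here: `M` is large enough for every `y ∈ Lᗮ` to be
    -- the `Lᗮ`-component of a two-sided normal at `b`.
    have hd : Module.finrank ℝ Lᗮ ≤ Module.finrank ℝ M := by
      have e1 := Submodule.finrank_add_finrank_orthogonal (𝕜 := ℝ) L
      have e2 := Submodule.finrank_add_finrank_orthogonal (𝕜 := ℝ)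
        (Submodule.span ℝ (posTangentConeAt A b))
      have := hdim b hbA
      rw [hM]; omega
    obtain ⟨n, hn, hn2⟩ := exists_mem_sub_proj_eq hd
      (fun n hn => h1 b hba n (hMprox n hn) (hMprox _ (M.neg_mem hn))) hy
    refine ⟨n, fun b' hb' => abs_le.2 ⟨?_, hMprox n hn b' hb'⟩, hn2⟩
    have := hMprox _ (M.neg_mem hn) b' hb'
    rw [inner_neg_left, norm_neg] at this
    linarith
  have hsplit : ∀ n y x : E, n - (proj L n : E) = y → ⟪y, x⟫ = ⟪n, x⟫ - ⟪proj L n, proj L x⟫ := by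
    intro n y x h
    rw [← h, inner_sub_left, inner_coe_eq_inner_proj]
  have hbilip : ∀ b ∈ A ∩ closedBall a ε, ∀ b' ∈ A ∩ closedBall a ε,
      ‖b' - b‖ ≤ 2 * ‖proj L b' - proj L b‖ := by
    rintro b hb b' hb'
    set x := b' - b with hx
    -- Lift the normal component of `b' - b` itself. This gives `‖y‖ ≤ (‖x‖ + ‖proj L x‖) / 4`,
    -- hence the Lipschitz bound.
    set y := x - (proj L x : E) with hy
    have hyL : y ∈ Lᗮ := sub_proj_mem L x
    obtain ⟨n, hn1, hn2, hn3, hn4⟩ := hlift y hyL b hb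
    have e1 : ‖y‖ ^ 2 = ⟪n, x⟫ - ⟪proj L n, proj L x⟫ := by
      rw [← hsplit n y x hn2, ← inner_sub_proj hyL x, ← hy, real_inner_self_eq_norm_sq]
    have e2 := (le_abs_self _).trans (hn1 b' hb'.1)
    have e3 := (neg_le_abs _).trans (abs_real_inner_le_norm (proj L n) (proj L x))
    have hxε : ‖x‖ ≤ r / 8 := by
      have h2 := hb.2
      have h3 := hb'.2
      rw [mem_closedBall, dist_eq_norm] at h2 h3
      have h4 : ‖x‖ ≤ ‖b' - a‖ + ‖b - a‖ := by
        rw [norm_sub_rev b a]; exact norm_sub_le_norm_sub_add_norm_sub _ _ _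
      have : ε ≤ r / 16 := min_le_right _ _
      linarith
    have e4 : 1 / r * ‖n‖ * ‖x‖ ^ 2 ≤ ‖y‖ * (1 / 4 * ‖x‖) := by
      have : 1 / r * ‖x‖ ≤ 1 / 8 := by
        rw [one_div, ← div_eq_inv_mul, div_le_iff₀ hr]; linarith
      calc 1 / r * ‖n‖ * ‖x‖ ^ 2 = ‖n‖ * (1 / r * ‖x‖) * ‖x‖ := by ring
        _ ≤ (2 * ‖y‖) * (1 / 8) * ‖x‖ := by gcongr
        _ = _ := by ring
    have e5 : ‖proj L n‖ * ‖proj L x‖ ≤ ‖y‖ * (1 / 4 * ‖proj L x‖) := by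
      calc _ ≤ 1 / 4 * ‖y‖ * ‖proj L x‖ := by gcongr
        _ = _ := by ring
    have e6 : ‖y‖ ≤ 1 / 4 * ‖x‖ + 1 / 4 * ‖proj L x‖ := by
      rcases (norm_nonneg y).eq_or_lt with h0 | h0
      · rw [← h0]; positivity
      · refine le_of_mul_le_mul_left ?_ h0
        nlinarith
    have e7 : ‖x‖ ≤ ‖y‖ + ‖proj L x‖ := by
      have : x = y + (proj L x : E) := by rw [hy]; abel
      conv_lhs => rw [this]
      exact norm_add_le _ _
    rw [← map_sub]
    have := norm_nonneg x
    linarith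
  refine ⟨ε, hε0, hbilip, fun y hy => ?_⟩
  choose! N hN1 hN2 hN3 hN4 using hlift y hy
  -- For the lift `n` of `y`, `⟪y, b' - b⟫ = ⟪n, b' - b⟫ - ⟪proj L n, proj L (b' - b)⟫`. The first
  -- term is quadratic, so `-proj L n` is the gradient.
  refine ⟨fun b => -proj L (N b), fun b hb b' hb' => ?_⟩
  have e1 : ⟪y, b'⟫ - ⟪y, b⟫ - ⟪-proj L (N b), proj L b' - proj L b⟫ = ⟪N b, b' - b⟫ := by
    rw [← inner_sub_right, hsplit _ _ (b' - b) (hN2 b hb), inner_neg_left, ← map_sub]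
    ring
  rw [e1]
  refine (hN1 b hb b' hb'.1).trans ?_
  have e2 := hN3 b hb
  have e3 := hbilip b hb b' hb'
  calc 1 / r * ‖N b‖ * ‖b' - b‖ ^ 2
      ≤ 1 / r * (2 * ‖y‖) * (2 * ‖proj L b' - proj L b‖) ^ 2 := by gcongr
    _ = _ := by ring

end Graph

/-! ### Local hypographs: cones of directions, bodies, and a criterion -/

section Shape

variable {F : Type*} [NormedAddCommGroup F] [InnerProductSpace ℝ F]

/-- Near `x₀`, the set `D` is a neighbourhood of `x₀` or the hypograph of a Lipschitz semiconcave
function. -/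
def IsLocallyHypograph (D : Set F) (x₀ : F) : Prop :=
  D ∈ 𝓝 x₀ ∨ ∃ ε > 0, ∃ u : F, ‖u‖ = 1 ∧ ∃ f : (ℝ ∙ u)ᗮ → ℝ,
    (∃ L : ℝ≥0, LipschitzWith L f) ∧ SemiconcaveOn univ f ∧
      D ∩ ball x₀ ε = hypograph u f ∩ ball x₀ ε

theorem IsLocallyHypograph.inter_ball {D : Set F} {x₀ : F} (h : IsLocallyHypograph D x₀) {δ : ℝ}
    (hδ : 0 < δ) : IsLocallyHypograph (D ∩ ball x₀ δ) x₀ := by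
  rcases h with h | ⟨ε, hε, u, hu, f, hL, hS, hD⟩
  · exact Or.inl (inter_mem h (ball_mem_nhds _ hδ))
  · refine Or.inr ⟨min ε δ, lt_min hε hδ, u, hu, f, hL, hS, ?_⟩
    have h1 : ball x₀ (min ε δ) ⊆ ball x₀ ε := ball_subset_ball (min_le_left _ _)
    have h2 : ball x₀ (min ε δ) ⊆ ball x₀ δ := ball_subset_ball (min_le_right _ _)
    ext x
    constructor
    · rintro ⟨⟨hx, -⟩, hb⟩
      exact ⟨(hD.subset ⟨hx, h1 hb⟩).1, hb⟩
    · rintro ⟨hx, hb⟩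
      exact ⟨⟨(hD.superset ⟨hx, h1 hb⟩).1, h2 hb⟩, hb⟩

/-- The set contains, at uniform scale, a ball of directions at each of its points near `x₀`. -/
theorem IsLocallyHypograph.exists_cone {D : Set F} {x₀ : F} (h : IsLocallyHypograph D x₀) :
    ∃ w : F, ∃ ρ > 0, ∃ δ > 0, ∀ x ∈ D ∩ ball x₀ δ, ∀ y ∈ D ∩ ball x₀ δ, ∀ e : F, ‖e‖ ≤ ρ →
      y + ‖x - y‖ • (w + e) ∈ D := by
  have hbd : ∀ {ε : ℝ} {w e x y : F}, x ∈ ball x₀ (ε / 8) → y ∈ ball x₀ (ε / 8) → ‖w + e‖ ≤ 2 →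
      y + ‖x - y‖ • (w + e) ∈ ball x₀ ε := by
    intro ε w e x y hx hy he
    rw [mem_ball, dist_eq_norm] at hx hy ⊢
    have h1 : ‖x - y‖ ≤ ‖x - x₀‖ + ‖y - x₀‖ := by
      rw [norm_sub_rev y]; exact norm_sub_le_norm_sub_add_norm_sub _ _ _
    have h2 : ‖y + ‖x - y‖ • (w + e) - x₀‖ ≤ ‖y - x₀‖ + ‖x - y‖ * 2 := by
      rw [add_sub_right_comm]
      refine (norm_add_le _ _).trans ?_
      rw [norm_smul, norm_norm]
      gcongr
    have h3 := norm_nonneg (x - x₀)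
    linarith
  rcases h with h | ⟨ε, hε, u, hu, f, ⟨K, hK⟩, -, hD⟩
  · obtain ⟨ε, hε, hsub⟩ := Metric.mem_nhds_iff.1 h
    refine ⟨0, 1, one_pos, ε / 8, by positivity, fun x hx y hy e he => hsub ?_⟩
    exact hbd hx.2 hy.2 (by rw [zero_add]; linarith)
  -- The cone around `-u` of this aperture stays below the graph of a `K`-Lipschitz function.
  · refine ⟨-u, 1 / (1 + K), by positivity, ε / 8, by positivity, fun x hx y hy e he => ?_⟩
    have hρ1 : 1 / (1 + (K : ℝ)) ≤ 1 := by
      rw [div_le_one (by positivity)]; linarith [K.2]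
    have hball := hbd (w := -u) (e := e) hx.2 hy.2 (by
      refine (norm_add_le _ _).trans ?_
      rw [norm_neg, hu]; linarith)
    refine (hD.superset ⟨?_, hball⟩).1
    have hyh := (hD.subset ⟨hy.1, ball_subset_ball (by linarith) hy.2⟩).1
    rw [mem_hypograph_iff hu] at hyh ⊢
    set s := ‖x - y‖ with hs
    have hs0 : 0 ≤ s := norm_nonneg _
    have h1 : hyperProj u (y + s • (-u + e)) = hyperProj u y + s • hyperProj u e := by
      have h0 : hyperProj u u = 0 := by simp
      rw [map_add, map_smul, map_add, map_neg, h0, neg_zero, zero_add]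
    have h2 := hK.dist_le_mul (hyperProj u y) (hyperProj u y + s • hyperProj u e)
    rw [dist_self_add_right, norm_smul, Real.norm_of_nonneg hs0, Real.dist_eq] at h2
    have h3 : ‖hyperProj u e‖ ≤ ‖e‖ := Submodule.norm_orthogonalProjectionOnto_apply_le _ e
    have h4 : ⟪e, u⟫ ≤ ‖e‖ := by
      have := real_inner_le_norm e u
      rwa [hu, mul_one] at this
    have h5 : ⟪y + s • (-u + e), u⟫ = ⟪y, u⟫ + s * (-1 + ⟪e, u⟫) := by
      rw [inner_add_left, real_inner_smul_left, inner_add_left, inner_neg_left,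
        real_inner_self_eq_norm_sq, hu]; ring
    rw [h1, h5]
    have h6 := (le_abs_self _).trans h2
    have h7 : K * (s * ‖hyperProj u e‖) ≤ s * (K * ‖e‖) := by
      calc K * (s * ‖hyperProj u e‖) = s * (K * ‖hyperProj u e‖) := by ring
        _ ≤ s * (K * ‖e‖) := by gcongr
    have h8 : (1 + K) * ‖e‖ ≤ 1 := by
      rw [le_div_iff₀ (by positivity)] at he; linarith
    have h9 : s * (-1 + ⟪e, u⟫ + K * ‖e‖) ≤ 0 :=
      mul_nonpos_of_nonneg_of_nonpos hs0 (by linarith)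
    linarith

theorem IsLocallyHypograph.exists_closedBall {D : Set F} {x₀ : F} (h : IsLocallyHypograph D x₀)
    (hx₀ : x₀ ∈ D) : ∃ z : F, ∃ δ > 0, closedBall z δ ⊆ D := by
  rcases h with h | ⟨ε, hε, u, hu, f, ⟨K, hK⟩, -, hD⟩
  · obtain ⟨ε, hε, hsub⟩ := Metric.nhds_basis_closedBall.mem_iff.1 h
    exact ⟨x₀, ε, hε, hsub⟩
  · have hx₀h := (hD.subset ⟨hx₀, mem_ball_self hε⟩).1
    rw [mem_hypograph_iff hu] at hx₀h
    have hopen : IsOpen ({x | ⟪x, u⟫ < f (hyperProj u x)} ∩ ball x₀ ε) := by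
      refine IsOpen.inter (isOpen_lt (by fun_prop) ?_) isOpen_ball
      exact hK.continuous.comp (hyperProj u).continuous
    have hz : x₀ - (ε / 2) • u ∈ {x | ⟪x, u⟫ < f (hyperProj u x)} ∩ ball x₀ ε := by
      constructor
      · have h1 : hyperProj u (x₀ - (ε / 2) • u) = hyperProj u x₀ := by rw [map_sub]; simp
        simp only [mem_ofPred_eq, h1]
        rw [inner_sub_left, real_inner_smul_left, real_inner_self_eq_norm_sq, hu]
        linarith
      · rw [mem_ball, dist_eq_norm, sub_sub_cancel_left, norm_neg, norm_smul, hu,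
          Real.norm_of_nonneg (by positivity)]
        linarith
    obtain ⟨η, hη, hsub⟩ := Metric.nhds_basis_closedBall.mem_iff.1 (hopen.mem_nhds hz)
    refine ⟨_, η, hη, hsub.trans fun x hx => (hD.superset ⟨?_, hx.2⟩).1⟩
    rw [mem_hypograph_iff hu]
    have h2 : ⟪x, u⟫ < f (hyperProj u x) := hx.1
    exact h2.le

theorem IsLocallyHypograph.exists_body [FiniteDimensional ℝ F] {D : Set F} {x₀ : F}
    (h : IsLocallyHypograph D x₀) (hx₀ : x₀ ∈ D) :
    ∃ K : Set F, ∃ q : F → F, IsConvexBody K ∧ IsShear q ∧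
      IsNhdIn ((fun z => z + q z) '' K) x₀ D := by
  rcases h with h | ⟨ε, hε, u, hu, f, ⟨K, hK⟩, hS, hD⟩
  · exact exists_body_of_mem_nhds h
  · exact exists_body_of_hypograph hu hx₀ hε hK.continuous hS hD

/-- A criterion for local hypographs through exterior normals controlled by an inner direction. -/
theorem isLocallyHypograph_of_normals {D : Set F} {x₀ v : F} {C ρ ε₀ : ℝ} (hC : 0 ≤ C)
    (hρ : 0 < ρ) (hε₀ : 0 < ε₀)
    (h : ∀ y ∈ ball x₀ ε₀, y ∉ D → ∃ p ∈ D, ‖y - p‖ ≤ ‖y - x₀‖ ∧ ⟪y - p, v⟫ ≤ -ρ * ‖y - p‖ ∧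
      ∀ x ∈ D, x ∈ ball x₀ ε₀ → ⟪y - p, x - p⟫ ≤ C * ‖y - p‖ * ‖x - p‖ ^ 2) :
    IsLocallyHypograph D x₀ := by
  by_cases hD : D ∈ 𝓝 x₀
  · exact Or.inl hD
  have hx₀ : ∀ ε > 0, ∃ y ∈ ball x₀ ε, y ∉ D := by
    intro ε hε
    by_contra! hcon
    exact hD (Metric.mem_nhds_iff.2 ⟨ε, hε, hcon⟩)
  have hv : 0 < ‖v‖ := by
    rw [norm_pos_iff]
    rintro rfl
    obtain ⟨y, hy, hyD⟩ := hx₀ ε₀ hε₀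
    obtain ⟨p, hp, -, h1, -⟩ := h y hy hyD
    rw [inner_zero_right] at h1
    have : 0 < ‖y - p‖ := norm_pos_iff.2 (sub_ne_zero.2 fun hh => hyD (hh ▸ hp))
    nlinarith
  set u : F := (-‖v‖⁻¹) • v with hu
  have hu1 : ‖u‖ = 1 := by
    rw [hu, norm_smul, norm_neg, norm_inv, norm_norm, inv_mul_cancel₀ hv.ne']
  obtain ⟨ε, hε, f, hf⟩ := exists_hypograph (D := D) (x₀ := x₀) hu1 (ρ := ρ / ‖v‖) hC
    (by positivity) hε₀ (fun y hy hyD => by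
      obtain ⟨p, hp, h1, h2, h3⟩ := h y hy hyD
      refine ⟨p, hp, h1, ?_, h3⟩
      rw [hu, real_inner_smul_right, div_mul_eq_mul_div, div_le_iff₀ hv]
      have : -‖v‖⁻¹ * ⟪y - p, v⟫ * ‖v‖ = -⟪y - p, v⟫ := by field_simp
      rw [this]; linarith) hx₀
  exact Or.inr ⟨ε, hε, u, hu1, f, hf⟩

end Shape

/-! ### Local models at points of maximal tangent dimension -/

section Model

variable {E : Type*} [NormedAddCommGroup E] [InnerProductSpace ℝ E] [FiniteDimensional ℝ E]

/-- At a point with full-dimensional tangent cone, a set of positive reach is locally a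
neighbourhood of the point or a hypograph. -/
theorem isLocallyHypograph_of_finrank_eq {A : Set E} {r : ℝ} (hr : 0 < r)
    (hU : ∀ a ∈ A, ball a r ⊆ unp A) {a : E} (ha : a ∈ A)
    (hdim : Submodule.span ℝ (posTangentConeAt A a) = ⊤) : IsLocallyHypograph A a := by
  have hA := isClosed_of_ball_subset_unp hr hU
  obtain ⟨v, -, ρ, hρ, hv⟩ := exists_ball_subset_posTangentConeAt hr hU ha
  rw [hdim] at hv
  obtain ⟨ε, hε, h⟩ := exists_inner_le_of_mem A (1 / r) a (L := ⊤) (v := ⟨v, trivial⟩) hρ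
    (fun e he m hm => hm.inner_nonpos (hv e trivial he))
  refine isLocallyHypograph_of_normals (v := v) (C := 1 / r) (ρ := ρ / 2) (ε₀ := ε / 2)
    (by positivity) (by positivity) (by positivity) fun y hy hyA => ?_
  obtain ⟨p, hp, hpy⟩ := exists_nearest hA ⟨a, ha⟩ y
  have hnear : ∀ b ∈ A, ‖y - p‖ ≤ ‖y - b‖ := fun b hb => by
    rw [hpy, ← dist_eq_norm]; exact infDist_le_dist_of_mem hb
  have hn := isProxNormal_of_nearest hr hU hp hnear
  rw [mem_ball, dist_eq_norm] at hy
  have hpa : ‖p - a‖ < ε := by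
    have h1 : ‖p - a‖ ≤ ‖y - p‖ + ‖y - a‖ := by
      rw [norm_sub_rev y p]; exact norm_sub_le_norm_sub_add_norm_sub _ _ _
    have := hnear a ha
    linarith
  exact ⟨p, hp, hnear a ha, h p hpa ⟨y - p, trivial⟩ hn, fun x hx _ => hn x hx⟩

/-- The local structure of a set of positive reach at a point where the dimension of the tangent
cone is maximal: a `C^{1,1}` graph over a subset of the tangent space which is locally a
hypograph. -/
theorem exists_local_model {A : Set E} {r : ℝ} (hr : 0 < r) (hU : ∀ a ∈ A, ball a r ⊆ unp A)
    {a : E} (ha : a ∈ A) {L : Submodule ℝ E}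
    (hL : L = Submodule.span ℝ (posTangentConeAt A a))
    (hdim : ∀ b ∈ A, Module.finrank ℝ (Submodule.span ℝ (posTangentConeAt A b)) ≤
      Module.finrank ℝ L) :
    ∃ (D : Set L) (φ : L → E), proj L a ∈ D ∧ IsLocallyHypograph D (proj L a) ∧
      C11On φ univ ∧ (∀ x, φ x ∈ Lᗮ) ∧ (∀ x ∈ D, (x : E) + φ x ∈ A) ∧
      ∃ ε > 0, ∀ b ∈ A ∩ ball a ε, proj L b ∈ D ∧ (proj L b : E) + φ (proj L b) = b := by
  have hA := isClosed_of_ball_subset_unp hr hU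
  obtain ⟨v₀, hv₀, ρ, hρ, hv⟩ := exists_ball_subset_posTangentConeAt hr hU ha
  rw [← hL] at hv₀ hv
  set v : L := ⟨v₀, hv₀⟩ with hvdef
  have hpol : ∀ e : L, ‖e‖ ≤ ρ → ∀ m, IsProxNormal A (1 / r) a m → ⟪m, ((v + e : L) : E)⟫ ≤ 0 :=
    fun e he m hm => hm.inner_nonpos (hv e e.2 he)
  obtain ⟨ε₁, hε₁, hinner⟩ := exists_inner_le_of_mem A (1 / r) a hρ hpol
  obtain ⟨ε₂, hε₂, hbilip, hjet⟩ := exists_taylor_graph hr hU hρ hpol hdim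
  set ε := min (ε₁ / 2) ε₂ with hε
  have hε0 : 0 < ε := lt_min (by positivity) hε₂
  set S := A ∩ closedBall a ε with hS
  have hSsub : S ⊆ A ∩ closedBall a ε₂ :=
    inter_subset_inter_right _ (closedBall_subset_closedBall (min_le_right _ _))
  have hScomp : IsCompact S := (isCompact_closedBall a ε).inter_left hA
  have haS : a ∈ S := ⟨ha, mem_closedBall_self hε0.le⟩
  have hbl : ∀ b ∈ S, ∀ b' ∈ S, ‖b' - b‖ ≤ 2 * ‖proj L b' - proj L b‖ := fun b hb b' hb' =>
    hbilip b (hSsub hb) b' (hSsub hb')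
  set x₀ := proj L a with hx₀
  set D₀ := proj L '' S with hD₀
  have hD₀comp : IsCompact D₀ := hScomp.image (proj L).continuous
  have hD₀ne : D₀.Nonempty := ⟨x₀, a, haS, rfl⟩
  have hshape : IsLocallyHypograph D₀ x₀ := by
    refine isLocallyHypograph_of_normals (v := v) (C := 4 / r) (ρ := ρ / 2) (ε₀ := ε / 8)
      (by positivity) (by positivity) (by positivity) fun y hy hyD => ?_
    obtain ⟨p, hp, hpy⟩ := exists_nearest hD₀comp.isClosed hD₀ne y
    have hnear : ∀ x ∈ D₀, ‖y - p‖ ≤ ‖y - x‖ := fun x hx => by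
      rw [hpy, ← dist_eq_norm]; exact infDist_le_dist_of_mem hx
    obtain ⟨b, hb, rfl⟩ := hp
    rw [mem_ball, dist_eq_norm] at hy
    have hyx := hnear x₀ ⟨a, haS, rfl⟩
    have hba : ‖b - a‖ ≤ ε / 2 := by
      have h1 : ‖proj L b - x₀‖ ≤ ‖y - proj L b‖ + ‖y - x₀‖ := by
        rw [norm_sub_rev y (proj L b)]; exact norm_sub_le_norm_sub_add_norm_sub _ _ _
      have h2 := hbl a haS b hb
      linarith
    -- An exterior normal of the projection `D₀`, viewed in `E`, is a normal of `A`, since `proj L`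
    -- is 1-Lipschitz. The radius `ε / 8` gives `‖b - a‖ ≤ ε / 2`, so all points of `A` near `b`
    -- take part in the minimization.
    have hn : IsProxNormal A (1 / r) b ((y - proj L b : L) : E) := by
      refine isProxNormal_of_local hr hU hb.1 (C := 1 / 2) (half_pos hε0) fun b' hb' hbb' => ?_
      have hb'S : b' ∈ S := by
        refine ⟨hb', ?_⟩
        rw [mem_closedBall, dist_eq_norm]
        have := norm_sub_le_norm_sub_add_norm_sub b' b a
        linarith
      have h1 := pow_le_pow_left₀ (norm_nonneg _) (hnear (proj L b') ⟨b', hb'S, rfl⟩) 2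
      rw [show y - proj L b' = (y - proj L b) - (proj L b' - proj L b) by abel,
        norm_sub_sq_real (y - proj L b)] at h1
      have h2 : ‖proj L b' - proj L b‖ ^ 2 ≤ ‖b' - b‖ ^ 2 := by
        rw [← map_sub]; gcongr; exact norm_proj_le _ _
      rw [inner_coe_eq_inner_proj, map_sub]
      linarith
    have hbε₁ : ‖b - a‖ < ε₁ := by
      have : ε ≤ ε₁ / 2 := min_le_left _ _
      linarith
    refine ⟨proj L b, ⟨b, hb, rfl⟩, hyx, hinner b hbε₁ _ hn, ?_⟩
    rintro _ ⟨b', hb', rfl⟩ -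
    have h1 := hn b' hb'.1
    rw [inner_coe_eq_inner_proj, map_sub, Submodule.norm_coe] at h1
    have h2 := hbl b hb b' hb'
    refine h1.trans ?_
    calc 1 / r * ‖y - proj L b‖ * ‖b' - b‖ ^ 2
        ≤ 1 / r * ‖y - proj L b‖ * (2 * ‖proj L b' - proj L b‖) ^ 2 := by gcongr
      _ = _ := by ring
  obtain ⟨w, ρ', hρ', δ, hδ, hcone⟩ := hshape.exists_cone
  have hsec : ∀ x : L, ∃ b, x ∈ D₀ → b ∈ S ∧ proj L b = x := by
    intro x
    by_cases hx : x ∈ D₀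
    · obtain ⟨b, hb, hbx⟩ := hx
      exact ⟨b, fun _ => ⟨hb, hbx⟩⟩
    · exact ⟨0, fun h => absurd h hx⟩
  choose σ hσ using hsec
  have hσS : ∀ x ∈ D₀, σ x ∈ S := fun x hx => (hσ x hx).1
  have hσP : ∀ x ∈ D₀, proj L (σ x) = x := fun x hx => (hσ x hx).2
  have hext : ∀ y ∈ Lᗮ, ∃ Φ : L → ℝ, C11On Φ univ ∧ ∀ x ∈ D₀ ∩ ball x₀ δ, Φ x = ⟪y, σ x⟫ := by
    intro y hy
    obtain ⟨G, hG⟩ := hjet y hy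
    set C := 8 / r * ‖y‖ with hC
    have hC0 : 0 ≤ C := by positivity
    have htaylor : ∀ x ∈ D₀, ∀ x' ∈ D₀,
        |⟪y, σ x'⟫ - ⟪y, σ x⟫ - ⟪G (σ x), x' - x⟫| ≤ C * ‖x' - x‖ ^ 2 := by
      intro x hx x' hx'
      have := hG (σ x) (hSsub (hσS x hx)) (σ x') (hSsub (hσS x' hx'))
      rwa [hσP x hx, hσP x' hx'] at this
    -- The second entry is the Lipschitz constant of the gradient from `norm_gradient_sub_le`. The
    -- cone points may leave `ball x₀ δ` but stay in `D₀`, so the Taylor bound is taken on all of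
    -- `D₀`.
    set M := max C (2 * C * ((‖w‖ + ρ') ^ 2 + (1 + (‖w‖ + ρ')) ^ 2 + 1) / ρ') with hM
    refine exists_c11On_extension (f := fun x => ⟪y, σ x⟫) (G := fun x => G (σ x)) (M := M)
      (hC0.trans (le_max_left _ _)) (fun x hx x' hx' => ?_) (fun x hx x' hx' => ?_)
    · refine (htaylor x hx.1 x' hx'.1).trans ?_
      gcongr
      exact le_max_left _ _
    · have := norm_gradient_sub_le (f := fun x => ⟪y, σ x⟫) (G := fun x => G (σ x)) hC0 htaylor
        hρ' hx.1 hx'.1 (fun e he => hcone x hx x' hx' e he)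
      rw [norm_sub_rev x x'] at this
      refine this.trans ?_
      gcongr
      exact le_max_right _ _
  set B := stdOrthonormalBasis ℝ Lᗮ with hB
  choose Φ hΦ hΦσ using fun i => hext (B i) (B i).2
  set φ : L → E := fun x => ∑ i, Φ i x • (B i : E) with hφ
  have hφL : ∀ x, φ x ∈ Lᗮ := fun x => Submodule.sum_mem _ fun i _ => Submodule.smul_mem _ _ (B i).2
  have hφσ : ∀ x ∈ D₀ ∩ ball x₀ δ, (x : E) + φ x = σ x := by
    intro x hx
    set y : Lᗮ := ⟨σ x - (proj L (σ x) : E), sub_proj_mem L _⟩ with hy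
    have h1 := B.sum_repr' y
    have h2 : φ x = (y : E) := by
      rw [← h1]
      simp only [hφ]
      rw [Submodule.coe_sum]
      refine Finset.sum_congr rfl fun i _ => ?_
      rw [Submodule.coe_smul, hΦσ i x hx, Submodule.coe_inner, hy, inner_sub_proj (B i).2]
    rw [h2, hy]
    simp only [hσP x hx.1]
    abel
  have hφC : C11On φ univ := by
    have hterm : ∀ s : Finset (Fin (Module.finrank ℝ Lᗮ)),
        C11On (fun x => ∑ i ∈ s, Φ i x • (B i : E)) univ := by
      intro s
      induction s using Finset.induction_on with
      | empty => simpa using c11On_const (E := L) (0 : E)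
      | insert i s his ih =>
        simp only [Finset.sum_insert his]
        exact ((hΦ i).clm_comp (ContinuousLinearMap.toSpanSingleton ℝ (B i : E))).add ih
    exact hterm Finset.univ
  refine ⟨D₀ ∩ ball x₀ δ, φ, ⟨⟨a, haS, rfl⟩, mem_ball_self hδ⟩, hshape.inter_ball hδ, hφC, hφL,
    fun x hx => ?_, min ε δ, lt_min hε0 hδ, fun b hb => ?_⟩
  · rw [hφσ x hx]; exact (hσS x hx.1).1
  · have hbS : b ∈ S := ⟨hb.1, ball_subset_closedBall (ball_subset_ball (min_le_left _ _) hb.2)⟩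
    have hPb : proj L b ∈ D₀ ∩ ball x₀ δ := by
      refine ⟨⟨b, hbS, rfl⟩, ?_⟩
      have h1 := ball_subset_ball (min_le_right ε δ) hb.2
      rw [mem_ball, dist_eq_norm] at h1 ⊢
      rw [hx₀, ← map_sub]
      exact (norm_proj_le _ _).trans_lt h1
    refine ⟨hPb, ?_⟩
    rw [hφσ _ hPb]
    have h1 := hbl b hbS (σ (proj L b)) (hσS _ hPb.1)
    rw [hσP _ hPb.1, sub_self, norm_zero, mul_zero] at h1
    exact sub_eq_zero.1 (norm_le_zero_iff.1 h1)

end Model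

/-! ### The standard inclusion and isometries of `ℝᵈ` -/

section Euclidean

variable {k d : ℕ}

theorem stdIncl_apply (x : EuclideanSpace ℝ (Fin k)) (i : Fin d) :
    stdIncl k d x i = if h : (i : ℕ) < k then x ⟨i, h⟩ else 0 := rfl

/-- The standard inclusion as a linear isometry. -/
noncomputable def stdInclIsometry (h : k ≤ d) :
    EuclideanSpace ℝ (Fin k) →ₗᵢ[ℝ] EuclideanSpace ℝ (Fin d) where
  toFun := stdIncl k d
  map_add' x y := by
    ext i
    simp only [PiLp.add_apply, stdIncl_apply]
    split_ifs <;> simp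
  map_smul' c x := by
    ext i
    simp only [PiLp.smul_apply, stdIncl_apply, RingHom.id_apply, smul_eq_mul]
    split_ifs <;> simp
  norm_map' x := by
    obtain ⟨m, rfl⟩ := Nat.exists_eq_add_of_le h
    change ‖stdIncl k (k + m) x‖ = ‖x‖
    rw [EuclideanSpace.norm_eq, EuclideanSpace.norm_eq, Fin.sum_univ_add]
    simp [stdIncl_apply]

/-- An isometry from `ℝᵏ` onto a `k`-dimensional subspace of `ℝᵈ` is the restriction of an isometry
of `ℝᵈ`. -/
theorem exists_isometryEquiv (h : k ≤ d) {L : Submodule ℝ (EuclideanSpace ℝ (Fin d))}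
    (hL : Module.finrank ℝ L = k) :
    ∃ (j : EuclideanSpace ℝ (Fin k) ≃ₗᵢ[ℝ] L)
      (ι : EuclideanSpace ℝ (Fin d) ≃ₗᵢ[ℝ] EuclideanSpace ℝ (Fin d)),
      ∀ x, ι (stdIncl k d x) = j x := by
  have j : EuclideanSpace ℝ (Fin k) ≃ₗᵢ[ℝ] L :=
    ((stdOrthonormalBasis ℝ L).reindex (finCongr hL)).repr.symm
  set s := stdInclIsometry h with hs
  set e := s.equivRange
  set g : LinearMap.range s.toLinearMap →ₗᵢ[ℝ] EuclideanSpace ℝ (Fin d) :=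
    (L.subtypeₗᵢ.comp j.toLinearIsometry).comp e.symm.toLinearIsometry with hg
  refine ⟨j, g.extend.toLinearIsometryEquiv rfl, fun x => ?_⟩
  have h1 : stdIncl k d x = (e x : EuclideanSpace ℝ (Fin d)) := rfl
  rw [h1]
  change g.extend (e x) = _
  rw [LinearIsometry.extend_apply]
  simp [hg]

end Euclidean

/-! ### Tangent dimension versus covering dimension; lifting shears -/

section Model

variable {E : Type*} [NormedAddCommGroup E] [InnerProductSpace ℝ E] [FiniteDimensional ℝ E]

/-- The dimension of the tangent cones of a set of positive reach is at most its topological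
dimension. -/
theorem finrank_span_posTangentConeAt_le {A : Set E} {r : ℝ} (hr : 0 < r)
    (hU : ∀ a ∈ A, ball a r ⊆ unp A) {n : ℕ} (hn : CoveringDimLE A n) {b : E} (hb : b ∈ A) :
    Module.finrank ℝ (Submodule.span ℝ (posTangentConeAt A b)) ≤ n := by
  set g : A → ℕ := fun c => Module.finrank ℝ (Submodule.span ℝ (posTangentConeAt A (c : E))) with hg
  have hfin : (range g).Finite := (finite_Iic (Module.finrank ℝ E)).subset (by
    rintro _ ⟨c, rfl⟩
    exact Submodule.finrank_le _)
  -- A point `c` of largest tangent dimension has a local model with no topological hypothesis, and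
  -- its graph map embeds a ball of that dimension in `A`.
  obtain ⟨_, ⟨c, rfl⟩, hc⟩ := hfin.exists_maximal ⟨_, ⟨b, hb⟩, rfl⟩
  have hmax : ∀ x ∈ A, Module.finrank ℝ (Submodule.span ℝ (posTangentConeAt A x)) ≤ g c :=
    fun x hx => (le_total (g ⟨x, hx⟩) (g c)).elim id fun h => hc ⟨⟨x, hx⟩, rfl⟩ h
  obtain ⟨D, φ, hD, hshape, hφ, hφL, hφA, -⟩ := exists_local_model hr hU c.2 rfl hmax
  obtain ⟨z, δ, hδ, hz⟩ := hshape.exists_closedBall hD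
  refine (hmax b hb).trans (hn.finrank_le (x₀ := z) hδ (e := fun x => (x : E) + φ x) ?_ ?_ ?_)
  · exact (continuous_subtype_val.add (c11On_univ_iff.1 hφ).1.continuous).continuousOn
  · intro x _ y _ hxy
    have := congrArg (proj (Submodule.span ℝ (posTangentConeAt A (c : E)))) hxy
    simpa only [map_add, proj_coe, proj_of_mem_orthogonal (hφL _), add_zero] using this
  · exact fun x hx => hφA x (hz hx)

theorem IsShear.comp_proj {L : Submodule ℝ E} {q : L → L} (hq : IsShear q) :
    IsShear fun z : E => (q (proj L z) : E) where
  c11On := (hq.c11On.clm_comp L.subtypeL).comp_clm (proj L)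
  add_self z := by simp only [map_add, proj_coe, hq.add_self]
  sub_self z := by simp only [map_sub, proj_coe, hq.sub_self]

theorem isShear_graph {L : Submodule ℝ E} {φ : L → E} (hφ : C11On φ univ)
    (hφL : ∀ x, φ x ∈ Lᗮ) : IsShear fun z : E => φ (proj L z) where
  c11On := hφ.comp_clm (proj L)
  add_self z := by simp only [map_add, proj_of_mem_orthogonal (hφL _), add_zero]
  sub_self z := by simp only [map_sub, proj_of_mem_orthogonal (hφL _), sub_zero]

end Model

/-! ### Assembly of the diffeomorphisms -/

section Main

theorem IsConvexBody.preimage {V W : Type*} [NormedAddCommGroup V] [NormedSpace ℝ V]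
    [NormedAddCommGroup W] [NormedSpace ℝ W] {K : Set W} (hK : IsConvexBody K) (j : V ≃ₗᵢ[ℝ] W) :
    IsConvexBody (j ⁻¹' K) := by
  refine ⟨j.toHomeomorph.isCompact_preimage.2 hK.1,
    hK.2.1.linear_preimage (j.toLinearEquiv : V →ₗ[ℝ] W), ?_⟩
  have h1 := j.toHomeomorph.preimage_interior K
  have h2 : (j ⁻¹' interior K).Nonempty := hK.2.2.preimage j.surjective
  exact h1 ▸ h2

variable {d : ℕ} {A : Set (EuclideanSpace ℝ (Fin d))} {a : EuclideanSpace ℝ (Fin d)}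

theorem isLocallyHypograph_of_mem_tangentStratum (hA : HasPositiveReach A)
    (ha : a ∈ tangentStratum d A) : IsLocallyHypograph A a := by
  obtain ⟨r, hr, hU⟩ := hA.exists_ball_subset
  refine isLocallyHypograph_of_finrank_eq hr hU ha.1 (Submodule.eq_top_of_finrank_eq ?_)
  rw [ha.2, finrank_euclideanSpace_fin]

/-- `Φ` places `ℝᵏ` on `L` by an isometry, bends the convex body into a neighbourhood in `D` by a
shear inside `L`, and lifts it to the graph by a shear along `Lᗮ`. The composite is shown to be only
locally `C^{1,1}`, so `U` is taken to be a ball. -/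
theorem exists_convexBody_diffeo {k : ℕ} (hkd : k ≤ d) (hdim : CoveringDimLE A k)
    (hA : HasPositiveReach A) (ha : a ∈ tangentStratum k A) :
    ∃ (K : Set (EuclideanSpace ℝ (Fin k))) (U : Set (EuclideanSpace ℝ (Fin d)))
      (Φ : EuclideanSpace ℝ (Fin d) → EuclideanSpace ℝ (Fin d)),
      IsConvexBody K ∧ stdIncl k d '' K ⊆ U ∧ IsC11Diffeo Φ U ∧
        IsNhdIn (Φ '' (stdIncl k d '' K)) a A := by
  obtain ⟨r, hr, hU⟩ := hA.exists_ball_subset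
  set L := Submodule.span ℝ (posTangentConeAt A a) with hL
  have hLk : Module.finrank ℝ L = k := ha.2
  obtain ⟨D, φ, hD, hshape, hφ, hφL, hφA, ε, hε, hgraph⟩ :=
    exists_local_model hr hU ha.1 hL
      (fun b hb => (finrank_span_posTangentConeAt_le hr hU hdim hb).trans hLk.ge)
  obtain ⟨K₀, q, hK₀, hq, -, hK₀D, hK₀n⟩ := hshape.exists_body hD
  obtain ⟨j, ι, hι⟩ := exists_isometryEquiv hkd hLk
  have hS := hq.comp_proj
  have hT := isShear_graph hφ hφL
  have hK : IsConvexBody (j ⁻¹' K₀) := hK₀.preimage j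
  have hbdd : Bornology.IsBounded (stdIncl k d '' (j ⁻¹' K₀)) :=
    (hK.1.image (stdInclIsometry hkd).continuous).isBounded
  obtain ⟨R, hR⟩ := hbdd.subset_ball 0
  have hιC : IsLocC11 ι := (c11On_clm ι.toContinuousLinearEquiv.toContinuousLinearMap).isLocC11
  have hιC' : IsLocC11 ι.symm := 
    (c11On_clm ι.symm.toContinuousLinearEquiv.toContinuousLinearMap).isLocC11
  set Φ : EuclideanSpace ℝ (Fin d) → EuclideanSpace ℝ (Fin d) :=
    (fun z => z + φ (proj L z)) ∘ (fun z => z + (q (proj L z) : EuclideanSpace ℝ (Fin d))) ∘ ι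
    with hΦ
  have hΦj : ∀ x, Φ (stdIncl k d x) = ((j x + q (j x) : L) : EuclideanSpace ℝ (Fin d)) +
      φ (j x + q (j x)) := by
    intro x
    simp only [hΦ, Function.comp_apply, hι, proj_coe, map_add, Submodule.coe_add]
  refine ⟨j ⁻¹' K₀, ball 0 R, Φ, hK, hR, ?_, ha.1, ?_, ?_⟩
  · exact isC11Diffeo_of_inverse (hT.c11On_add.isLocC11.comp (hS.c11On_add.isLocC11.comp hιC))
      (hιC'.comp (hS.c11On_sub.isLocC11.comp hT.c11On_sub.isLocC11))
      (hT.leftInverse.comp (hS.leftInverse.comp ι.symm_apply_apply))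
      (hT.rightInverse.comp (hS.rightInverse.comp ι.apply_symm_apply))
      isOpen_ball ball_subset_closedBall
  · rintro _ ⟨_, ⟨x, hx, rfl⟩, rfl⟩
    rw [hΦj]
    exact hφA _ (hK₀D ⟨j x, hx, rfl⟩)
  · obtain ⟨V, hV, hVs⟩ := mem_nhdsWithin_iff_exists_mem_nhds_inter.1 hK₀n
    rw [mem_nhdsWithin_iff_exists_mem_nhds_inter]
    refine ⟨proj L ⁻¹' V ∩ ball a ε,
      inter_mem ((proj L).continuous.continuousAt.preimage_mem_nhds hV) (ball_mem_nhds a hε), ?_⟩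
    rintro b ⟨⟨hbV, hbε⟩, hbA⟩
    obtain ⟨hbD, hb⟩ := hgraph b ⟨hbA, hbε⟩
    obtain ⟨y, hy, hyb⟩ := hVs ⟨hbV, hbD⟩
    refine ⟨_, ⟨j.symm y, by simpa using hy, rfl⟩, ?_⟩
    rw [hΦj, j.apply_symm_apply]
    simp only at hyb
    rw [hyb, hb]

end Main

end PositiveReach

theorem proposition6p1 :
    -- The local structure at boundary points with full-dimensional tangent cone.
    (∀ (d : ℕ), 1 ≤ d → ∀ (A : Set (EuclideanSpace ℝ (Fin d))) (a : EuclideanSpace ℝ (Fin d)),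
      PositiveReach.HasPositiveReach A →
      a ∈ PositiveReach.tangentStratum d A ∩ frontier A →
      (2 ≤ d → ∃ (ε : ℝ) (u : EuclideanSpace ℝ (Fin d)) (f : (ℝ ∙ u)ᗮ → ℝ),
        0 < ε ∧ ‖u‖ = 1 ∧ (∃ L : ℝ≥0, LipschitzWith L f) ∧
        PositiveReach.SemiconcaveOn Set.univ f ∧
        A ∩ Metric.ball a ε = PositiveReach.hypograph u f ∩ Metric.ball a ε) ∧
      (∃ (K : Set (EuclideanSpace ℝ (Fin d)))
          (Φ : EuclideanSpace ℝ (Fin d) → EuclideanSpace ℝ (Fin d)),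
        PositiveReach.IsConvexBody K ∧
        PositiveReach.IsC11Diffeo Φ Set.univ ∧ Function.Surjective Φ ∧
        PositiveReach.IsNhdIn (Φ '' K) a A)) ∧
    -- Lytchak's theorem.
    (∀ (d k : ℕ), 1 ≤ k → k ≤ d →
      ∀ (A : Set (EuclideanSpace ℝ (Fin d))) (a : EuclideanSpace ℝ (Fin d)),
      PositiveReach.HasTopologicalDim A k →
      PositiveReach.HasPositiveReach A →
      a ∈ PositiveReach.tangentStratum k A →
      ∃ (K : Set (EuclideanSpace ℝ (Fin k))) (U : Set (EuclideanSpace ℝ (Fin d)))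
          (Φ : EuclideanSpace ℝ (Fin d) → EuclideanSpace ℝ (Fin d)),
        PositiveReach.IsConvexBody K ∧
        PositiveReach.stdIncl k d '' K ⊆ U ∧
        PositiveReach.IsC11Diffeo Φ U ∧
        PositiveReach.IsNhdIn (Φ '' (PositiveReach.stdIncl k d '' K)) a A) := by
  refine ⟨fun d _ A a hA ha => ?_, fun d k _ hkd A a hdim hA ha =>
    PositiveReach.exists_convexBody_diffeo hkd hdim.2.1 hA ha⟩
  have h := PositiveReach.isLocallyHypograph_of_mem_tangentStratum hA ha.1
  refine ⟨fun _ => ?_, ?_⟩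
  · rcases h with h | ⟨ε, hε, u, hu, f, hf⟩
    -- The boundary hypothesis excludes the neighbourhood alternative.
    · exact absurd (mem_interior_iff_mem_nhds.2 h) ha.2.2
    · exact ⟨ε, u, f, hε, hu, hf⟩
  · obtain ⟨K, q, hK, hq, hn⟩ := h.exists_body ha.1.1
    exact ⟨K, fun z => z + q z, hK, hq.isC11Diffeo, hq.rightInverse.surjective, hn⟩
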